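/- **Setting.** All rings are unital and associative. A *left bialgebroid* $\mathcal H_L=(H,L,s_L,t_L,\gamma_L,\pi_L)$ consists of rings $H,L$, ring maps $s_L:L\to H$ and $t_L:L^{op}\to H$ with commuting ranges, and a comonoid $(H,\gamma_L,\pi_L)$ in $L$-$L$-bimodules, where $l\cdot h\cdot l'=s_L(l)t_L(l')h$, such that $\gamma_L(h)=h_{(1)}\otimes h_{(2)}$ satisfies $h_{(1)}t_L(l)\otimes h_{(2)}=h_{(1)}\otimes h_{(2)}s_L(l)$, $\gamma_L$ is multiplicative and unital, $\pi_L(1)=1$ and $\pi_L(h\,s_L\pi_L(k))=\pi_L(hk)=\pi_L(h\,t_L\pi_L(k))$. A *right bialgebroid* $\mathcal H_R=(H,R,s_R,t_R,\gamma_R,\pi_R)$ is defined symmetrically, with $r\cdot h\cdot r'=h\,s_R(r')t_R(r)$, $\gamma_R(h)=h^{(1)}\otimes h^{(2)}$, $s_R(r)h^{(1)}\otimes h^{(2)}=h^{(1)}\otimes t_R(r)h^{(2)}$ and $\pi_R(s_R\pi_R(h)\,k)=\pi_R(hk)=\pi_R(t_R\pi_R(h)\,k)$. A *Hopf algebroid*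 $\mathcal H=(\mathcal H_L,\mathcal H_R,S)$ consists of a left and a right bialgebroid on the same ring $H$ with $R\cong L^{op}$, $s_L(L)=t_R(R^{op})$, $t_L(L^{op})=s_R(R)$, $(\gamma_L\otimes\mathrm{id})\gamma_R=(\mathrm{id}\otimes\gamma_R)\gamma_L$, $(\gamma_R\otimes\mathrm{id})\gamma_L=(\mathrm{id}\otimes\gamma_L)\gamma_R$, and an additive bijection $S:H\to H$ such that $S(t_L(l)\,h\,t_L(l'))=s_L(l')S(h)s_L(l)$, $S(t_R(r')\,h\,t_R(r))=s_R(r)S(h)s_R(r')$, $S(h_{(1)})h_{(2)}=s_R\pi_R(h)$ and $h^{(1)}S(h^{(2)})=s_L\pi_L(h)$. Let $\mathcal H$ be a Hopf algebroid and let $i\in H$ be a *non-degenerate right integral*: $ih=i\,s_R\pi_R(h)$ for all $h\in H$, and the maps $${}_Li:{}_*\mathcal H=\mathrm{Hom}_{L-}({}_LH,L)\to H,\ \varphi\mapsto t_L(\varphi(i_{(2)}))\,i_{(1)},\qquad i_L:\mathcal H_*=\mathrm{Hom}_{-L}(H_L,L)\to H,\ \varphi\mapsto s_L(\varphi(i_{(1)}))\,i_{(2)}$$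 are bijective. Define the convolution product $h*k={}_Li\big({}_Li^{-1}(h)\,{}_Li^{-1}(k)\big)$, where ${}_*\mathcal H$ carries the product $(\varphi\psi)(h)=\psi\big(t_L(\varphi(h_{(2)}))h_{(1)}\big)$, and $\eta:R\to H$, $\eta(r)=i\,s_R(r)$. Let $\mathcal M_H$ be the monoidal category of right $H$-modules with product $\otimes_R$ (where $r\cdot m\cdot r'=m\,s_R(r')t_R(r)$), diagonal action $(m\otimes n)h=mh^{(1)}\otimes nh^{(2)}$ and unit object $R_H$, $r\cdot h=\pi_R(s_R(r)h)$; write $l_M:R\otimes_R M\to M$ and $r_M:M\otimes_R R\to M$ for its unit constraints. Let $\mathbf{BIM}(\mathcal M_H)$ be the additive bicategory of internal bimodules: 0-cells are monoids in $\mathcal M_H$, 1-cells are bimodules, 2-cells are bimodule maps, and horizontal composition $\times$ of an $\mathcal A$-$\mathcal B$- and a $\mathcal B$-$\mathcal C$-bimodule is the tensor product over $\mathcal B$ (a coequalizer), with associator $\alpha$. Let $\mathcal U$ be the trivial monoid on $R_H$. **Claim.** The triple $\mathcal Q=(H_H,*,\eta)$ is a monoid in $\mathcal M_H$. The $\mathcal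 U$-$\mathcal Q$-bimodule $\mathcal X=(H_H,l_H,*)$ is a Frobenius 1-morphism of $\mathbf{BIM}(\mathcal M_H)$ with two-sided dual the $\mathcal Q$-$\mathcal U$-bimodule $\bar{\mathcal X}=(H_H,*,r_H)$. Explicitly, let $t:\mathcal X\times\bar{\mathcal X}\cong(H_H,l_H,r_H)$ be the isomorphism induced by $*$, and identify the object underlying $\bar{\mathcal X}\times\mathcal X$ with $H_H\otimes_R H_H$. Then $$\mathrm{ev}_L=*:\bar{\mathcal X}\times\mathcal X\to\mathcal Q,\qquad \mathrm{coev}_L=t^{-1}\circ\eta:\mathcal U\to\mathcal X\times\bar{\mathcal X},$$ $$\mathrm{ev}_R=\pi_R\circ t:\mathcal X\times\bar{\mathcal X}\to\mathcal U,\qquad \mathrm{coev}_R=\gamma_R:\mathcal Q\to\bar{\mathcal X}\times\mathcal X$$ are 2-cells, where $\mathcal Q$ and $\mathcal U$ stand for the regular bimodules (the identity 1-cells); $(\mathrm{coev}_L,\mathrm{ev}_L)$ are unit and counit of an adjunction between $\mathcal X$ and $\bar{\mathcal X}$, and $(\mathrm{coev}_R,\mathrm{ev}_R)$ are unit and counit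 of an adjunction between $\bar{\mathcal X}$ and $\mathcal X$. Moreover $\mathcal X$ satisfies the D2 condition on both sides: $(\mathcal X\times\bar{\mathcal X})\times\mathcal X$ is a direct summand of a finite direct sum of copies of $\mathcal X$, and $(\bar{\mathcal X}\times\mathcal X)\times\bar{\mathcal X}$ is a direct summand of a finite direct sum of copies of $\bar{\mathcal X}$. Finally, let $\Lambda(h)$ be the 2-endomorphism of $\mathcal X\times\bar{\mathcal X}$ that corresponds under $t$ to left multiplication $k\mapsto hk$ on $H_H$. Let $A$ be the ring of 2-endomorphisms of $\mathcal X\times\bar{\mathcal X}$ and $E$ the ring of 2-endomorphisms of $\mathcal X$, acting on $A$ by $a\cdot e=a\circ(e\times\bar{\mathcal X})$ and $e\cdot a=(e\times\bar{\mathcal X})\circ a$. Then the element $$\Lambda(S(i_{(1)}))\otimes\Lambda(i_{(2)})\in A\otimes_EA$$ is well defined (it does not depend on how $\gamma_L(i)=i_{(1)}\otimes i_{(2)}$ is written as a finite sum of elementary tensors), and it is a D2 quasi-basis for $\mathcal X$: whenever it is written as $\sum_j y_j\otimes x_j$, $$\sum_j (y_j\times\mathcal X)\circ\alpha^{-1}\circ(\mathcal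 X\times\mathrm{coev}_R)\circ(\mathcal X\times\mathrm{ev}_L)\circ\alpha\circ(x_j\times\mathcal X)=\mathrm{id}_{(\mathcal X\times\bar{\mathcal X})\times\mathcal X}.$$ -/

import Mathlib

open CategoryTheory MonoidalCategory MulOpposite
open scoped TensorProduct

universe u v w

section BalancedTensor

variable {R : Type*} {R' : Type*} {M : Type*} {N : Type*} {P : Type*} {T : Type*}
  [AddCommGroup M] [AddCommGroup N] [AddCommGroup P] [AddCommGroup T]

/-- The additive map out of `M ⊗_ℤ N` induced by a biadditive map. -/
def intLift (f : M →+ N →+ P) : M ⊗[ℤ] N →+ P :=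
  TensorProduct.liftAddHom f (by intro r m n; simp)

@[simp] theorem intLift_tmul (f : M →+ N →+ P) (m : M) (n : N) :
    intLift f (m ⊗ₜ[ℤ] n) = f m n := rfl

theorem intTensor_hom_ext {f g : M ⊗[ℤ] N →+ P} (h : ∀ m n, f (m ⊗ₜ n) = g (m ⊗ₜ n)) : f = g := by
  ext z
  induction z using TensorProduct.induction_on with
  | zero => simp
  | tmul m n => exact h m n
  | add a b ha hb => rw [map_add, map_add, ha, hb]

/-- The relations `m·r ⊗ n = m ⊗ r·n`. -/
def balRel (ρ : R → M →+ M) (l : R → N →+ N) : Submodule ℤ (M ⊗[ℤ] N) :=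
  Submodule.span ℤ {z | ∃ r m n, z = ρ r m ⊗ₜ[ℤ] n - m ⊗ₜ[ℤ] l r n}

/-- The balanced tensor product `M ⊗_R N` of a right `R`-module `M` and a left `R`-module `N`,
`R` not necessarily commutative. The actions are explicit arguments, since the total ring of a
Hopf algebroid carries several module structures over the same base ring:
`ρ r m` is `m·r` and `l r n` is `r·n`. -/
def BalTensor (ρ : R → M →+ M) (l : R → N →+ N) : Type _ := (M ⊗[ℤ] N) ⧸ balRel ρ l

instance (ρ : R → M →+ M) (l : R → N →+ N) : AddCommGroup (BalTensor ρ l) :=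
  inferInstanceAs (AddCommGroup ((M ⊗[ℤ] N) ⧸ balRel ρ l))

namespace BalTensor

variable {ρ : R → M →+ M} {l : R → N →+ N}

/-- The class of `m ⊗ n` in `M ⊗_R N`. -/
def tmul (ρ : R → M →+ M) (l : R → N →+ N) (m : M) (n : N) : BalTensor ρ l :=
  Submodule.Quotient.mk (p := balRel ρ l) (m ⊗ₜ[ℤ] n)

theorem add_tmul (m m' : M) (n : N) : tmul ρ l (m + m') n = tmul ρ l m n + tmul ρ l m' n := by
  simp only [tmul, TensorProduct.add_tmul]; rfl

theorem tmul_add (m : M) (n n' : N) : tmul ρ l m (n + n') = tmul ρ l m n + tmul ρ l m n' := by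
  simp only [tmul, TensorProduct.tmul_add]; rfl

theorem smul_tmul (r : R) (m : M) (n : N) : tmul ρ l (ρ r m) n = tmul ρ l m (l r n) :=
  (Submodule.Quotient.eq _).2 (Submodule.subset_span ⟨r, m, n, rfl⟩)

/-- `tmul` as a biadditive map. -/
def tmulHom (ρ : R → M →+ M) (l : R → N →+ N) : M →+ N →+ BalTensor ρ l :=
  AddMonoidHom.mk' (fun m => AddMonoidHom.mk' (fun n => tmul ρ l m n) (tmul_add m))
    (fun m m' => by ext n; exact add_tmul m m' n)

@[simp] theorem tmulHom_apply (m : M) (n : N) : tmulHom ρ l m n = tmul ρ l m n := rfl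

theorem zero_tmul (n : N) : tmul ρ l 0 n = 0 := by
  rw [← tmulHom_apply, map_zero]; rfl

theorem tmul_zero (m : M) : tmul ρ l m 0 = 0 := by
  rw [← tmulHom_apply, map_zero]

theorem sum_tmul {ι : Type*} (s : Finset ι) (f : ι → M) (n : N) :
    tmul ρ l (∑ j ∈ s, f j) n = ∑ j ∈ s, tmul ρ l (f j) n := by
  simp only [← tmulHom_apply, map_sum, AddMonoidHom.finsetSum_apply]

theorem tmul_sum {ι : Type*} (s : Finset ι) (m : M) (f : ι → N) :
    tmul ρ l m (∑ j ∈ s, f j) = ∑ j ∈ s, tmul ρ l m (f j) := by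
  simp only [← tmulHom_apply, map_sum]

/-- The universal property of the balanced tensor product. -/
def lift (f : M →+ N →+ P) (hf : ∀ r m n, f (ρ r m) n = f m (l r n)) : BalTensor ρ l →+ P :=
  ((balRel ρ l).liftQ
    (intLift f).toIntLinearMap (by
      rw [balRel, Submodule.span_le]
      rintro _ ⟨r, m, n, rfl⟩
      simp [hf r m n])).toAddMonoidHom

@[simp] theorem lift_tmul (f : M →+ N →+ P) (hf : ∀ r m n, f (ρ r m) n = f m (l r n))
    (m : M) (n : N) : lift f hf (tmul ρ l m n) = f m n := rfl

theorem exists_rep (q : BalTensor ρ l) :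
    ∃ (n : ℕ) (x : Fin n → M) (y : Fin n → N), q = ∑ j, tmul ρ l (x j) (y j) := by
  obtain ⟨z, rfl⟩ := Submodule.Quotient.mk_surjective (balRel ρ l) q
  induction z using TensorProduct.induction_on with
  | zero => exact ⟨0, Fin.elim0, Fin.elim0, by simp; rfl⟩
  | tmul m n => exact ⟨1, fun _ => m, fun _ => n, by simp; rfl⟩
  | add a b ha hb =>
    obtain ⟨n, x, y, h⟩ := ha
    obtain ⟨n', x', y', h'⟩ := hb
    refine ⟨n + n', Fin.append x x', Fin.append y y', ?_⟩
    rw [Fin.sum_univ_add]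
    simp only [Fin.append_left, Fin.append_right]
    rw [← h, ← h']; rfl

theorem hom_ext {f g : BalTensor ρ l →+ P} (h : ∀ m n, f (tmul ρ l m n) = g (tmul ρ l m n)) :
    f = g := by
  ext q
  obtain ⟨n, x, y, rfl⟩ := exists_rep q
  simp [map_sum, h]

end BalTensor

/-- The relations `m·r ⊗ n ⊗ p = m ⊗ r·n ⊗ p` and `m ⊗ n·r' ⊗ p = m ⊗ n ⊗ r'·p`. -/
def balRel₃ (ρ₁ : R → M →+ M) (l₂ : R → N →+ N) (ρ₂ : R' → N →+ N) (l₃ : R' → P →+ P) :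
    Submodule ℤ (M ⊗[ℤ] (N ⊗[ℤ] P)) :=
  Submodule.span ℤ
    ({z | ∃ r m n p, z = ρ₁ r m ⊗ₜ[ℤ] (n ⊗ₜ[ℤ] p) - m ⊗ₜ[ℤ] (l₂ r n ⊗ₜ[ℤ] p)} ∪
      {z | ∃ r m n p, z = m ⊗ₜ[ℤ] (ρ₂ r n ⊗ₜ[ℤ] p) - m ⊗ₜ[ℤ] (n ⊗ₜ[ℤ] l₃ r p)})

/-- The threefold balanced tensor product `M ⊗_R N ⊗_{R'} P`. -/
def BalTensor₃ (ρ₁ : R → M →+ M) (l₂ : R → N →+ N) (ρ₂ : R' → N →+ N) (l₃ : R' → P →+ P) :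
    Type _ := (M ⊗[ℤ] (N ⊗[ℤ] P)) ⧸ balRel₃ ρ₁ l₂ ρ₂ l₃

instance (ρ₁ : R → M →+ M) (l₂ : R → N →+ N) (ρ₂ : R' → N →+ N) (l₃ : R' → P →+ P) :
    AddCommGroup (BalTensor₃ ρ₁ l₂ ρ₂ l₃) :=
  inferInstanceAs (AddCommGroup ((M ⊗[ℤ] (N ⊗[ℤ] P)) ⧸ balRel₃ ρ₁ l₂ ρ₂ l₃))

namespace BalTensor₃

variable (ρ₁ : R → M →+ M) (l₂ : R → N →+ N) (ρ₂ : R' → N →+ N) (l₃ : R' → P →+ P)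

/-- The class of `m ⊗ n ⊗ p` as a triadditive map. -/
def tmulHom : M →+ N →+ P →+ BalTensor₃ ρ₁ l₂ ρ₂ l₃ :=
  AddMonoidHom.mk' (fun m => AddMonoidHom.mk' (fun n => AddMonoidHom.mk' (fun p =>
      (Submodule.Quotient.mk (p := balRel₃ ρ₁ l₂ ρ₂ l₃) (m ⊗ₜ[ℤ] (n ⊗ₜ[ℤ] p)) :
        BalTensor₃ ρ₁ l₂ ρ₂ l₃))
      (fun p p' => by simp only [TensorProduct.tmul_add]; rfl))
      (fun n n' => by
        ext p; simp only [TensorProduct.tmul_add, TensorProduct.add_tmul]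
        rfl))
    (fun m m' => by
      ext n p; simp only [TensorProduct.add_tmul, AddMonoidHom.mk'_apply]; rfl)

/-- The canonical map `(M ⊗_R N) × P → M ⊗_R N ⊗_{R'} P`. -/
def assocL : BalTensor ρ₁ l₂ →+ P →+ BalTensor₃ ρ₁ l₂ ρ₂ l₃ :=
  BalTensor.lift (tmulHom ρ₁ l₂ ρ₂ l₃) (fun r m n => by
    ext p
    exact (Submodule.Quotient.eq _).2 (Submodule.subset_span (Or.inl ⟨r, m, n, p, rfl⟩)))

/-- The canonical map `M × (N ⊗_{R'} P) → M ⊗_R N ⊗_{R'} P`. -/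
def assocR : M →+ BalTensor ρ₂ l₃ →+ BalTensor₃ ρ₁ l₂ ρ₂ l₃ :=
  AddMonoidHom.mk' (fun m => BalTensor.lift (tmulHom ρ₁ l₂ ρ₂ l₃ m) (fun r n p =>
      (Submodule.Quotient.eq _).2 (Submodule.subset_span (Or.inr ⟨r, m, n, p, rfl⟩))))
    (fun m m' => BalTensor.hom_ext (fun n p => by
      simp only [map_add, AddMonoidHom.add_apply, BalTensor.lift_tmul]; rfl))

variable {ρ₁ l₂ ρ₂ l₃}

/-- The universal property of the threefold balanced tensor product. -/
def lift (f : M →+ N →+ P →+ T) (h₁ : ∀ r m n p, f (ρ₁ r m) n p = f m (l₂ r n) p)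
    (h₂ : ∀ r m n p, f m (ρ₂ r n) p = f m n (l₃ r p)) : BalTensor₃ ρ₁ l₂ ρ₂ l₃ →+ T :=
  ((balRel₃ ρ₁ l₂ ρ₂ l₃).liftQ
    (intLift (AddMonoidHom.mk' (fun m => intLift (f m)) (fun m m' =>
      intTensor_hom_ext (fun n p => by simp)))).toIntLinearMap (by
      rw [balRel₃, Submodule.span_le]
      rintro _ (⟨r, m, n, p, rfl⟩ | ⟨r, m, n, p, rfl⟩)
      · exact (map_sub _ _ _).trans (sub_eq_zero.2 (h₁ r m n p))
      · exact (map_sub _ _ _).trans (sub_eq_zero.2 (h₂ r m n p)))).toAddMonoidHom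

theorem lift_assocL (f : M →+ N →+ P →+ T) (h₁ : ∀ r m n p, f (ρ₁ r m) n p = f m (l₂ r n) p)
    (h₂ : ∀ r m n p, f m (ρ₂ r n) p = f m n (l₃ r p)) (m : M) (n : N) (p : P) :
    lift f h₁ h₂ (assocL ρ₁ l₂ ρ₂ l₃ (BalTensor.tmul ρ₁ l₂ m n) p) = f m n p := by
  rfl

theorem lift_assocR (f : M →+ N →+ P →+ T) (h₁ : ∀ r m n p, f (ρ₁ r m) n p = f m (l₂ r n) p)
    (h₂ : ∀ r m n p, f m (ρ₂ r n) p = f m n (l₃ r p)) (m : M) (n : N) (p : P) :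
    lift f h₁ h₂ (assocR ρ₁ l₂ ρ₂ l₃ m (BalTensor.tmul ρ₂ l₃ n p)) = f m n p := by
  rfl

end BalTensor₃

end BalancedTensor

section Bialgebroids

open BalTensor

/-- The right `R`-action `m·r = m s(r)` on a right `A`-module, for a ring map `s : R → A`. -/
def rightAct {A R : Type*} [Ring A] [Ring R] (s : R →+* A) (M : Type*) [AddCommGroup M]
    [Module Aᵐᵒᵖ M] (r : R) : M →+ M :=
  DistribSMul.toAddMonoidHom M (op (s r))

/-- The left `R`-action `r·m = m t(r)` on a right `A`-module, for a ring map `t : Rᵒᵖ → A`. -/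
def leftAct {A R : Type*} [Ring A] [Ring R] (t : Rᵐᵒᵖ →+* A) (M : Type*) [AddCommGroup M]
    [Module Aᵐᵒᵖ M] (r : R) : M →+ M :=
  DistribSMul.toAddMonoidHom M (op (t (op r)))

/-- A left bialgebroid `(A, L, s, t, γ, π)`. Here `A` is the `L`-`L`-bimodule
`l·a·l' = s(l) t(l') a`, and `γ` takes values in `A_L ⊗ _LA`. Identities in Sweedler notation are
required for every representation of the coproducts as finite sums of elementary tensors. -/
structure LeftBialgebroid (A : Type*) (L : Type*) [Ring A] [Ring L] where
  /-- the source map -/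
  s : L →+* A
  /-- the target map -/
  t : Lᵐᵒᵖ →+* A
  s_t_comm : ∀ l l', s l * t (op l') = t (op l') * s l
  /-- the coproduct -/
  γ : A →+ BalTensor (fun l => AddMonoidHom.mulLeft (t (op l)))
    (fun l => AddMonoidHom.mulLeft (s l))
  /-- the counit -/
  π : A →+ L
  γ_bimod : ∀ (l l' : L) (a : A) (n : ℕ) (x y : Fin n → A), γ a = ∑ j, tmul _ _ (x j) (y j) →
    γ (s l * t (op l') * a) = ∑ j, tmul _ _ (s l * x j) (t (op l') * y j)
  π_bimod : ∀ (l l' : L) (a : A), π (s l * t (op l') * a) = l * π a * l'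
  coassoc : ∀ (a : A) (n : ℕ) (x y : Fin n → A), γ a = ∑ j, tmul _ _ (x j) (y j) →
    ∑ j, BalTensor₃.assocL _ _ (fun l => AddMonoidHom.mulLeft (t (op l)))
        (fun l => AddMonoidHom.mulLeft (s l)) (γ (x j)) (y j) =
      ∑ j, BalTensor₃.assocR _ _ _ _ (x j) (γ (y j))
  counit_left : ∀ (a : A) (n : ℕ) (x y : Fin n → A), γ a = ∑ j, tmul _ _ (x j) (y j) →
    ∑ j, s (π (x j)) * y j = a
  counit_right : ∀ (a : A) (n : ℕ) (x y : Fin n → A), γ a = ∑ j, tmul _ _ (x j) (y j) →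
    ∑ j, t (op (π (y j))) * x j = a
  γ_takeuchi : ∀ (l : L) (a : A) (n : ℕ) (x y : Fin n → A), γ a = ∑ j, tmul _ _ (x j) (y j) →
    (∑ j, tmul _ _ (x j * t (op l)) (y j) : BalTensor (fun l => AddMonoidHom.mulLeft (t (op l)))
      (fun l => AddMonoidHom.mulLeft (s l))) = ∑ j, tmul _ _ (x j) (y j * s l)
  γ_one : γ 1 = tmul _ _ 1 1
  γ_mul : ∀ (a b : A) (n m : ℕ) (x y : Fin n → A) (z w : Fin m → A),
    γ a = ∑ j, tmul _ _ (x j) (y j) → γ b = ∑ k, tmul _ _ (z k) (w k) →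
      γ (a * b) = ∑ j, ∑ k, tmul _ _ (x j * z k) (y j * w k)
  π_one : π 1 = 1
  π_mul_s : ∀ a b, π (a * s (π b)) = π (a * b)
  π_mul_t : ∀ a b, π (a * t (op (π b))) = π (a * b)

/-- A right bialgebroid `(A, R, s, t, γ, π)`. Here `A` is the `R`-`R`-bimodule
`r·a·r' = a s(r') t(r)`, and `γ` takes values in `A^R ⊗ ^RA`. -/
structure RightBialgebroid (A : Type*) (R : Type*) [Ring A] [Ring R] where
  /-- the source map -/
  s : R →+* A
  /-- the target map -/
  t : Rᵐᵒᵖ →+* A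
  s_t_comm : ∀ r r', s r * t (op r') = t (op r') * s r
  /-- the coproduct -/
  γ : A →+ BalTensor (rightAct s A) (leftAct t A)
  /-- the counit -/
  π : A →+ R
  γ_bimod : ∀ (r r' : R) (a : A) (n : ℕ) (x y : Fin n → A), γ a = ∑ j, tmul _ _ (x j) (y j) →
    γ (a * s r' * t (op r)) = ∑ j, tmul _ _ (x j * t (op r)) (y j * s r')
  π_bimod : ∀ (r r' : R) (a : A), π (a * s r' * t (op r)) = r * π a * r'
  coassoc : ∀ (a : A) (n : ℕ) (x y : Fin n → A), γ a = ∑ j, tmul _ _ (x j) (y j) →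
    ∑ j, BalTensor₃.assocL _ _ (rightAct s A) (leftAct t A) (γ (x j)) (y j) =
      ∑ j, BalTensor₃.assocR _ _ _ _ (x j) (γ (y j))
  counit_left : ∀ (a : A) (n : ℕ) (x y : Fin n → A), γ a = ∑ j, tmul _ _ (x j) (y j) →
    ∑ j, y j * t (op (π (x j))) = a
  counit_right : ∀ (a : A) (n : ℕ) (x y : Fin n → A), γ a = ∑ j, tmul _ _ (x j) (y j) →
    ∑ j, x j * s (π (y j)) = a
  γ_takeuchi : ∀ (r : R) (a : A) (n : ℕ) (x y : Fin n → A), γ a = ∑ j, tmul _ _ (x j) (y j) →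
    (∑ j, tmul _ _ (s r * x j) (y j) : BalTensor (rightAct s A) (leftAct t A)) =
      ∑ j, tmul _ _ (x j) (t (op r) * y j)
  γ_one : γ 1 = tmul _ _ 1 1
  γ_mul : ∀ (a b : A) (n m : ℕ) (x y : Fin n → A) (z w : Fin m → A),
    γ a = ∑ j, tmul _ _ (x j) (y j) → γ b = ∑ k, tmul _ _ (z k) (w k) →
      γ (a * b) = ∑ j, ∑ k, tmul _ _ (x j * z k) (y j * w k)
  π_one : π 1 = 1
  π_s_mul : ∀ a b, π (s (π a) * b) = π (a * b)
  π_t_mul : ∀ a b, π (t (op (π a)) * b) = π (a * b)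

/-- A Hopf algebroid `(𝒜_L, 𝒜_R, S)` with bijective antipode: a left and a right bialgebroid on the
same total ring, and an antipode relating them. -/
structure HopfAlgebroid (A : Type*) (L : Type*) (R : Type*) [Ring A] [Ring L] [Ring R] where
  /-- the underlying left bialgebroid -/
  left : LeftBialgebroid A L
  /-- the underlying right bialgebroid -/
  right : RightBialgebroid A R
  base_iso : Nonempty (R ≃+* Lᵐᵒᵖ)
  range_sL : Set.range left.s = Set.range right.t
  range_tL : Set.range left.t = Set.range right.s
  /-- `(γ_L ⊗ id) ∘ γ_R = (id ⊗ γ_R) ∘ γ_L` in `A_L ⊗ _LA^R ⊗ ^RA` -/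
  coassoc_LR : ∀ (a : A) (n m : ℕ) (x y : Fin n → A) (z w : Fin m → A),
    right.γ a = ∑ j, tmul _ _ (x j) (y j) → left.γ a = ∑ k, tmul _ _ (z k) (w k) →
      ∑ j, BalTensor₃.assocL _ _ (rightAct right.s A) (leftAct right.t A) (left.γ (x j)) (y j) =
        ∑ k, BalTensor₃.assocR _ _ _ _ (z k) (right.γ (w k))
  /-- `(γ_R ⊗ id) ∘ γ_L = (id ⊗ γ_L) ∘ γ_R` in `A^R ⊗ ^RA_L ⊗ _LA` -/
  coassoc_RL : ∀ (a : A) (n m : ℕ) (x y : Fin n → A) (z w : Fin m → A),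
    left.γ a = ∑ j, tmul _ _ (x j) (y j) → right.γ a = ∑ k, tmul _ _ (z k) (w k) →
      ∑ j, BalTensor₃.assocL _ _ (fun l => AddMonoidHom.mulLeft (left.t (op l)))
          (fun l => AddMonoidHom.mulLeft (left.s l)) (right.γ (x j)) (y j) =
        ∑ k, BalTensor₃.assocR _ _ _ _ (z k) (left.γ (w k))
  /-- the antipode -/
  S : A ≃+ A
  S_left : ∀ (l l' : L) (a : A),
    S (left.t (op l) * a * left.t (op l')) = left.s l' * S a * left.s l
  S_right : ∀ (r r' : R) (a : A),
    S (right.t (op r') * a * right.t (op r)) = right.s r * S a * right.s r'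
  antipode_left : ∀ (a : A) (n : ℕ) (x y : Fin n → A), left.γ a = ∑ j, tmul _ _ (x j) (y j) →
    ∑ j, S (x j) * y j = right.s (right.π a)
  antipode_right : ∀ (a : A) (n : ℕ) (x y : Fin n → A), right.γ a = ∑ j, tmul _ _ (x j) (y j) →
    ∑ j, x j * S (y j) = left.s (left.π a)

end Bialgebroids

namespace LeftBialgebroid

open BalTensor

variable {A L : Type*} [Ring A] [Ring L] (B : LeftBialgebroid A L)

/-- The dual `_*𝒜` of left `L`-module maps `_LA → _LL`. -/
abbrev StarL : Type _ := {φ : A →+ L // ∀ l a, φ (B.s l * a) = l * φ a}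

/-- The dual `𝒜_*` of right `L`-module maps `A_L → L_L`. -/
abbrev LStar : Type _ := {φ : A →+ L // ∀ l a, φ (B.t (op l) * a) = φ a * l}

/-- `a ↼ φ = t(φ(a₂)) a₁` for `φ ∈ _*𝒜`. -/
def hitStarL (φ : B.StarL) (a : A) : A :=
  lift (AddMonoidHom.mk' (fun x => AddMonoidHom.mk' (fun y => B.t (op (φ.1 y)) * x)
      (fun y y' => by rw [map_add, MulOpposite.op_add, map_add, add_mul]))
      (fun x x' => by ext y; exact mul_add _ _ _))
    (fun l x y => by
      change B.t (op (φ.1 y)) * (B.t (op l) * x) = B.t (op (φ.1 (B.s l * y))) * x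
      rw [φ.2, MulOpposite.op_mul, map_mul, mul_assoc]) (B.γ a)

/-- `a ↼ φ = s(φ(a₁)) a₂` for `φ ∈ 𝒜_*`. -/
def hitLStar (φ : B.LStar) (a : A) : A :=
  lift (AddMonoidHom.mk' (fun x => AddMonoidHom.mk' (fun y => B.s (φ.1 x) * y)
      (fun y y' => mul_add _ _ _))
      (fun x x' => by
        ext y; change B.s (φ.1 (x + x')) * y = B.s (φ.1 x) * y + B.s (φ.1 x') * y
        rw [map_add, map_add, add_mul]))
    (fun l x y => by
      change B.s (φ.1 (B.t (op l) * x)) * y = B.s (φ.1 x) * (B.s l * y)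
      rw [φ.2, map_mul, mul_assoc]) (B.γ a)

theorem hitStarL_of_rep (φ : B.StarL) (a : A) {n : ℕ} (x y : Fin n → A)
    (h : B.γ a = ∑ j, tmul _ _ (x j) (y j)) :
    B.hitStarL φ a = ∑ j, B.t (op (φ.1 (y j))) * x j := by
  unfold hitStarL; rw [h, map_sum]; rfl

theorem hitLStar_of_rep (φ : B.LStar) (a : A) {n : ℕ} (x y : Fin n → A)
    (h : B.γ a = ∑ j, tmul _ _ (x j) (y j)) :
    B.hitLStar φ a = ∑ j, B.s (φ.1 (x j)) * y j := by
  unfold hitLStar; rw [h, map_sum]; rfl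

/-- The product `(φψ)(a) = ψ(a ↼ φ) = ψ(t(φ(a₂)) a₁)` of the dual ring `_*𝒜`. -/
def mulStarL (φ ψ : B.StarL) : B.StarL :=
  ⟨AddMonoidHom.mk' (fun a => ψ.1 (B.hitStarL φ a)) (fun a a' => by
      unfold hitStarL; rw [map_add, map_add, map_add]),
    fun l a => by
      obtain ⟨n, x, y, h⟩ := exists_rep (B.γ a)
      have h' := B.γ_bimod l 1 a n x y h
      simp only [MulOpposite.op_one, map_one, mul_one, one_mul] at h'
      simp only [AddMonoidHom.mk'_apply]
      rw [B.hitStarL_of_rep φ a x y h, B.hitStarL_of_rep φ _ _ _ h', ← ψ.2, Finset.mul_sum]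
      congr 1
      refine Finset.sum_congr rfl (fun j _ => ?_)
      rw [← mul_assoc, ← B.s_t_comm, mul_assoc]⟩

end LeftBialgebroid

namespace HopfAlgebroid

variable {A L R : Type*} [Ring A] [Ring L] [Ring R] (𝓗 : HopfAlgebroid A L R)

/-- `i` is a right integral: `i a = i s_R(π_R(a))` for all `a`. -/
def IsRightIntegral (i : A) : Prop := ∀ a, i * a = i * 𝓗.right.s (𝓗.right.π a)

/-- Non-degeneracy of a right integral `i`: the maps `_Li : _*𝒜 → A` and `i_L : 𝒜_* → A`,
`φ ↦ i ↼ φ`, are bijective. -/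
structure IsNondegenerate (i : A) : Prop where
  bijective_starL : Function.Bijective fun φ : 𝓗.left.StarL => 𝓗.left.hitStarL φ i
  bijective_lStar : Function.Bijective fun φ : 𝓗.left.LStar => 𝓗.left.hitLStar φ i

variable {𝓗}

/-- The convolution product `h ∗ k = _Li(_Li⁻¹(h) _Li⁻¹(k))`. -/
noncomputable def conv {i : A} (hi : 𝓗.IsNondegenerate i) (h k : A) : A :=
  𝓗.left.hitStarL (𝓗.left.mulStarL ((Equiv.ofBijective _ hi.bijective_starL).symm h)
    ((Equiv.ofBijective _ hi.bijective_starL).symm k)) i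

end HopfAlgebroid

namespace RightBialgebroid

open BalTensor

variable {A R : Type u} [Ring A] [Ring R] (B : RightBialgebroid A R)

section Modules

variable (M N P : Type u) [AddCommGroup M] [AddCommGroup N] [AddCommGroup P]
  [Module Aᵐᵒᵖ M] [Module Aᵐᵒᵖ N] [Module Aᵐᵒᵖ P]

/-- The tensor product `M ⊗_R N` of right `A`-modules, with `r·m·r' = m s(r') t(r)`. -/
abbrev Tens : Type u := BalTensor (rightAct B.s M) (leftAct B.t N)

variable {M N P}

/-- The map `A^R ⊗ ^RA → M ⊗_R N`, `x ⊗ y ↦ m x ⊗ n y`. -/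
def orbit (m : M) (n : N) : BalTensor (rightAct B.s A) (leftAct B.t A) →+ B.Tens M N :=
  lift (AddMonoidHom.mk' (fun x => AddMonoidHom.mk'
      (fun y => tmul (rightAct B.s M) (leftAct B.t N) (op x • m) (op y • n))
      (fun y y' => by rw [MulOpposite.op_add, add_smul, tmul_add]))
      (fun x x' => by
        ext y; simp only [AddMonoidHom.mk'_apply, AddMonoidHom.add_apply]
        rw [MulOpposite.op_add, add_smul, add_tmul]))
    (fun r x y => by
      simp only [AddMonoidHom.mk'_apply]
      have h₁ : op (rightAct B.s A r x) • m = rightAct B.s M r (op x • m) := by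
        change op (x * B.s r) • m = op (B.s r) • op x • m
        rw [MulOpposite.op_mul, mul_smul]
      have h₂ : op (leftAct B.t A r y) • n = leftAct B.t N r (op y • n) := by
        change op (y * B.t (op r)) • n = op (B.t (op r)) • op y • n
        rw [MulOpposite.op_mul, mul_smul]
      rw [h₁, h₂, smul_tmul])

@[simp] theorem orbit_tmul (m : M) (n : N) (x y : A) :
    B.orbit m n (tmul _ _ x y) = tmul _ _ (op x • m) (op y • n) := rfl

theorem orbit_add_left (m m' : M) (n : N) : B.orbit (m + m') n = B.orbit m n + B.orbit m' n :=
  hom_ext (fun x y => by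
    rw [AddMonoidHom.add_apply]; simp only [orbit_tmul]; rw [smul_add, add_tmul])

theorem orbit_add_right (m : M) (n n' : N) : B.orbit m (n + n') = B.orbit m n + B.orbit m n' :=
  hom_ext (fun x y => by
    rw [AddMonoidHom.add_apply]; simp only [orbit_tmul]; rw [smul_add, tmul_add])

/-- The diagonal action `(m ⊗ n)·a = m a⁽¹⁾ ⊗ n a⁽²⁾`. -/
def diagAct (a : A) : B.Tens M N →+ B.Tens M N :=
  lift (AddMonoidHom.mk' (fun m => AddMonoidHom.mk' (fun n => B.orbit m n (B.γ a))
      (fun n n' => by rw [orbit_add_right]; rfl))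
      (fun m m' => by
        ext n; simp only [AddMonoidHom.mk'_apply, AddMonoidHom.add_apply, orbit_add_left]))
    (fun r m n => by
      simp only [AddMonoidHom.mk'_apply]
      obtain ⟨k, x, y, h⟩ := exists_rep (B.γ a)
      have h' := congrArg (B.orbit m n) (B.γ_takeuchi r a k x y h)
      simp only [map_sum, orbit_tmul] at h'
      rw [h]
      simp only [map_sum, orbit_tmul]
      simp only [MulOpposite.op_mul, mul_smul] at h'
      exact h')

theorem diagAct_tmul (a : A) (m : M) (n : N) :
    B.diagAct a (tmul _ _ m n) = B.orbit m n (B.γ a) := rfl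

theorem diagAct_of_rep (a : A) (m : M) (n : N) {k : ℕ} (x y : Fin k → A)
    (h : B.γ a = ∑ j, tmul _ _ (x j) (y j)) :
    B.diagAct a (tmul _ _ m n : B.Tens M N) = ∑ j, tmul _ _ (op (x j) • m) (op (y j) • n) := by
  rw [diagAct_tmul, h, map_sum]; rfl

theorem diagAct_one : (B.diagAct 1 : B.Tens M N →+ B.Tens M N) = AddMonoidHom.id _ :=
  hom_ext (fun m n => by rw [diagAct_tmul, B.γ_one, orbit_tmul]; simp)

theorem diagAct_mul (a b : A) :
    (B.diagAct (a * b) : B.Tens M N →+ B.Tens M N) = (B.diagAct b).comp (B.diagAct a) :=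
  hom_ext (fun m n => by
    obtain ⟨k, x, y, h⟩ := exists_rep (B.γ a)
    obtain ⟨k', z, w, h'⟩ := exists_rep (B.γ b)
    rw [AddMonoidHom.comp_apply, B.diagAct_of_rep a m n x y h, map_sum, diagAct_tmul,
      B.γ_mul a b k k' x y z w h h', map_sum]
    refine Finset.sum_congr rfl (fun j _ => ?_)
    rw [B.diagAct_of_rep b _ _ z w h', map_sum]
    refine Finset.sum_congr rfl (fun i _ => ?_)
    rw [orbit_tmul, MulOpposite.op_mul, MulOpposite.op_mul, mul_smul, mul_smul])

theorem diagAct_add (a b : A) :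
    (B.diagAct (a + b) : B.Tens M N →+ B.Tens M N) = B.diagAct a + B.diagAct b :=
  hom_ext (fun m n => by
    rw [AddMonoidHom.add_apply, diagAct_tmul, map_add, map_add]; rfl)

instance : Module Aᵐᵒᵖ (B.Tens M N) where
  smul a q := B.diagAct a.unop q
  one_smul q := DFunLike.congr_fun B.diagAct_one q
  mul_smul a b q := DFunLike.congr_fun (B.diagAct_mul b.unop a.unop) q
  smul_zero a := map_zero (B.diagAct a.unop)
  smul_add a := map_add (B.diagAct a.unop)
  add_smul a b q := DFunLike.congr_fun (B.diagAct_add a.unop b.unop) q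
  zero_smul q := by
    have h := DFunLike.congr_fun (B.diagAct_add (M := M) (N := N) 0 0) q
    rw [add_zero, AddMonoidHom.add_apply] at h
    exact left_eq_add.1 h

theorem smul_def (a : A) (q : B.Tens M N) : op a • q = B.diagAct a q := rfl

theorem smul_tmul_of_rep (a : A) (m : M) (n : N) {k : ℕ} (x y : Fin k → A)
    (h : B.γ a = ∑ j, tmul _ _ (x j) (y j)) :
    op a • (tmul _ _ m n : B.Tens M N) = ∑ j, tmul _ _ (op (x j) • m) (op (y j) • n) :=
  B.diagAct_of_rep a m n x y h

/-- `γ(s(r)) = 1 ⊗ s(r)`. -/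
theorem γ_s (r : R) : B.γ (B.s r) = tmul _ _ 1 (B.s r) := by
  have h := B.γ_bimod 1 r 1 1 (fun _ => 1) (fun _ => 1) (by simpa using B.γ_one)
  simpa using h

/-- `γ(t(r)) = t(r) ⊗ 1`. -/
theorem γ_t (r : R) : B.γ (B.t (op r)) = tmul _ _ (B.t (op r)) 1 := by
  have h := B.γ_bimod r 1 1 1 (fun _ => 1) (fun _ => 1) (by simpa using B.γ_one)
  simpa using h

theorem rightAct_tmul (r : R) (m : M) (n : N) :
    rightAct B.s (B.Tens M N) r (tmul _ _ m n) = tmul _ _ m (rightAct B.s N r n) := by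
  change B.diagAct (B.s r) _ = _
  rw [diagAct_tmul, γ_s, orbit_tmul, op_one, one_smul]; rfl

theorem leftAct_tmul (r : R) (m : M) (n : N) :
    leftAct B.t (B.Tens M N) r (tmul _ _ m n) = tmul _ _ (leftAct B.t M r m) n := by
  change B.diagAct (B.t (op r)) _ = _
  rw [diagAct_tmul, γ_t, orbit_tmul, op_one, one_smul]; rfl

/-- An additive map on `M ⊗_R N` that commutes with the actions on elementary tensors is
`A`-linear. -/
def linOfTmul (f : B.Tens M N →+ P) (h : ∀ (a : A) (m : M) (n : N),
    f (op a • (tmul _ _ m n : B.Tens M N)) = op a • f (tmul _ _ m n)) : B.Tens M N →ₗ[Aᵐᵒᵖ] P :=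
  { f with
    map_smul' := fun a q => by
      have : f.comp (B.diagAct a.unop) = (DistribSMul.toAddMonoidHom P a).comp f :=
        hom_ext (fun m n => h a.unop m n)
      exact DFunLike.congr_fun this q }

@[simp] theorem linOfTmul_apply (f : B.Tens M N →+ P) (h) (q : B.Tens M N) :
    B.linOfTmul f h q = f q := rfl

theorem lin_ext {f g : B.Tens M N →ₗ[Aᵐᵒᵖ] P}
    (h : ∀ m n, f (tmul _ _ m n) = g (tmul _ _ m n)) : f = g := by
  have : f.toAddMonoidHom = g.toAddMonoidHom := hom_ext h
  ext q
  exact DFunLike.congr_fun this q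

end Modules

section Constructions

variable {M N P M' N' : Type u} [AddCommGroup M] [AddCommGroup N] [AddCommGroup P]
  [AddCommGroup M'] [AddCommGroup N']
  [Module Aᵐᵒᵖ M] [Module Aᵐᵒᵖ N] [Module Aᵐᵒᵖ P] [Module Aᵐᵒᵖ M'] [Module Aᵐᵒᵖ N']

/-- The tensor product `f ⊗ g` of module maps. -/
def tensMap (f : M →ₗ[Aᵐᵒᵖ] M') (g : N →ₗ[Aᵐᵒᵖ] N') : B.Tens M N →ₗ[Aᵐᵒᵖ] B.Tens M' N' :=
  B.linOfTmul (lift (AddMonoidHom.mk' (fun m => (tmulHom _ _ (f m)).comp g.toAddMonoidHom)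
      (fun m m' => by ext n; simp))
    (fun r m n => by
      change tmul _ _ (f (op (B.s r) • m)) (g n) = tmul _ _ (f m) (g (op (B.t (op r)) • n))
      rw [map_smul, map_smul]
      exact smul_tmul r (f m) (g n)))
    (fun a m n => by
      obtain ⟨k, x, y, h⟩ := exists_rep (B.γ a)
      rw [B.smul_tmul_of_rep a m n x y h, map_sum]
      simp only [lift_tmul, AddMonoidHom.mk'_apply, AddMonoidHom.comp_apply, tmulHom_apply]
      rw [B.smul_tmul_of_rep a _ _ x y h]
      refine Finset.sum_congr rfl (fun j _ => ?_)
      change tmul _ _ (f _) (g _) = tmul _ _ (op (x j) • f m) (op (y j) • g n)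
      rw [map_smul, map_smul])

@[simp] theorem tensMap_tmul (f : M →ₗ[Aᵐᵒᵖ] M') (g : N →ₗ[Aᵐᵒᵖ] N') (m : M) (n : N) :
    B.tensMap f g (tmul _ _ m n) = tmul _ _ (f m) (g n) := rfl

variable (M N P)

/-- `(m ⊗ n, p) ↦ m ⊗ (n ⊗ p)` as a biadditive map. -/
def assocAux₁ : B.Tens M N →+ P →+ B.Tens M (B.Tens N P) :=
  lift (AddMonoidHom.mk' (fun m => AddMonoidHom.mk' (fun n =>
      (tmulHom (rightAct B.s M) (leftAct B.t (B.Tens N P)) m).comp (tmulHom _ _ n))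
      (fun n n' => by ext p; simp [tmul_add]))
      (fun m m' => by ext n p; simp))
    (fun r m n => by
      ext p
      change tmul _ _ (rightAct B.s M r m) (tmul _ _ n p) =
        tmul _ _ m (tmul _ _ (leftAct B.t N r n) p)
      rw [smul_tmul, leftAct_tmul])

/-- `(m, n ⊗ p) ↦ (m ⊗ n) ⊗ p` as a biadditive map. -/
def assocAux₂ : M →+ B.Tens N P →+ B.Tens (B.Tens M N) P :=
  AddMonoidHom.mk' (fun m => lift
      ((tmulHom (rightAct B.s (B.Tens M N)) (leftAct B.t P)).comp (tmulHom _ _ m))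
      (fun r n p => by
        change tmul _ _ (tmul _ _ m (rightAct B.s N r n)) p =
          tmul _ _ (tmul _ _ m n) (leftAct B.t P r p)
        rw [← smul_tmul, rightAct_tmul]))
    (fun m m' => hom_ext (fun n p => by
      change tmul _ _ (tmul _ _ (m + m') n) p = tmul _ _ (tmul _ _ m n) p + tmul _ _ (tmul _ _ m' n) p
      rw [add_tmul, add_tmul]))

/-- `(m ⊗ n) ⊗ p ↦ m ⊗ (n ⊗ p)` as an additive map. -/
def assocAux : B.Tens (B.Tens M N) P →+ B.Tens M (B.Tens N P) :=
  lift (B.assocAux₁ M N P) (fun r q p => by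
    obtain ⟨k, x, y, rfl⟩ := exists_rep q
    simp only [map_sum, AddMonoidHom.finsetSum_apply]
    refine Finset.sum_congr rfl (fun j _ => ?_)
    rw [rightAct_tmul]
    change tmul _ _ (x j) (tmul _ _ (rightAct B.s N r (y j)) p) =
      tmul _ _ (x j) (tmul _ _ (y j) (leftAct B.t P r p))
    rw [smul_tmul])

@[simp] theorem assocAux_tmul (m : M) (n : N) (p : P) :
    B.assocAux M N P (tmul _ _ (tmul _ _ m n) p) = tmul _ _ m (tmul _ _ n p) := rfl

/-- `m ⊗ (n ⊗ p) ↦ (m ⊗ n) ⊗ p` as an additive map. -/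
def assocAuxInv : B.Tens M (B.Tens N P) →+ B.Tens (B.Tens M N) P :=
  lift (B.assocAux₂ M N P) (fun r m q => by
    obtain ⟨k, x, y, rfl⟩ := exists_rep q
    simp only [map_sum]
    refine Finset.sum_congr rfl (fun j _ => ?_)
    rw [leftAct_tmul]
    change tmul _ _ (tmul _ _ (rightAct B.s M r m) (x j)) (y j) =
      tmul _ _ (tmul _ _ m (leftAct B.t N r (x j))) (y j)
    rw [smul_tmul])

@[simp] theorem assocAuxInv_tmul (m : M) (n : N) (p : P) :
    B.assocAuxInv M N P (tmul _ _ m (tmul _ _ n p)) = tmul _ _ (tmul _ _ m n) p := rfl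

variable {M N P}

/-- Two additive maps on `(M ⊗ N) ⊗ P` that agree on elementary tensors are equal. -/
theorem hom_ext₃ {T : Type*} [AddCommGroup T] {f g : B.Tens (B.Tens M N) P →+ T}
    (h : ∀ m n p, f (tmul _ _ (tmul _ _ m n) p) = g (tmul _ _ (tmul _ _ m n) p)) : f = g :=
  hom_ext (fun q p => by
    obtain ⟨k, x, y, rfl⟩ := exists_rep q
    rw [sum_tmul, map_sum, map_sum]
    exact Finset.sum_congr rfl (fun j _ => h _ _ _))

/-- Two additive maps on `M ⊗ (N ⊗ P)` that agree on elementary tensors are equal. -/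
theorem hom_ext₃' {T : Type*} [AddCommGroup T] {f g : B.Tens M (B.Tens N P) →+ T}
    (h : ∀ m n p, f (tmul _ _ m (tmul _ _ n p)) = g (tmul _ _ m (tmul _ _ n p))) : f = g :=
  hom_ext (fun m q => by
    obtain ⟨k, x, y, rfl⟩ := exists_rep q
    rw [tmul_sum, map_sum, map_sum]
    exact Finset.sum_congr rfl (fun j _ => h _ _ _))

/-- The map `x ⊗ y ⊗ z ↦ m x ⊗ (n y ⊗ p z)`. -/
def orbit₃ (m : M) (n : N) (p : P) :
    BalTensor₃ (rightAct B.s A) (leftAct B.t A) (rightAct B.s A) (leftAct B.t A) →+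
      B.Tens M (B.Tens N P) :=
  BalTensor₃.lift (AddMonoidHom.mk' (fun x => AddMonoidHom.mk' (fun y => AddMonoidHom.mk' (fun z =>
      (tmul _ _ (op x • m) (tmul _ _ (op y • n) (op z • p)) : B.Tens M (B.Tens N P)))
      (fun z z' => by rw [MulOpposite.op_add, add_smul, tmul_add, tmul_add]))
      (fun y y' => by
        ext z; simp only [AddMonoidHom.mk'_apply, AddMonoidHom.add_apply]
        rw [MulOpposite.op_add, add_smul, add_tmul, tmul_add]))
      (fun x x' => by
        ext y z; simp only [AddMonoidHom.mk'_apply, AddMonoidHom.add_apply]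
        rw [MulOpposite.op_add, add_smul, add_tmul]))
    (fun r x y z => by
      change tmul _ _ (op (x * B.s r) • m) (tmul _ _ (op y • n) (op z • p)) =
        tmul _ _ (op x • m) (tmul _ _ (op (y * B.t (op r)) • n) (op z • p))
      rw [MulOpposite.op_mul, mul_smul, MulOpposite.op_mul, mul_smul]
      exact (smul_tmul r _ _).trans (congrArg _ (B.leftAct_tmul r _ _)))
    (fun r x y z => by
      change tmul _ _ (op x • m) (tmul _ _ (op (y * B.s r) • n) (op z • p)) =
        tmul _ _ (op x • m) (tmul _ _ (op y • n) (op (z * B.t (op r)) • p))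
      rw [MulOpposite.op_mul, mul_smul, MulOpposite.op_mul, mul_smul]
      exact congrArg _ (smul_tmul r _ _))

theorem orbit₃_assocL (m : M) (n : N) (p : P)
    (q : BalTensor (rightAct B.s A) (leftAct B.t A)) (z : A) :
    B.orbit₃ m n p (BalTensor₃.assocL _ _ _ _ q z) =
      B.assocAux M N P (tmul _ _ (B.orbit m n q) (op z • p)) := by
  obtain ⟨k, x, y, rfl⟩ := exists_rep q
  simp only [map_sum, AddMonoidHom.finsetSum_apply, sum_tmul]
  exact Finset.sum_congr rfl (fun j _ => rfl)

theorem orbit₃_assocR (m : M) (n : N) (p : P) (x : A)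
    (q : BalTensor (rightAct B.s A) (leftAct B.t A)) :
    B.orbit₃ m n p (BalTensor₃.assocR _ _ _ _ x q) = tmul _ _ (op x • m) (B.orbit n p q) := by
  obtain ⟨k, y, z, rfl⟩ := exists_rep q
  simp only [map_sum, tmul_sum]
  exact Finset.sum_congr rfl (fun j _ => rfl)

theorem assocAux_smul (a : A) (q : B.Tens (B.Tens M N) P) :
    B.assocAux M N P (op a • q) = op a • B.assocAux M N P q := by
  have : (B.assocAux M N P).comp (B.diagAct a) = (B.diagAct a).comp (B.assocAux M N P) :=
    B.hom_ext₃ (fun m n p => by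
      obtain ⟨k, x, y, h⟩ := exists_rep (B.γ a)
      have h' := congrArg (B.orbit₃ m n p) (B.coassoc a k x y h)
      simp only [map_sum, orbit₃_assocL, orbit₃_assocR] at h'
      rw [AddMonoidHom.comp_apply, AddMonoidHom.comp_apply, B.diagAct_of_rep a _ _ x y h,
        map_sum, assocAux_tmul, B.diagAct_of_rep a _ _ x y h]
      exact h')
  exact DFunLike.congr_fun this q

variable (M N P)

/-- The associativity isomorphism. -/
def assocEquiv : B.Tens (B.Tens M N) P ≃ₗ[Aᵐᵒᵖ] B.Tens M (B.Tens N P) :=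
  { B.assocAux M N P with
    map_smul' := fun a q => B.assocAux_smul a.unop q
    invFun := B.assocAuxInv M N P
    left_inv := DFunLike.congr_fun (show (B.assocAuxInv M N P).comp (B.assocAux M N P) =
      AddMonoidHom.id _ from B.hom_ext₃ (fun _ _ _ => rfl))
    right_inv := DFunLike.congr_fun (show (B.assocAux M N P).comp (B.assocAuxInv M N P) =
      AddMonoidHom.id _ from B.hom_ext₃' (fun _ _ _ => rfl)) }

@[simp] theorem assocEquiv_tmul (m : M) (n : N) (p : P) :
    B.assocEquiv M N P (tmul _ _ (tmul _ _ m n) p) = tmul _ _ m (tmul _ _ n p) := rfl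

/-- The right `A`-action `r·a = π(s(r) a)` on the base ring. -/
def unitAct (a : A) : R →+ R := B.π.comp ((AddMonoidHom.mulRight a).comp B.s.toAddMonoidHom)

theorem unitAct_apply (a : A) (r : R) : B.unitAct a r = B.π (B.s r * a) := rfl

theorem π_s (r : R) : B.π (B.s r) = r := by
  have h := B.π_bimod 1 r 1
  rw [op_one, map_one, mul_one, one_mul, B.π_one, one_mul, one_mul] at h
  exact h

theorem π_mul_s (a : A) (r : R) : B.π (a * B.s r) = B.π a * r := by
  have h := B.π_bimod 1 r a
  rw [op_one, map_one, mul_one, one_mul] at h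
  exact h

theorem π_mul_t (a : A) (r : R) : B.π (a * B.t (op r)) = r * B.π a := by
  have h := B.π_bimod r 1 a
  rw [map_one, mul_one, mul_one] at h
  exact h

theorem π_t_mul_eq (r : R) (a : A) : B.π (B.t (op r) * a) = B.π (B.s r * a) := by
  have h := B.π_t_mul (B.s r) a
  rwa [π_s] at h

theorem unitAct_s (r r' : R) : B.unitAct (B.s r) r' = r' * r := by
  rw [unitAct_apply, ← map_mul, π_s]

theorem unitAct_t (r r' : R) : B.unitAct (B.t (op r)) r' = r * r' := by
  rw [unitAct_apply, π_mul_t, π_s]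

theorem unitAct_one (r : R) : B.unitAct 1 r = r := by rw [unitAct_apply, mul_one, π_s]

theorem unitAct_mul (a b : A) (r : R) : B.unitAct (a * b) r = B.unitAct b (B.unitAct a r) := by
  rw [unitAct_apply, unitAct_apply, unitAct_apply, B.π_s_mul, mul_assoc]

theorem unitAct_add (a b : A) (r : R) : B.unitAct (a + b) r = B.unitAct a r + B.unitAct b r := by
  rw [unitAct_apply, mul_add, map_add]; rfl

theorem unitAct_zero (r : R) : B.unitAct 0 r = 0 := by rw [unitAct_apply, mul_zero, map_zero]

/-- The monoidal unit: the base ring `R` with right `A`-action `r·a = π(s(r) a)`. -/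
@[nolint unusedArguments]
def UnitMod (_ : RightBialgebroid A R) : Type u := R

instance : AddCommGroup B.UnitMod := inferInstanceAs (AddCommGroup R)

instance : Module Aᵐᵒᵖ B.UnitMod where
  smul a r := B.unitAct a.unop r
  one_smul r := B.unitAct_one r
  mul_smul a b r := B.unitAct_mul b.unop a.unop r
  smul_zero a := map_zero (B.unitAct a.unop)
  smul_add a := map_add (B.unitAct a.unop)
  add_smul a b r := B.unitAct_add a.unop b.unop r
  zero_smul r := B.unitAct_zero r

/-- `x ⊗ y ↦ y t(π(x))`. -/
def counitL : BalTensor (rightAct B.s A) (leftAct B.t A) →+ A :=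
  lift (AddMonoidHom.mk' (fun x => AddMonoidHom.mulRight (B.t (op (B.π x))))
      (fun x x' => by
        ext y; simp [mul_add]))
    (fun r x y => by
      change y * B.t (op (B.π (x * B.s r))) = y * B.t (op r) * B.t (op (B.π x))
      rw [π_mul_s, MulOpposite.op_mul, map_mul, mul_assoc])

/-- `x ⊗ y ↦ x s(π(y))`. -/
def counitR : BalTensor (rightAct B.s A) (leftAct B.t A) →+ A :=
  lift (AddMonoidHom.mk' (fun x => (AddMonoidHom.mulLeft x).comp (B.s.toAddMonoidHom.comp B.π))
      (fun x x' => by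
        ext y; simp [add_mul]))
    (fun r x y => by
      change x * B.s r * B.s (B.π y) = x * B.s (B.π (y * B.t (op r)))
      rw [π_mul_t, map_mul, mul_assoc])

theorem counit_left_act (r : R) (a : A) {k : ℕ} (x y : Fin k → A)
    (h : B.γ a = ∑ j, tmul _ _ (x j) (y j)) :
    ∑ j, y j * B.t (op (B.unitAct (x j) r)) = B.t (op r) * a := by
  have h' := congrArg B.counitL (B.γ_takeuchi r a k x y h)
  rw [map_sum, map_sum] at h'
  refine h'.trans ?_
  change ∑ j, B.t (op r) * y j * B.t (op (B.π (x j))) = _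
  simp only [mul_assoc]
  rw [← Finset.mul_sum, B.counit_left a k x y h]

theorem counit_right_act (r : R) (a : A) {k : ℕ} (x y : Fin k → A)
    (h : B.γ a = ∑ j, tmul _ _ (x j) (y j)) :
    ∑ j, x j * B.s (B.unitAct (y j) r) = B.s r * a := by
  have h' := congrArg B.counitR (B.γ_takeuchi r a k x y h)
  rw [map_sum, map_sum] at h'
  simp only [unitAct_apply, ← π_t_mul_eq]
  refine h'.symm.trans ?_
  change ∑ j, B.s r * x j * B.s (B.π (y j)) = _
  simp only [mul_assoc]
  rw [← Finset.mul_sum, B.counit_right a k x y h]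

theorem sum_op_smul {k : ℕ} (x : Fin k → A) (m : M) : ∑ j, op (x j) • m = op (∑ j, x j) • m := by
  rw [← Finset.sum_smul]
  exact congrArg (· • m) (map_sum (opAddEquiv (α := A)) x Finset.univ).symm

/-- An element of the base ring as an element of the unit module. -/
def toUnit : R ≃+ B.UnitMod := AddEquiv.refl R

/-- `(r, m) ↦ m t(r)` as a biadditive map. -/
def leftActHom : R →+ M →+ M :=
  AddMonoidHom.mk' (fun r : R => leftAct B.t M r) (fun r r' => by
    ext m
    change op (B.t (op (r + r'))) • m = op (B.t (op r)) • m + op (B.t (op r')) • m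
    rw [MulOpposite.op_add, map_add, MulOpposite.op_add, add_smul])

/-- `(r, m) ↦ m s(r)` as a biadditive map. -/
def rightActHom : R →+ M →+ M :=
  AddMonoidHom.mk' (fun r : R => rightAct B.s M r) (fun r r' => by
    ext m
    change op (B.s (r + r')) • m = op (B.s r) • m + op (B.s r') • m
    rw [map_add, MulOpposite.op_add, add_smul])

/-- `r ⊗ m ↦ m t(r)` as an additive map. -/
def lUnitAux : B.Tens B.UnitMod M →+ M :=
  lift ((B.leftActHom M).comp B.toUnit.symm.toAddMonoidHom)
    (fun (r' r : R) m => by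
      change op (B.t (op (B.unitAct (B.s r') r))) • m = op (B.t (op r)) • op (B.t (op r')) • m
      rw [unitAct_s, MulOpposite.op_mul, map_mul, MulOpposite.op_mul, mul_smul])

/-- `m ⊗ r ↦ m s(r)` as an additive map. -/
def rUnitAux : B.Tens M B.UnitMod →+ M :=
  lift ((B.rightActHom M).comp B.toUnit.symm.toAddMonoidHom).flip
    (fun (r' : R) m (r : R) => by
      change op (B.s r) • op (B.s r') • m = op (B.s (B.unitAct (B.t (op r')) r)) • m
      rw [unitAct_t, map_mul, MulOpposite.op_mul, mul_smul])

/-- The left unit isomorphism `r ⊗ m ↦ m t(r)`. -/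
def lUnitEquiv : B.Tens B.UnitMod M ≃ₗ[Aᵐᵒᵖ] M :=
  { B.linOfTmul (B.lUnitAux M) (fun a (r : R) m => by
      obtain ⟨k, x, y, h⟩ := exists_rep (B.γ a)
      rw [B.smul_tmul_of_rep a (M := B.UnitMod) r m x y h, map_sum]
      change ∑ j, op (B.t (op (B.unitAct (x j) r))) • op (y j) • m = op a • op (B.t (op r)) • m
      simp only [← mul_smul, ← MulOpposite.op_mul]
      rw [sum_op_smul, B.counit_left_act r a x y h]) with
    invFun := fun m => tmul _ _ (B.toUnit 1) m
    left_inv := fun q => by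
      obtain ⟨k, x, y, rfl⟩ := exists_rep q
      change tmul _ _ (B.toUnit 1) (B.lUnitAux M _) = _
      rw [map_sum, tmul_sum]
      refine Finset.sum_congr rfl (fun j _ => ?_)
      refine (smul_tmul (x j : R) _ _).symm.trans ?_
      congr 1
      exact (B.unitAct_s (x j : R) 1).trans (one_mul _)
    right_inv := fun m => by
      change op (B.t (op 1)) • m = m
      rw [op_one, map_one, op_one, one_smul] }

/-- The right unit isomorphism `m ⊗ r ↦ m s(r)`. -/
def rUnitEquiv : B.Tens M B.UnitMod ≃ₗ[Aᵐᵒᵖ] M :=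
  { B.linOfTmul (B.rUnitAux M) (fun a m (r : R) => by
      obtain ⟨k, x, y, h⟩ := exists_rep (B.γ a)
      rw [B.smul_tmul_of_rep a (N := B.UnitMod) m r x y h, map_sum]
      change ∑ j, op (B.s (B.unitAct (y j) r)) • op (x j) • m = op a • op (B.s r) • m
      simp only [← mul_smul, ← MulOpposite.op_mul]
      rw [sum_op_smul, B.counit_right_act r a x y h]) with
    invFun := fun m => tmul _ _ m (B.toUnit 1)
    left_inv := fun q => by
      obtain ⟨k, x, y, rfl⟩ := exists_rep q
      change tmul _ _ (B.rUnitAux M _) (B.toUnit 1) = _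
      rw [map_sum, sum_tmul]
      refine Finset.sum_congr rfl (fun j _ => ?_)
      refine (smul_tmul (y j : R) _ _).trans ?_
      congr 1
      exact (B.unitAct_t (y j : R) 1).trans (mul_one _)
    right_inv := fun m => by
      change op (B.s 1) • m = m
      rw [map_one, op_one, one_smul] }

theorem lUnitEquiv_tmul (r : R) (m : M) :
    B.lUnitEquiv M (tmul _ _ (B.toUnit r) m) = op (B.t (op r)) • m := rfl

theorem rUnitEquiv_tmul (r : R) (m : M) :
    B.rUnitEquiv M (tmul _ _ m (B.toUnit r)) = op (B.s r) • m := rfl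

end Constructions

end RightBialgebroid

namespace RightBialgebroid

open BalTensor

variable {A R : Type u} [Ring A] [Ring R] (B : RightBialgebroid A R)

/-- The category `ℳ_A` of right `A`-modules, to be given the monoidal structure of the right
bialgebroid `B`. -/
@[nolint unusedArguments]
def Mod (_ : RightBialgebroid A R) : Type (u + 1) := ModuleCat.{u} Aᵐᵒᵖ

instance : Category.{u} B.Mod := inferInstanceAs (Category.{u} (ModuleCat.{u} Aᵐᵒᵖ))
instance : Preadditive B.Mod := inferInstanceAs (Preadditive (ModuleCat.{u} Aᵐᵒᵖ))
instance : Limits.HasCoequalizers B.Mod :=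
  inferInstanceAs (Limits.HasCoequalizers (ModuleCat.{u} Aᵐᵒᵖ))

variable {B}

namespace Mod

/-- The underlying set of a right module. -/
def carrier (M : B.Mod) : Type u := ModuleCat.carrier (R := Aᵐᵒᵖ) M

instance : CoeSort B.Mod (Type u) := ⟨carrier⟩
instance (M : B.Mod) : AddCommGroup M := ModuleCat.isAddCommGroup (R := Aᵐᵒᵖ) M
instance (M : B.Mod) : Module Aᵐᵒᵖ M := ModuleCat.isModule (R := Aᵐᵒᵖ) M

variable (B) in
/-- A right `A`-module as an object of `ℳ_A`. -/
def of (M : Type u) [AddCommGroup M] [Module Aᵐᵒᵖ M] : B.Mod := ModuleCat.of Aᵐᵒᵖ M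

variable {M N P : B.Mod}

/-- The linear map underlying a morphism of `ℳ_A`. -/
def lin (f : M ⟶ N) : M →ₗ[Aᵐᵒᵖ] N := ModuleCat.Hom.hom (R := Aᵐᵒᵖ) f

/-- A linear map as a morphism of `ℳ_A`. -/
def ofLin (f : M →ₗ[Aᵐᵒᵖ] N) : M ⟶ N :=
  ConcreteCategory.ofHom (C := ModuleCat.{u} Aᵐᵒᵖ) f

@[simp] theorem lin_ofLin (f : M →ₗ[Aᵐᵒᵖ] N) : lin (ofLin f) = f := rfl
@[simp] theorem lin_id : lin (𝟙 M) = LinearMap.id := rfl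
@[simp] theorem lin_comp (f : M ⟶ N) (g : N ⟶ P) : lin (f ≫ g) = (lin g).comp (lin f) := rfl
@[simp] theorem lin_add (f g : M ⟶ N) : lin (f + g) = lin f + lin g := rfl

theorem hom_ext' {f g : M ⟶ N} (h : lin f = lin g) : f = g := ModuleCat.hom_ext (R := Aᵐᵒᵖ) h

/-- A linear equivalence as an isomorphism of `ℳ_A`. -/
def ofEquiv (e : M ≃ₗ[Aᵐᵒᵖ] N) : M ≅ N where
  hom := ofLin e.toLinearMap
  inv := ofLin e.symm.toLinearMap
  hom_inv_id := hom_ext' (by ext x; exact e.symm_apply_apply x)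
  inv_hom_id := hom_ext' (by ext x; exact e.apply_symm_apply x)

/-- The tensor product of `ℳ_A`. -/
def tensor (M N : B.Mod) : B.Mod := of B (B.Tens M N)

/-- The elementary tensor `m ⊗ n` in `M ⊗_R N`. -/
def tm (m : M) (n : N) : tensor M N := tmul (rightAct B.s M) (leftAct B.t N) m n

theorem tensor_ext {f g : tensor M N ⟶ P} (h : ∀ m n, lin f (tm m n) = lin g (tm m n)) : f = g :=
  hom_ext' (B.lin_ext (M := M) (N := N) h)

theorem tensor_ext₃ {Q : B.Mod} {f g : tensor (tensor M N) P ⟶ Q}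
    (h : ∀ m n p, lin f (tm (tm m n) p) = lin g (tm (tm m n) p)) : f = g :=
  hom_ext' (by
    have : (lin f).toAddMonoidHom = (lin g).toAddMonoidHom :=
      B.hom_ext₃ (M := M) (N := N) (P := P) h
    ext q
    exact DFunLike.congr_fun this q)

theorem tensor_ext₄ {Q T : B.Mod} {f g : tensor (tensor (tensor M N) P) Q ⟶ T}
    (h : ∀ m n p q, lin f (tm (tm (tm m n) p) q) = lin g (tm (tm (tm m n) p) q)) : f = g :=
  tensor_ext (fun x q => by
    have : ((lin f).toAddMonoidHom.comp ((tmulHom (rightAct B.s (tensor (tensor M N) P))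
        (leftAct B.t Q)).flip q)) = ((lin g).toAddMonoidHom.comp ((tmulHom (rightAct B.s
          (tensor (tensor M N) P)) (leftAct B.t Q)).flip q)) :=
      B.hom_ext₃ (M := M) (N := N) (P := P) (fun m n p => h m n p q)
    exact DFunLike.congr_fun this x)

/-- The tensor product of morphisms of `ℳ_A`. -/
def tensorMap {M M' N N' : B.Mod} (f : M ⟶ M') (g : N ⟶ N') : tensor M N ⟶ tensor M' N' :=
  ofLin (M := tensor M N) (N := tensor M' N') (B.tensMap (lin f) (lin g))

/-- The monoidal structure of `ℳ_A`: the tensor product over the base ring with the diagonal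
action, the base ring as unit object. -/
instance : MonoidalCategory B.Mod :=
  letI : MonoidalCategoryStruct B.Mod :=
    { tensorObj := tensor
      tensorHom := tensorMap
      whiskerLeft := fun M _ _ g => tensorMap (𝟙 M) g
      whiskerRight := fun f N => tensorMap f (𝟙 N)
      tensorUnit := of B B.UnitMod
      associator := fun M N P => ofEquiv (M := tensor (tensor M N) P)
        (N := tensor M (tensor N P)) (B.assocEquiv M N P)
      leftUnitor := fun M => ofEquiv (M := tensor (of B B.UnitMod) M) (B.lUnitEquiv M)
      rightUnitor := fun M => ofEquiv (M := tensor M (of B B.UnitMod)) (B.rUnitEquiv M) }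
  MonoidalCategory.ofTensorHom
    (id_tensorHom_id := fun M N => tensor_ext (fun m n => rfl))
    (id_tensorHom := fun M _ _ f => rfl)
    (tensorHom_id := fun f N => rfl)
    (tensorHom_comp_tensorHom := fun f₁ f₂ g₁ g₂ => tensor_ext (fun m n => rfl))
    (associator_naturality := fun f₁ f₂ f₃ => tensor_ext₃ (fun m n p => rfl))
    (leftUnitor_naturality := fun {M N} f => tensor_ext (fun r m => by
      change op (B.t (op (B.toUnit.symm r))) • lin f m = lin f (op (B.t (op (B.toUnit.symm r))) • m)
      rw [map_smul]))
    (rightUnitor_naturality := fun {M N} f => tensor_ext (fun m r => by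
      change op (B.s (B.toUnit.symm r)) • lin f m = lin f (op (B.s (B.toUnit.symm r)) • m)
      rw [map_smul]))
    (pentagon := fun M N P Q => tensor_ext₄ (fun m n p q => rfl))
    (triangle := fun M N => tensor_ext₃ (fun m r n =>
      (smul_tmul (B.toUnit.symm r) m n).symm))

end Mod

end RightBialgebroid

namespace RightBialgebroid.Mod

open BalTensor

variable {A R : Type u} [Ring A] [Ring R] {B : RightBialgebroid A R}

instance : MonoidalPreadditive B.Mod where
  whiskerLeft_zero := tensor_ext (fun _ _ => tmul_zero _)
  zero_whiskerRight := tensor_ext (fun _ _ => zero_tmul _)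
  whiskerLeft_add _ _ := tensor_ext (fun _ _ => tmul_add _ _ _)
  add_whiskerRight _ _ := tensor_ext (fun _ _ => add_tmul _ _ _)

section Colimits

open CategoryTheory.Limits

variable (B) in
/-- The functor sending a right module to its underlying abelian group. -/
def toAb : B.Mod ⥤ AddCommGrpCat.{u} := forget₂ (ModuleCat.{u} Aᵐᵒᵖ) AddCommGrpCat.{u}

instance : PreservesColimitsOfSize.{0, 0} (toAb B) :=
  have : PreservesColimitsOfSize.{u, u} (toAb B) :=
    ModuleCat.forget₂PreservesColimitsOfSize.{u, u, u, u} (R := Aᵐᵒᵖ)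
  preservesColimitsOfSize_shrink.{0, u, 0, u} (toAb B)

variable {J : Type} [SmallCategory J] {K : J ⥤ B.Mod} {c : Cocone K}

/-- Colimits in `ℳ_A` are colimits of abelian groups. -/
theorem exists_addHom (hc : IsColimit c) {T : Type u} [AddCommGroup T]
    (f : ∀ j, K.obj j →+ T) (hf : ∀ {j j'} (φ : j ⟶ j') x, f j' (lin (K.map φ) x) = f j x) :
    ∃ g : c.pt →+ T, ∀ j x, g (lin (c.ι.app j) x) = f j x := by
  have hc' : IsColimit ((toAb B).mapCocone c) := isColimitOfPreserves (toAb B) hc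
  let s : Cocone (K ⋙ toAb B) :=
    { pt := AddCommGrpCat.of T
      ι := { app := fun j => AddCommGrpCat.ofHom (X := (toAb B).obj (K.obj j)) (Y := AddCommGrpCat.of T) (f j)
             naturality := fun j j' φ => by ext x; exact hf φ x } }
  refine ⟨(hc'.desc s).hom, fun j x => ?_⟩
  exact ConcreteCategory.congr_hom (hc'.fac s j) x

theorem addHom_ext (hc : IsColimit c) {T : Type u} [AddCommGroup T] {g g' : c.pt →+ T}
    (h : ∀ j x, g (lin (c.ι.app j) x) = g' (lin (c.ι.app j) x)) : g = g' := by
  have hc' : IsColimit ((toAb B).mapCocone c) := isColimitOfPreserves (toAb B) hc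
  have : AddCommGrpCat.ofHom (X := (toAb B).obj c.pt) (Y := AddCommGrpCat.of T) g =
      AddCommGrpCat.ofHom (X := (toAb B).obj c.pt) (Y := AddCommGrpCat.of T) g' :=
    hc'.hom_ext (fun j => by ext x; exact h j x)
  ext x
  exact ConcreteCategory.congr_hom this x

theorem existsUnique_tensorLeft (M : B.Mod) (hc : IsColimit c) (s : Cocone (K ⋙ tensorLeft M)) :
    ∃! d : M ⊗ c.pt ⟶ s.pt, ∀ j, M ◁ c.ι.app j ≫ d = s.ι.app j := by
  have key : ∀ m : M, ∃ g : c.pt →+ s.pt, ∀ j x,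
      g (lin (c.ι.app j) x) = lin (s.ι.app j) (tm m x) := fun m => by
    let f : ∀ j, K.obj j →+ s.pt := fun j => (lin (s.ι.app j)).toAddMonoidHom.comp
      (tmulHom (rightAct B.s M) (leftAct B.t (K.obj j)) m)
    exact exists_addHom hc f (fun {j j'} φ x =>
      DFunLike.congr_fun (congrArg lin (s.w φ)) (tm m x))
  choose g hg using key
  have hlin : ∀ j (a : A) (x : K.obj j), op a • lin (c.ι.app j) x = lin (c.ι.app j) (op a • x) :=
    fun j a x => (map_smul _ _ _).symm
  let D : B.Tens M c.pt →+ s.pt := lift (AddMonoidHom.mk' g (fun m m' => addHom_ext hc (fun j x => by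
      rw [AddMonoidHom.add_apply, hg, hg, hg, ← map_add]
      exact congrArg _ (add_tmul _ _ _)))) (fun r m n => by
        have : g (rightAct B.s M r m) = (g m).comp (leftAct B.t c.pt r) :=
          addHom_ext hc (fun j x => by
            rw [AddMonoidHom.comp_apply, hg]
            change _ = g m (op (B.t (op r)) • _)
            rw [hlin, hg]
            exact congrArg _ (smul_tmul _ _ _))
        exact DFunLike.congr_fun this n)
  have hD : ∀ (a : A) (m : M) (n : c.pt),
      D (op a • (tmul _ _ m n : B.Tens M c.pt)) = op a • D (tmul _ _ m n) := by
    intro a m n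
    obtain ⟨k, x, y, h⟩ := exists_rep (B.γ a)
    rw [B.smul_tmul_of_rep a m n x y h, map_sum]
    have : ∑ i, (g (op (x i) • m)).comp (DistribSMul.toAddMonoidHom _ (op (y i))) =
        (DistribSMul.toAddMonoidHom _ (op a)).comp (g m) := addHom_ext hc (fun j z => by
      simp only [AddMonoidHom.finsetSum_apply, AddMonoidHom.comp_apply,
        DistribSMul.toAddMonoidHom_apply, hlin, hg]
      rw [← map_sum, ← map_smul]
      exact congrArg _ (B.smul_tmul_of_rep a m z x y h).symm)
    have h' := DFunLike.congr_fun this n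
    rw [AddMonoidHom.finsetSum_apply] at h'
    exact h'
  refine ⟨ofLin (M := tensor M c.pt) (B.linOfTmul D hD), fun j => tensor_ext (fun m x => hg m j x),
    fun d hd => tensor_ext (fun m n => ?_)⟩
  have : (lin d).toAddMonoidHom.comp (tmulHom (rightAct B.s M) (leftAct B.t c.pt) m) = g m :=
    addHom_ext hc (fun j x => by
      rw [hg, ← hd j]; rfl)
  exact DFunLike.congr_fun this n

theorem existsUnique_tensorRight (M : B.Mod) (hc : IsColimit c) (s : Cocone (K ⋙ tensorRight M)) :
    ∃! d : c.pt ⊗ M ⟶ s.pt, ∀ j, c.ι.app j ▷ M ≫ d = s.ι.app j := by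
  have key : ∀ m : M, ∃ g : c.pt →+ s.pt, ∀ j x,
      g (lin (c.ι.app j) x) = lin (s.ι.app j) (tm x m) := fun m => by
    let f : ∀ j, K.obj j →+ s.pt := fun j => (lin (s.ι.app j)).toAddMonoidHom.comp
      ((tmulHom (rightAct B.s (K.obj j)) (leftAct B.t M)).flip m)
    exact exists_addHom hc f (fun {j j'} φ x =>
      DFunLike.congr_fun (congrArg lin (s.w φ)) (tm x m))
  choose g hg using key
  have hlin : ∀ j (a : A) (x : K.obj j), op a • lin (c.ι.app j) x = lin (c.ι.app j) (op a • x) :=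
    fun j a x => (map_smul _ _ _).symm
  let D : B.Tens c.pt M →+ s.pt := lift (AddMonoidHom.mk' g (fun m m' => addHom_ext hc (fun j x => by
      rw [AddMonoidHom.add_apply, hg, hg, hg, ← map_add]
      exact congrArg _ (tmul_add _ _ _)))).flip (fun r n m => by
        have : (g m).comp (rightAct B.s c.pt r) = g (leftAct B.t M r m) :=
          addHom_ext hc (fun j x => by
            rw [AddMonoidHom.comp_apply, hg]
            change g m (op (B.s r) • _) = _
            rw [hlin, hg]
            exact congrArg _ (smul_tmul _ _ _))
        exact DFunLike.congr_fun this n)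
  have hD : ∀ (a : A) (n : c.pt) (m : M),
      D (op a • (tmul _ _ n m : B.Tens c.pt M)) = op a • D (tmul _ _ n m) := by
    intro a n m
    obtain ⟨k, x, y, h⟩ := exists_rep (B.γ a)
    rw [B.smul_tmul_of_rep a n m x y h, map_sum]
    have : ∑ i, (g (op (y i) • m)).comp (DistribSMul.toAddMonoidHom _ (op (x i))) =
        (DistribSMul.toAddMonoidHom _ (op a)).comp (g m) := addHom_ext hc (fun j z => by
      simp only [AddMonoidHom.finsetSum_apply, AddMonoidHom.comp_apply,
        DistribSMul.toAddMonoidHom_apply, hlin, hg]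
      rw [← map_sum, ← map_smul]
      exact congrArg _ (B.smul_tmul_of_rep a z m x y h).symm)
    have h' := DFunLike.congr_fun this n
    rw [AddMonoidHom.finsetSum_apply] at h'
    exact h'
  refine ⟨ofLin (M := tensor c.pt M) (B.linOfTmul D hD), fun j => tensor_ext (fun x m => hg m j x),
    fun d hd => tensor_ext (fun n m => ?_)⟩
  have : (lin d).toAddMonoidHom.comp ((tmulHom (rightAct B.s c.pt) (leftAct B.t M)).flip m) = g m :=
    addHom_ext hc (fun j x => by
      rw [hg, ← hd j]; rfl)
  exact DFunLike.congr_fun this n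

/-- A cocone with the universal property is a colimit cocone. -/
theorem nonempty_isColimit {C : Type*} [Category C] {I : Type*} [Category I] {F : I ⥤ C}
    (c : Cocone F) (h : ∀ s : Cocone F, ∃! d : c.pt ⟶ s.pt, ∀ j, c.ι.app j ≫ d = s.ι.app j) :
    Nonempty (IsColimit c) :=
  ⟨{ desc := fun s => (h s).exists.choose
     fac := fun s j => (h s).exists.choose_spec j
     uniq := fun s _ hm => (h s).unique hm (h s).exists.choose_spec }⟩

instance (M : B.Mod) : PreservesColimitsOfSize.{0, 0} (tensorLeft M) where
  preservesColimitsOfShape :=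
    ⟨⟨fun hc => nonempty_isColimit _ (fun s => existsUnique_tensorLeft M hc s)⟩⟩

instance (M : B.Mod) : PreservesColimitsOfSize.{0, 0} (tensorRight M) where
  preservesColimitsOfShape :=
    ⟨⟨fun hc => nonempty_isColimit _ (fun s => existsUnique_tensorRight M hc s)⟩⟩

end Colimits

end RightBialgebroid.Mod

section InternalBimodules

open CategoryTheory.Limits MonObj

variable {C : Type u} [Category.{v} C] [MonoidalCategory C]

section Additive

variable [Preadditive C] [MonoidalPreadditive C] {X Y : Mon C}

namespace Bimod

variable {P Q : Bimod X Y}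

instance : Zero (P ⟶ Q) := ⟨{ hom := 0, left_act_hom := by simp, right_act_hom := by simp }⟩

instance : Add (P ⟶ Q) := ⟨fun f g =>
  { hom := f.hom + g.hom
    left_act_hom := by
      rw [Preadditive.comp_add, f.left_act_hom, g.left_act_hom, MonoidalPreadditive.whiskerLeft_add,
        Preadditive.add_comp]
    right_act_hom := by
      rw [Preadditive.comp_add, f.right_act_hom, g.right_act_hom,
        MonoidalPreadditive.add_whiskerRight, Preadditive.add_comp] }⟩

instance : Neg (P ⟶ Q) := ⟨fun f =>
  { hom := -f.hom
    left_act_hom := by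
      have h : X.X ◁ (-f.hom) = -(X.X ◁ f.hom) := (tensorLeft X.X).map_neg
      rw [h, Preadditive.comp_neg, Preadditive.neg_comp, f.left_act_hom]
    right_act_hom := by
      have h : (-f.hom) ▷ Y.X = -(f.hom ▷ Y.X) := (tensorRight Y.X).map_neg
      rw [h, Preadditive.comp_neg, Preadditive.neg_comp, f.right_act_hom] }⟩

theorem add_hom (f g : P ⟶ Q) : (f + g).hom = f.hom + g.hom := rfl
theorem zero_hom : (0 : P ⟶ Q).hom = 0 := rfl
theorem neg_hom (f : P ⟶ Q) : (-f).hom = -f.hom := rfl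

/-- Bimodule maps are added in the ambient category. -/
instance : AddCommGroup (P ⟶ Q) where
  add_assoc f g h := hom_ext _ _ (add_assoc f.hom g.hom h.hom)
  zero_add f := hom_ext _ _ (zero_add f.hom)
  add_zero f := hom_ext _ _ (add_zero f.hom)
  neg_add_cancel f := hom_ext _ _ (neg_add_cancel f.hom)
  add_comm f g := hom_ext _ _ (add_comm f.hom g.hom)
  nsmul := nsmulRec
  zsmul := zsmulRec

instance : Preadditive (Bimod X Y) where
  add_comp _ _ _ f f' g := hom_ext _ _ (by
    change (f.hom + f'.hom) ≫ g.hom = f.hom ≫ g.hom + f'.hom ≫ g.hom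
    exact Preadditive.add_comp _ _ _ _ _ _)
  comp_add _ _ _ f g g' := hom_ext _ _ (by
    change f.hom ≫ (g.hom + g'.hom) = f.hom ≫ g.hom + f.hom ≫ g'.hom
    exact Preadditive.comp_add _ _ _ _ _ _)

end Bimod

end Additive

/-- An object `X` as the bimodule `_𝒰X_𝒰 = (X, l_X, r_X)` over the trivial monoid `𝒰`. -/
def unitUnitBimod (X : C) : Bimod (Mon.trivial C) (Mon.trivial C) where
  X := X
  actLeft := (λ_ X).hom
  actRight := (ρ_ X).hom
  one_actLeft := by
    change 𝟙 (𝟙_ C) ▷ X ≫ (λ_ X).hom = (λ_ X).hom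
    simp
  left_assoc := by
    change (λ_ (𝟙_ C)).hom ▷ X ≫ (λ_ X).hom =
      (α_ (𝟙_ C) (𝟙_ C) X).hom ≫ 𝟙_ C ◁ (λ_ X).hom ≫ (λ_ X).hom
    monoidal
  actRight_one := by
    change X ◁ 𝟙 (𝟙_ C) ≫ (ρ_ X).hom = (ρ_ X).hom
    simp
  right_assoc := by
    change X ◁ (λ_ (𝟙_ C)).hom ≫ (ρ_ X).hom =
      (α_ X (𝟙_ C) (𝟙_ C)).inv ≫ (ρ_ X).hom ▷ 𝟙_ C ≫ (ρ_ X).hom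
    monoidal
  middle_assoc := by
    change ((λ_ X).hom) ▷ 𝟙_ C ≫ (ρ_ X).hom = (α_ (𝟙_ C) X (𝟙_ C)).hom ≫ 𝟙_ C ◁ ((ρ_ X).hom) ≫ (λ_ X).hom
    simp

/-- A morphism of the ambient category as a map of `𝒰`-`𝒰`-bimodules. -/
def unitUnitBimodMap {X Y : C} (f : X ⟶ Y) : unitUnitBimod X ⟶ unitUnitBimod Y :=
  Bimod.Hom.mk (M := unitUnitBimod X) (N := unitUnitBimod Y) f
    (leftUnitor_naturality f).symm (rightUnitor_naturality f).symm

/-- The `𝒰`-`𝒬`-bimodule `_𝒰Q_𝒬 = (Q, l_Q, m)` of a monoid `𝒬 = (Q, m, η)`. -/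
def unitMonBimod (Q : Mon C) : Bimod (Mon.trivial C) Q where
  X := Q.X
  actLeft := (λ_ Q.X).hom
  actRight := μ[Q.X]
  one_actLeft := by
    change 𝟙 (𝟙_ C) ▷ Q.X ≫ (λ_ Q.X).hom = (λ_ Q.X).hom
    simp
  left_assoc := by
    change (λ_ (𝟙_ C)).hom ▷ Q.X ≫ (λ_ Q.X).hom =
      (α_ (𝟙_ C) (𝟙_ C) Q.X).hom ≫ 𝟙_ C ◁ (λ_ Q.X).hom ≫ (λ_ Q.X).hom
    monoidal
  actRight_one := by simp
  right_assoc := by simp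
  middle_assoc := by
    change ((λ_ Q.X).hom) ▷ Q.X ≫ μ[Q.X] = (α_ (𝟙_ C) Q.X Q.X).hom ≫ 𝟙_ C ◁ (μ[Q.X]) ≫ (λ_ Q.X).hom
    simp

/-- The `𝒬`-`𝒰`-bimodule `_𝒬Q_𝒰 = (Q, m, r_Q)` of a monoid `𝒬 = (Q, m, η)`. -/
def monUnitBimod (Q : Mon C) : Bimod Q (Mon.trivial C) where
  X := Q.X
  actLeft := μ[Q.X]
  actRight := (ρ_ Q.X).hom
  one_actLeft := by simp
  left_assoc := by simp
  actRight_one := by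
    change Q.X ◁ 𝟙 (𝟙_ C) ≫ (ρ_ Q.X).hom = (ρ_ Q.X).hom
    simp
  right_assoc := by
    change Q.X ◁ (λ_ (𝟙_ C)).hom ≫ (ρ_ Q.X).hom =
      (α_ Q.X (𝟙_ C) (𝟙_ C)).inv ≫ (ρ_ Q.X).hom ▷ 𝟙_ C ≫ (ρ_ Q.X).hom
    monoidal
  middle_assoc := by
    change (μ[Q.X]) ▷ 𝟙_ C ≫ (ρ_ Q.X).hom = (α_ Q.X Q.X (𝟙_ C)).hom ≫ Q.X ◁ ((ρ_ Q.X).hom) ≫ μ[Q.X]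
    simp

theorem unit_left_aux (Q : Mon C) {T : C} (p : Q.X ⊗ Q.X ⟶ T) (t : T ⟶ Q.X) (h : p ≫ t = μ[Q.X]) :
    ((α_ (𝟙_ C) Q.X Q.X).inv ≫ (λ_ Q.X).hom ▷ Q.X ≫ p) ≫ t =
      𝟙_ C ◁ p ≫ 𝟙_ C ◁ t ≫ (λ_ Q.X).hom := by
  rw [← MonoidalCategory.whiskerLeft_comp_assoc, Category.assoc, Category.assoc, h]
  simp

theorem unit_right_aux (Q : Mon C) {T : C} (p : Q.X ⊗ Q.X ⟶ T) (t : T ⟶ Q.X) (h : p ≫ t = μ[Q.X]) :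
    ((α_ Q.X Q.X (𝟙_ C)).hom ≫ Q.X ◁ (ρ_ Q.X).hom ≫ p) ≫ t =
      p ▷ 𝟙_ C ≫ t ▷ 𝟙_ C ≫ (ρ_ Q.X).hom := by
  rw [← MonoidalCategory.comp_whiskerRight_assoc, Category.assoc, Category.assoc, h]
  simp

section Bicat

variable [HasCoequalizers C]

section

variable (C)

/-- The bicategory `BIM(C)` of internal bimodules: 0-cells are the monoids of `C`, 1-cells are
bimodules, 2-cells are bimodule maps, horizontal composition is the tensor product of bimodules
(constructed as a coequalizer). The composite `M ≫ N` of an `𝒜`-`ℬ`-bimodule and a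
`ℬ`-`𝒞`-bimodule is `M ⊗_ℬ N`. -/
structure BIM where
  /-- the monoid -/
  mon : Mon C

variable [∀ X : C, PreservesColimitsOfSize.{0, 0} (tensorLeft X)]
  [∀ X : C, PreservesColimitsOfSize.{0, 0} (tensorRight X)]

noncomputable instance : Bicategory (BIM C) where
  Hom X Y := Bimod X.mon Y.mon
  homCategory X Y := (inferInstance : Category (Bimod X.mon Y.mon))
  id X := Bimod.regular X.mon
  comp M N := Bimod.tensorBimod M N
  whiskerLeft L _ _ f := Bimod.whiskerLeft L f
  whiskerRight f N := Bimod.whiskerRight f N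
  associator := Bimod.associatorBimod
  leftUnitor := Bimod.leftUnitorBimod
  rightUnitor := Bimod.rightUnitorBimod
  whiskerLeft_id _ _ := Bimod.whiskerLeft_id_bimod
  whiskerLeft_comp M _ _ _ f g := Bimod.whiskerLeft_comp_bimod M f g
  id_whiskerLeft := Bimod.id_whiskerLeft_bimod
  comp_whiskerLeft M N _ _ f := Bimod.comp_whiskerLeft_bimod M N f
  id_whiskerRight _ _ := Bimod.id_whiskerRight_bimod
  comp_whiskerRight f g Q := Bimod.comp_whiskerRight_bimod f g Q
  whiskerRight_id := Bimod.whiskerRight_id_bimod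
  whiskerRight_comp := Bimod.whiskerRight_comp_bimod
  whisker_assoc M _ _ f P := Bimod.whisker_assoc_bimod M f P
  whisker_exchange := Bimod.whisker_exchange_bimod
  pentagon := Bimod.pentagon_bimod
  triangle := Bimod.triangle_bimod

noncomputable instance [Preadditive C] [MonoidalPreadditive C] (a b : BIM C) :
    Preadditive (a ⟶ b) :=
  inferInstanceAs (Preadditive (Bimod a.mon b.mon))

end

variable [∀ X : C, PreservesColimitsOfSize.{0, 0} (tensorLeft X)]
  [∀ X : C, PreservesColimitsOfSize.{0, 0} (tensorRight X)]

namespace BIM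

variable (C) in
/-- The trivial monoid `𝒰` as a 0-cell. -/
def triv : BIM C := ⟨Mon.trivial C⟩

/-- A monoid as a 0-cell. -/
def ofMon (Q : Mon C) : BIM C := ⟨Q⟩

/-- The 1-cell `_𝒰Q_𝒬`. -/
def ext (Q : Mon C) : triv C ⟶ ofMon Q := unitMonBimod Q

/-- The 1-cell `_𝒬Q_𝒰`. -/
def extBar (Q : Mon C) : ofMon Q ⟶ triv C := monUnitBimod Q

/-- The 1-cell `_𝒰X_𝒰`. -/
def ofObj (X : C) : triv C ⟶ triv C := unitUnitBimod X

/-- The 2-cell given by a morphism of `C`. -/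
def ofHom {X Y : C} (f : X ⟶ Y) : ofObj X ⟶ ofObj Y := unitUnitBimodMap f

/-- The morphism of `C` underlying a 2-cell. -/
def hom {a b : BIM C} {f g : a ⟶ b} (φ : f ⟶ g) : Bimod.X f ⟶ Bimod.X g :=
  Bimod.Hom.hom φ

/-- The canonical projection `τ : M ⊗ N ⟶ M ⊗_ℬ N` onto the coequalizer. -/
noncomputable def proj {a b c : BIM C} (f : a ⟶ b) (g : b ⟶ c) :
    Bimod.X f ⊗ Bimod.X g ⟶ Bimod.X (f ≫ g) :=
  coequalizer.π _ _

theorem proj_leftUnitor (Q : Mon C) :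
    proj (ext Q) (extBar Q) ≫ Bimod.LeftUnitorBimod.hom (Bimod.regular Q) = μ[Q.X] :=
  coequalizer.π_desc _ _

/-- The isomorphism `t : _𝒰Q_𝒬 ⊗_𝒬 _𝒬Q_𝒰 ≅ _𝒰Q_𝒰` induced by the multiplication of `𝒬`. -/
noncomputable def multIso (Q : Mon C) : ext Q ≫ extBar Q ≅ ofObj Q.X :=
  Bimod.isoOfIso (C := C) (P := (unitMonBimod Q).tensorBimod (monUnitBimod Q))
    (Q := unitUnitBimod Q.X)
    { hom := Bimod.LeftUnitorBimod.hom (Bimod.regular Q)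
      inv := Bimod.LeftUnitorBimod.inv (Bimod.regular Q)
      hom_inv_id := Bimod.LeftUnitorBimod.hom_inv_id (Bimod.regular Q)
      inv_hom_id := Bimod.LeftUnitorBimod.inv_hom_id (Bimod.regular Q) }
    (by
      refine (cancel_epi ((tensorLeft (𝟙_ C)).map (coequalizer.π _ _))).1 ?_
      refine (Category.assoc _ _ _).symm.trans ?_
      refine (congrArg (· ≫ Bimod.LeftUnitorBimod.hom (Bimod.regular Q))
        (Bimod.TensorBimod.whiskerLeft_π_actLeft (unitMonBimod Q) (monUnitBimod Q))).trans ?_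
      exact unit_left_aux Q _ _ (proj_leftUnitor Q))
    (by
      refine (cancel_epi ((tensorRight (𝟙_ C)).map (coequalizer.π _ _))).1 ?_
      refine (Category.assoc _ _ _).symm.trans ?_
      refine (congrArg (· ≫ Bimod.LeftUnitorBimod.hom (Bimod.regular Q))
        (Bimod.TensorBimod.π_tensor_id_actRight (unitMonBimod Q) (monUnitBimod Q))).trans ?_
      exact unit_right_aux Q _ _ (proj_leftUnitor Q))

theorem proj_multIso (Q : Mon C) : proj (ext Q) (extBar Q) ≫ hom (multIso Q).hom = μ[Q.X] :=
  proj_leftUnitor Q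

end BIM

end Bicat

end InternalBimodules

section DepthTwo

open Bicategory BalTensor

/-- `X` is a direct summand in a finite direct sum of copies of `Y`. -/
def IsSummandOfCopies {C : Type*} [Category C] [Preadditive C] (X Y : C) : Prop :=
  ∃ (n : ℕ) (S : Limits.Bicone (fun _ : Fin n => Y)), Nonempty S.IsBilimit ∧ Nonempty (Retract X S.pt)

variable {𝒞 : Type*} [Bicategory 𝒞] [∀ a b : 𝒞, Preadditive (a ⟶ b)] {a b : 𝒞}

/-- The left D2 condition on a 1-cell `ι` with dual `ῑ`: `(ι × ῑ) × ι` is a direct summand in a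
finite direct sum of copies of `ι`. -/
def IsLeftD2 (ι : a ⟶ b) (ι' : b ⟶ a) : Prop := IsSummandOfCopies ((ι ≫ ι') ≫ ι) ι

/-- The right D2 condition on a 1-cell `ι` with dual `ῑ`: `(ῑ × ι) × ῑ` is a direct summand in a
finite direct sum of copies of `ῑ`. -/
def IsRightD2 (ι : a ⟶ b) (ι' : b ⟶ a) : Prop := IsSummandOfCopies ((ι' ≫ ι) ≫ ι') ι'

/-- The tensor product `A^L ⊗ _LA` of the ring `A` of 2-endomorphisms of `ι × ῑ` with itself over
the ring `L` of 2-endomorphisms of `ι`, for `a·l = a ∘ (l × ῑ)` and `l·a = (l × ῑ) ∘ a`. -/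
abbrev EndTensor (ι : a ⟶ b) (ι' : b ⟶ a) : Type _ :=
  BalTensor (R := (ι ⟶ ι)) (M := (ι ≫ ι' ⟶ ι ≫ ι')) (N := (ι ≫ ι' ⟶ ι ≫ ι'))
    (fun l => Preadditive.leftComp (ι ≫ ι') (l ▷ ι'))
    (fun l => Preadditive.rightComp (ι ≫ ι') (l ▷ ι'))

/-- The D2 quasi-basis property of `q = ∑ y_j ⊗ x_j`:
`∑ (y_j × ι) ∘ α⁻¹ ∘ (ι × coev_R) ∘ (ι × ev_L) ∘ α ∘ (x_j × ι) = id` on `(ι × ῑ) × ι`. -/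
def IsD2QuasiBasis {ι : a ⟶ b} {ι' : b ⟶ a} (evL : ι' ≫ ι ⟶ 𝟙 b) (coevR : 𝟙 b ⟶ ι' ≫ ι)
    (q : EndTensor ι ι') : Prop :=
  ∀ (n : ℕ) (y x : Fin n → (ι ≫ ι' ⟶ ι ≫ ι')), q = ∑ j, tmul _ _ (y j) (x j) →
    ∑ j, (x j ▷ ι) ≫ (α_ ι ι' ι).hom ≫ (ι ◁ evL) ≫ (ι ◁ coevR) ≫ (α_ ι ι' ι).inv ≫ (y j ▷ ι) =
      𝟙 ((ι ≫ ι') ≫ ι)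

end DepthTwo

namespace RightBialgebroid

open BalTensor

variable {A R : Type u} [Ring A] [Ring R] (B : RightBialgebroid A R)

/-- The right regular module `A_A`. -/
def reg : B.Mod := Mod.of B A

/-- An element of `A` as an element of the regular module. -/
def toReg : A ≃+ B.reg := AddEquiv.refl A

/-- An element of the base ring as an element of the monoidal unit `R_A`. -/
def toUnitObj : R ≃+ (𝟙_ B.Mod : B.Mod) := AddEquiv.refl R

/-- The elementary tensor `m ⊗ n` in the monoidal product of `ℳ_A`. -/
def Mod.elem {B : RightBialgebroid A R} {M N : B.Mod} (m : M) (n : N) : (M ⊗ N : B.Mod) :=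
  Mod.tm m n

/-- Left multiplication `Λ(h) k = h k`, an endomorphism of the right regular module. -/
def leftMul (h : A) : B.reg ⟶ B.reg :=
  Mod.ofLin (M := B.reg) (N := B.reg)
    { toFun := fun k : A => (h * k : A)
      map_add' := fun k k' => mul_add (R := A) h k k'
      map_smul' := fun a k => (mul_assoc (G := A) h k a.unop).symm }

/-- The coproduct `γ` as a morphism `A_A ⟶ A_A ⊗ A_A`. -/
def comulHom : B.reg ⟶ B.reg ⊗ B.reg :=
  Mod.ofLin (M := B.reg) (N := Mod.tensor B.reg B.reg)
    { B.γ with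
      map_smul' := fun a (k : A) => by
        change B.γ (k * a.unop) = B.diagAct a.unop (B.γ k)
        obtain ⟨n, x, y, h⟩ := exists_rep (B.γ k)
        obtain ⟨n', z, w, h'⟩ := exists_rep (B.γ a.unop)
        rw [B.γ_mul k a.unop n n' x y z w h h', h, map_sum]
        refine Finset.sum_congr rfl (fun j _ => ?_)
        rw [B.diagAct_of_rep _ _ _ z w h']
        rfl }

/-- The counit `π` as a morphism from `A_A` to the monoidal unit `R_A`. -/
def counitHom : B.reg ⟶ 𝟙_ B.Mod :=
  Mod.ofLin (M := B.reg) (N := Mod.of B B.UnitMod)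
    { B.π with
      map_smul' := fun a k => (B.π_s_mul k a.unop).symm }

end RightBialgebroid

namespace HopfAlgebroid

open MonObj

variable {H R : Type u} {L : Type v} [Ring H] [Ring R] [Ring L] (𝓗 : HopfAlgebroid H L R)

/-- The monoid `𝒬 = (H_H, ∗, η)` for a monoid structure on the right regular module. -/
abbrev monReg [MonObj 𝓗.right.reg] : Mon 𝓗.right.Mod := Mon.mk 𝓗.right.reg

/-- The `𝒰`-`𝒬`-bimodule `𝒳 = (H_H, l_H, ∗)`. -/
abbrev calX [MonObj 𝓗.right.reg] : BIM.triv 𝓗.right.Mod ⟶ BIM.ofMon 𝓗.monReg :=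
  BIM.ext 𝓗.monReg

/-- The `𝒬`-`𝒰`-bimodule `𝒳̄ = (H_H, ∗, r_H)`. -/
abbrev calXbar [MonObj 𝓗.right.reg] : BIM.ofMon 𝓗.monReg ⟶ BIM.triv 𝓗.right.Mod :=
  BIM.extBar 𝓗.monReg

/-- Left multiplication `Λ(h)` as a 2-endomorphism of `𝒳 ⊗_𝒬 𝒳̄ ≅ (H_H, l_H, r_H)`. -/
noncomputable def Lam [MonObj 𝓗.right.reg] (h : H) : 𝓗.calX ≫ 𝓗.calXbar ⟶ 𝓗.calX ≫ 𝓗.calXbar :=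
  (BIM.multIso 𝓗.monReg).hom ≫ BIM.ofHom (𝓗.right.leftMul h) ≫ (BIM.multIso 𝓗.monReg).inv

/-- The monoid structure on `H_H` is the convolution product of the integral `i`, with unit
`η(r) = i s_R(r)`. -/
structure IsConvolution {i : H} (hi : 𝓗.IsNondegenerate i) [MonObj 𝓗.right.reg] : Prop where
  mul : ∀ h k : H, RightBialgebroid.Mod.lin μ[𝓗.right.reg]
    (RightBialgebroid.Mod.elem (𝓗.right.toReg h) (𝓗.right.toReg k)) = 𝓗.right.toReg (conv hi h k)
  one : ∀ r : R, RightBialgebroid.Mod.lin η[𝓗.right.reg] (𝓗.right.toUnitObj r) =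
    𝓗.right.toReg (i * 𝓗.right.s r)

/-- The evaluations and coevaluations of the two dualities between `𝒳` and `𝒳̄` are
`ev_L = ∗`, `coev_L = t⁻¹ ∘ η`, `ev_R = π_R ∘ t`, `coev_R = γ_R`, where
`t : 𝒳 ⊗_𝒬 𝒳̄ ≅ (H_H, l_H, r_H)` is induced by `∗`, and `𝒳̄ ⊗_𝒰 𝒳` is identified with `H_H ⊗ H_H`
by the canonical projection. -/
structure IsCanonicalDuality [MonObj 𝓗.right.reg]
    (adjL : Bicategory.Adjunction 𝓗.calX 𝓗.calXbar)
    (adjR : Bicategory.Adjunction 𝓗.calXbar 𝓗.calX) : Prop where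
  evL : BIM.proj 𝓗.calXbar 𝓗.calX ≫ BIM.hom adjL.counit = μ[𝓗.right.reg]
  coevL : BIM.hom adjL.unit ≫ BIM.hom (BIM.multIso 𝓗.monReg).hom = η[𝓗.right.reg]
  evR : BIM.hom adjR.counit = BIM.hom (BIM.multIso 𝓗.monReg).hom ≫ 𝓗.right.counitHom
  coevR : BIM.hom adjR.unit = 𝓗.right.comulHom ≫ BIM.proj 𝓗.calXbar 𝓗.calX

end HopfAlgebroid

/-! Write `h ↼ φ` for the actions of the dual rings `_*𝓗` and `𝓗_*` on `H`, so that `_Li(φ) = i ↼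
φ`. Since `↼` is a right action of `_*𝓗` (`hitStarL_mulStarL`), one gets `h ∗ k = h ↼ _Li⁻¹(k)`;
hence `∗` is associative with two-sided unit `i`. The actions of the two duals commute by
coassociativity, so also `h ∗ k = k ↼ i_L⁻¹(h)`.

The integral property gives `i₁ a ⊗ i₂ = i₁ ⊗ i₂ S(a)` (`IsRightIntegral.mulRight₂_S`). Hence `S` is
anti-multiplicative, and `h ∗ k = t_L(φ(h₂ S(k))) h₁` with `φ = _Li⁻¹(1)` (`conv_eq_actStarL`). From
this closed form, `∗` is biadditive, `R`-balanced and `H`-linear, so `(H_H, ∗, η)` is a monoid in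
`ℳ_H`.

The mixed coassociativity laws say that `↼` acts on one leg of `γ_R`, which gives the Frobenius
relations `γ_R(h ∗ k) = h⁽¹⁾ ⊗ (h⁽²⁾ ∗ k) = (h ∗ k⁽¹⁾) ⊗ k⁽²⁾` (`isFrobenius`). For a Frobenius
monoid `Q` in a monoidal category with coequalizers preserved by tensoring, `Q` as a
`𝒰`-`𝒬`-bimodule and `Q` as a `𝒬`-`𝒰`-bimodule are two-sided duals: `adjL` uses only the monoid, and
`adjR` takes its unit and counit from the comonoid.

For the D2 condition, `t` replaces `(𝒳 × 𝒳̄) × 𝒳` by `Q ⊗ Q`, where `α⁻¹ ∘ (𝒳 × coev_R) ∘ (𝒳 × ev_L)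
∘ α` becomes `γ_R ∘ ∗` (`toLeftTriple_mul_comul`). The quasi-basis identity then reads `S(i₁) (i₂h ∗
k)⁽¹⁾ ⊗ (i₂h ∗ k)⁽²⁾ = h ⊗ k`. A Frobenius relation pulls `k` out, `S(i₁)(i₂h)⁽¹⁾ ⊗ (i₂h)⁽²⁾ = h ⊗
i` (`IsRightIntegral.sum_mulLeft₂_S`), and `i ∗ k = k`. Every summand factors through `𝒳 × 𝟙 ≅ 𝒳`,
which gives the left D2 condition; the right one is the mirror image, with `i₁` and `S⁻¹(i₂)`.

The quasi-basis is well defined because `s_L(l)(h ∗ k) = (s_L(l)h) ∗ k`: thus `Λ(s_L(l))` comes from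
a 2-endomorphism of `𝒳`, and `x ⊗ y ↦ Λ(S(x)) ⊗ Λ(y)` descends to `H_L ⊗ _LH`. -/

section InternalBimodules

open CategoryTheory.Limits MonObj

/-! ### Structural 2-cells of `BIM` computed on representatives -/

namespace BIM

variable {C : Type u} [Category.{v} C] [MonoidalCategory C] [HasCoequalizers C]
  [∀ X : C, PreservesColimitsOfSize.{0, 0} (tensorLeft X)]
  [∀ X : C, PreservesColimitsOfSize.{0, 0} (tensorRight X)]

open scoped Bicategory

variable {a b c d : BIM C}

theorem hom_inj {f g : a ⟶ b} {φ ψ : f ⟶ g} (h : hom φ = hom ψ) : φ = ψ :=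
  Bimod.hom_ext (M := f) (N := g) φ ψ h

theorem hom_comp {f g h : a ⟶ b} (φ : f ⟶ g) (ψ : g ⟶ h) : hom (φ ≫ ψ) = hom φ ≫ hom ψ := rfl

theorem hom_id (f : a ⟶ b) : hom (𝟙 f) = 𝟙 (Bimod.X f) := rfl

instance epi_proj (f : a ⟶ b) (g : b ⟶ c) : Epi (proj f g) :=
  inferInstanceAs (Epi (coequalizer.π _ _))

/-- Tensoring preserves colimits, so the projection onto a tensor product over a monoid stays epi
after whiskering. Equations between maps out of such composites can therefore be checked on
representatives in the ambient tensor product. -/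
instance epi_proj_whiskerRight (f : a ⟶ b) (g : b ⟶ c) (X : C) : Epi (proj f g ▷ X) :=
  inferInstanceAs (Epi ((tensorRight X).map (coequalizer.π _ _)))

instance epi_whiskerLeft_proj (f : a ⟶ b) (g : b ⟶ c) (X : C) : Epi (X ◁ proj f g) :=
  inferInstanceAs (Epi ((tensorLeft X).map (coequalizer.π _ _)))

/-- This and the next lemmas compute whiskerings, unitors and associators before passing to the
coequalizer; each comes from the defining property of a map induced on a coequalizer. -/
theorem proj_whiskerRight {f f' : a ⟶ b} (φ : f ⟶ f') (g : b ⟶ c) :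
    proj f g ≫ hom (φ ▷ g) = hom φ ▷ Bimod.X g ≫ proj f' g :=
  ι_colimMap _ _

theorem proj_whiskerLeft (f : a ⟶ b) {g g' : b ⟶ c} (φ : g ⟶ g') :
    proj f g ≫ hom (f ◁ φ) = Bimod.X f ◁ hom φ ≫ proj f g' :=
  ι_colimMap _ _

theorem proj_leftUnitor_hom (f : a ⟶ b) : proj (𝟙 a) f ≫ hom (Bicategory.leftUnitor f).hom = Bimod.actLeft f :=
  coequalizer.π_desc _ _

theorem proj_rightUnitor_hom (f : a ⟶ b) : proj f (𝟙 b) ≫ hom (Bicategory.rightUnitor f).hom = Bimod.actRight f :=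
  coequalizer.π_desc _ _

/-- The associator descends twice: along the outer coequalizer, then along the inner one tensored
with the third factor. Undoing both leaves the ambient associator. -/
theorem proj_associator_hom (f : a ⟶ b) (g : b ⟶ c) (h : c ⟶ d) :
    proj f g ▷ Bimod.X h ≫ proj (f ≫ g) h ≫ hom (α_ f g h).hom =
      (α_ (Bimod.X f) (Bimod.X g) (Bimod.X h)).hom ≫ Bimod.X f ◁ proj g h ≫ proj f (g ≫ h) := by
  have h₁ : proj (f ≫ g) h ≫ hom (α_ f g h).hom = Bimod.AssociatorBimod.homAux f g h :=
    coequalizer.π_desc _ _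
  rw [h₁]
  exact π_tensor_id_preserves_coequalizer_inv_desc _ _ _ _

theorem proj_associator_inv (f : a ⟶ b) (g : b ⟶ c) (h : c ⟶ d) :
    Bimod.X f ◁ proj g h ≫ proj f (g ≫ h) ≫ hom (α_ f g h).inv =
      (α_ (Bimod.X f) (Bimod.X g) (Bimod.X h)).inv ≫ proj f g ▷ Bimod.X h ≫ proj (f ≫ g) h := by
  have h₁ : proj f (g ≫ h) ≫ hom (α_ f g h).inv = Bimod.AssociatorBimod.invAux f g h :=
    coequalizer.π_desc _ _
  rw [h₁]
  exact id_tensor_π_preserves_coequalizer_inv_desc _ _ _ _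

theorem whiskerLeft_proj_actLeft (f : a ⟶ b) (g : b ⟶ c) :
    a.mon.X ◁ proj f g ≫ Bimod.actLeft (f ≫ g) =
      (α_ a.mon.X (Bimod.X f) (Bimod.X g)).inv ≫ Bimod.actLeft f ▷ Bimod.X g ≫ proj f g :=
  Bimod.TensorBimod.whiskerLeft_π_actLeft f g

theorem proj_whiskerRight_actRight (f : a ⟶ b) (g : b ⟶ c) :
    proj f g ▷ c.mon.X ≫ Bimod.actRight (f ≫ g) =
      (α_ (Bimod.X f) (Bimod.X g) c.mon.X).hom ≫ Bimod.X f ◁ Bimod.actRight g ≫ proj f g :=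
  Bimod.TensorBimod.π_tensor_id_actRight f g

/-- The relation `x b ⊗ y = x ⊗ b y` that defines the tensor product over the middle monoid. -/
theorem proj_condition (f : a ⟶ b) (g : b ⟶ c) :
    Bimod.actRight f ▷ Bimod.X g ≫ proj f g =
      (α_ (Bimod.X f) b.mon.X (Bimod.X g)).hom ≫ Bimod.X f ◁ Bimod.actLeft g ≫ proj f g :=
  (coequalizer.condition _ _).trans (Category.assoc _ _ _)

theorem hom_isoHom_inv {f g : a ⟶ b} (e : f ≅ g) : hom e.hom ≫ hom e.inv = 𝟙 (Bimod.X f) := by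
  rw [← hom_comp, e.hom_inv_id, hom_id]

theorem hom_isoInv_hom {f g : a ⟶ b} (e : f ≅ g) : hom e.inv ≫ hom e.hom = 𝟙 (Bimod.X g) := by
  rw [← hom_comp, e.inv_hom_id, hom_id]

theorem comp_hom_isoInv {f g : a ⟶ b} (e : f ≅ g) {Z : C} {p : Z ⟶ Bimod.X f} {q : Z ⟶ Bimod.X g}
    (h : p ≫ hom e.hom = q) : q ≫ hom e.inv = p := by
  rw [← h, Category.assoc, hom_isoHom_inv, Category.comp_id]

/-- `t⁻¹` sends `μ(x ⊗ y)` to the class of `x ⊗ y`. -/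
theorem mul_multIso_inv (Q : Mon C) : μ[Q.X] ≫ hom (multIso Q).inv = proj (ext Q) (extBar Q) :=
  comp_hom_isoInv (multIso Q) (proj_multIso Q)

/-- `hom` is additive. -/
theorem hom_sum [Preadditive C] [MonoidalPreadditive C] {f g : a ⟶ b} {J : Type*} (s : Finset J)
    (φ : J → (f ⟶ g)) : hom (∑ j ∈ s, φ j) = ∑ j ∈ s, hom (φ j) :=
  map_sum (AddMonoidHom.mk' (fun φ : f ⟶ g => hom φ) (fun _ _ => rfl)) φ s

end BIM

end InternalBimodules

/-! ### Frobenius monoids and their two adjunctions -/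

section FrobeniusMonoids

open CategoryTheory.Limits MonObj

namespace BIM

variable {C : Type u} [Category.{v} C] [MonoidalCategory C] [HasCoequalizers C]
  [∀ X : C, PreservesColimitsOfSize.{0, 0} (tensorLeft X)]
  [∀ X : C, PreservesColimitsOfSize.{0, 0} (tensorRight X)]

open scoped Bicategory

section Cells

variable {a b c : BIM C}

/-- The morphism out of a horizontal composite induced by a balanced morphism. -/
noncomputable def desc {f : a ⟶ b} {g : b ⟶ c} {Z : C} (p : Bimod.X f ⊗ Bimod.X g ⟶ Z)
    (hp : Bimod.actRight f ▷ Bimod.X g ≫ p =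
      (α_ (Bimod.X f) b.mon.X (Bimod.X g)).hom ≫ Bimod.X f ◁ Bimod.actLeft g ≫ p) :
    Bimod.X (f ≫ g) ⟶ Z :=
  coequalizer.desc p (hp.trans (Category.assoc _ _ _).symm)

theorem proj_desc {f : a ⟶ b} {g : b ⟶ c} {Z : C} (p : Bimod.X f ⊗ Bimod.X g ⟶ Z) (hp) :
    proj f g ≫ desc p hp = p :=
  coequalizer.π_desc _ _

/-- The 2-cell out of a horizontal composite induced by a balanced bimodule map. -/
noncomputable def descCell {f : a ⟶ b} {g : b ⟶ c} {h : a ⟶ c} (p : Bimod.X f ⊗ Bimod.X g ⟶ Bimod.X h)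
    (hp : Bimod.actRight f ▷ Bimod.X g ≫ p =
      (α_ (Bimod.X f) b.mon.X (Bimod.X g)).hom ≫ Bimod.X f ◁ Bimod.actLeft g ≫ p)
    (hl : (α_ a.mon.X (Bimod.X f) (Bimod.X g)).inv ≫ Bimod.actLeft f ▷ Bimod.X g ≫ p =
      a.mon.X ◁ p ≫ Bimod.actLeft h)
    (hr : (α_ (Bimod.X f) (Bimod.X g) c.mon.X).hom ≫ Bimod.X f ◁ Bimod.actRight g ≫ p =
      p ▷ c.mon.X ≫ Bimod.actRight h) : f ≫ g ⟶ h :=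
  Bimod.Hom.mk (M := f ≫ g) (N := h) (desc p hp)
    (by
      refine (cancel_epi (a.mon.X ◁ proj f g)).1 ?_
      refine (Category.assoc _ _ _).symm.trans ?_
      rw [whiskerLeft_proj_actLeft, Category.assoc, Category.assoc, proj_desc, hl,
        ← MonoidalCategory.whiskerLeft_comp_assoc, proj_desc])
    (by
      refine (cancel_epi (proj f g ▷ c.mon.X)).1 ?_
      refine (Category.assoc _ _ _).symm.trans ?_
      rw [proj_whiskerRight_actRight, Category.assoc, Category.assoc, proj_desc, hr,
        ← MonoidalCategory.comp_whiskerRight_assoc, proj_desc])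

theorem proj_descCell {f : a ⟶ b} {g : b ⟶ c} {h : a ⟶ c} (p : Bimod.X f ⊗ Bimod.X g ⟶ Bimod.X h)
    (hp hl hr) : proj f g ≫ hom (descCell p hp hl hr) = p :=
  proj_desc p hp

/-- The 2-cell into a horizontal composite `f ≫ g` given by a bimodule map to `f ⊗ g`. -/
noncomputable def projCell {f : a ⟶ b} {g : b ⟶ c} {h : a ⟶ c} (p : Bimod.X h ⟶ Bimod.X f ⊗ Bimod.X g)
    (hl : a.mon.X ◁ p ≫ (α_ a.mon.X (Bimod.X f) (Bimod.X g)).inv ≫ Bimod.actLeft f ▷ Bimod.X g =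
      Bimod.actLeft h ≫ p)
    (hr : p ▷ c.mon.X ≫ (α_ (Bimod.X f) (Bimod.X g) c.mon.X).hom ≫ Bimod.X f ◁ Bimod.actRight g =
      Bimod.actRight h ≫ p) : h ⟶ f ≫ g :=
  Bimod.Hom.mk (M := h) (N := f ≫ g) (p ≫ proj f g)
    (by
      rw [MonoidalCategory.whiskerLeft_comp, Category.assoc, whiskerLeft_proj_actLeft,
        ← Category.assoc, ← hl]
      simp only [Category.assoc])
    (by
      rw [MonoidalCategory.comp_whiskerRight, Category.assoc, proj_whiskerRight_actRight,
        ← Category.assoc, ← hr]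
      simp only [Category.assoc])

/-- When `φ` lifts to a morphism `p` into the ambient tensor product, the zigzag on representatives
involves only `p`, `e` and the ambient associator. This turns the triangle identities into equations
in `C`. -/
theorem proj_zigzag {j : a ⟶ a} {k : b ⟶ b} {f : a ⟶ b} {g : b ⟶ a} (φ : j ⟶ f ≫ g)
    (ψ : g ≫ f ⟶ k) (p : Bimod.X j ⟶ Bimod.X f ⊗ Bimod.X g)
    (e : Bimod.X g ⊗ Bimod.X f ⟶ Bimod.X k) (hp : hom φ = p ≫ proj f g)
    (he : proj g f ≫ hom ψ = e) :
    proj j f ≫ hom (φ ▷ f ≫ (Bicategory.associator f g f).hom ≫ f ◁ ψ) =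
      p ▷ Bimod.X f ≫ (α_ (Bimod.X f) (Bimod.X g) (Bimod.X f)).hom ≫ Bimod.X f ◁ e ≫ proj f k := by
  have h := congrArg (fun z => p ▷ Bimod.X f ≫ z ≫ hom (f ◁ ψ)) (proj_associator_hom f g f)
  simp only [Category.assoc] at h
  rw [proj_whiskerLeft, ← MonoidalCategory.whiskerLeft_comp_assoc, he] at h
  rw [← h, hom_comp, hom_comp, ← Category.assoc, proj_whiskerRight, hp,
    MonoidalCategory.comp_whiskerRight]
  simp only [Category.assoc]

theorem proj_zigzag' {j : a ⟶ a} {k : b ⟶ b} {f : a ⟶ b} {g : b ⟶ a} (φ : j ⟶ f ≫ g)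
    (ψ : g ≫ f ⟶ k) (p : Bimod.X j ⟶ Bimod.X f ⊗ Bimod.X g)
    (e : Bimod.X g ⊗ Bimod.X f ⟶ Bimod.X k) (hp : hom φ = p ≫ proj f g)
    (he : proj g f ≫ hom ψ = e) :
    proj g j ≫ hom (g ◁ φ ≫ (Bicategory.associator g f g).inv ≫ ψ ▷ g) =
      Bimod.X g ◁ p ≫ (α_ (Bimod.X g) (Bimod.X f) (Bimod.X g)).inv ≫ e ▷ Bimod.X g ≫ proj k g := by
  have h := congrArg (fun z => Bimod.X g ◁ p ≫ z ≫ hom (ψ ▷ g)) (proj_associator_inv g f g)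
  simp only [Category.assoc] at h
  rw [proj_whiskerRight, ← MonoidalCategory.comp_whiskerRight_assoc, he] at h
  rw [← h, hom_comp, hom_comp, ← Category.assoc, proj_whiskerLeft, hp,
    MonoidalCategory.whiskerLeft_comp]
  simp only [Category.assoc]

/-- The first triangle identity, for a unit that factors through `f ⊗ g`. -/
theorem leftZigzag_eq {f : a ⟶ b} {g : b ⟶ a} (φ : 𝟙 a ⟶ f ≫ g) (ψ : g ≫ f ⟶ 𝟙 b)
    (p : a.mon.X ⟶ Bimod.X f ⊗ Bimod.X g) (e : Bimod.X g ⊗ Bimod.X f ⟶ b.mon.X)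
    (hp : hom φ = p ≫ proj f g) (he : proj g f ≫ hom ψ = e)
    (h : p ▷ Bimod.X f ≫ (α_ (Bimod.X f) (Bimod.X g) (Bimod.X f)).hom ≫ Bimod.X f ◁ e ≫
      Bimod.actRight f = Bimod.actLeft f) :
    Bicategory.leftZigzag φ ψ =
      (Bicategory.leftUnitor f).hom ≫ (Bicategory.rightUnitor f).inv := by
  have h₁ : Bicategory.leftZigzag φ ψ =
      φ ▷ f ≫ (Bicategory.associator f g f).hom ≫ f ◁ ψ := by
    simp [bicategoricalComp]
  rw [h₁, Iso.eq_comp_inv]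
  apply hom_inj
  -- On representatives the two unitors become the left and right actions, so that only `h` is left.
  refine (cancel_epi (proj (𝟙 a) f)).1 ?_
  rw [proj_leftUnitor_hom, hom_comp, ← Category.assoc, proj_zigzag φ ψ p e hp he]
  simp only [Category.assoc]
  rw [proj_rightUnitor_hom]
  exact h

/-- The second triangle identity, for a unit that factors through `f ⊗ g`. -/
theorem rightZigzag_eq {f : a ⟶ b} {g : b ⟶ a} (φ : 𝟙 a ⟶ f ≫ g) (ψ : g ≫ f ⟶ 𝟙 b)
    (p : a.mon.X ⟶ Bimod.X f ⊗ Bimod.X g) (e : Bimod.X g ⊗ Bimod.X f ⟶ b.mon.X)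
    (hp : hom φ = p ≫ proj f g) (he : proj g f ≫ hom ψ = e)
    (h : Bimod.X g ◁ p ≫ (α_ (Bimod.X g) (Bimod.X f) (Bimod.X g)).inv ≫ e ▷ Bimod.X g ≫
      Bimod.actLeft g = Bimod.actRight g) :
    Bicategory.rightZigzag φ ψ =
      (Bicategory.rightUnitor g).hom ≫ (Bicategory.leftUnitor g).inv := by
  have h₁ : Bicategory.rightZigzag φ ψ =
      g ◁ φ ≫ (Bicategory.associator g f g).inv ≫ ψ ▷ g := by
    simp [bicategoricalComp]
  rw [h₁, Iso.eq_comp_inv]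
  apply hom_inj
  refine (cancel_epi (proj g (𝟙 a))).1 ?_
  rw [proj_rightUnitor_hom, hom_comp, ← Category.assoc, proj_zigzag' φ ψ p e hp he]
  simp only [Category.assoc]
  rw [proj_leftUnitor_hom]
  exact h

variable (C) in
/-- The identity 1-cell of the trivial monoid is the unit object. -/
def idTriv : 𝟙 (triv C) ⟶ ofObj (𝟙_ C) :=
  Bimod.Hom.mk (M := Bimod.regular (Mon.trivial C)) (N := unitUnitBimod (𝟙_ C)) (𝟙 (𝟙_ C))
    (by
      change (λ_ (𝟙_ C)).hom ≫ 𝟙 (𝟙_ C) = 𝟙_ C ◁ 𝟙 (𝟙_ C) ≫ (λ_ (𝟙_ C)).hom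
      simp)
    (by
      change (λ_ (𝟙_ C)).hom ≫ 𝟙 (𝟙_ C) = 𝟙 (𝟙_ C) ▷ 𝟙_ C ≫ (ρ_ (𝟙_ C)).hom
      -- The regular bimodule of the trivial monoid acts on the right by the left unitor,
      -- `unitUnitBimod` by the right unitor; on the unit object they agree.
      simp [unitors_equal])

variable (C) in
/-- The unit object is the identity 1-cell of the trivial monoid. -/
def trivId : ofObj (𝟙_ C) ⟶ 𝟙 (triv C) :=
  Bimod.Hom.mk (M := unitUnitBimod (𝟙_ C)) (N := Bimod.regular (Mon.trivial C)) (𝟙 (𝟙_ C))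
    (by
      change (λ_ (𝟙_ C)).hom ≫ 𝟙 (𝟙_ C) = 𝟙_ C ◁ 𝟙 (𝟙_ C) ≫ (λ_ (𝟙_ C)).hom
      simp)
    (by
      change (ρ_ (𝟙_ C)).hom ≫ 𝟙 (𝟙_ C) = 𝟙 (𝟙_ C) ▷ 𝟙_ C ≫ (λ_ (𝟙_ C)).hom
      simp [unitors_equal])

end Cells

/-- A comonoid structure `(δ, ν)` making the monoid `Q` a Frobenius monoid. Coassociativity is a
consequence of the Frobenius relations. -/
structure IsFrobenius (Q : Mon C) (δ : Q.X ⟶ Q.X ⊗ Q.X) (ν : Q.X ⟶ 𝟙_ C) : Prop where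
  left : Q.X ◁ δ ≫ (α_ Q.X Q.X Q.X).inv ≫ μ[Q.X] ▷ Q.X = μ[Q.X] ≫ δ
  right : δ ▷ Q.X ≫ (α_ Q.X Q.X Q.X).hom ≫ Q.X ◁ μ[Q.X] = μ[Q.X] ≫ δ
  counit_left : δ ≫ ν ▷ Q.X ≫ (λ_ Q.X).hom = 𝟙 Q.X
  counit_right : δ ≫ Q.X ◁ ν ≫ (ρ_ Q.X).hom = 𝟙 Q.X

variable (Q : Mon C)

/-- The multiplication as a 2-cell `_𝒬Q ⊗ Q_𝒬 ⟶ 𝒬`. -/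
noncomputable def mulCell : extBar Q ≫ ext Q ⟶ 𝟙 (ofMon Q) :=
  descCell (f := extBar Q) (g := ext Q) (h := 𝟙 (ofMon Q)) (μ[Q.X] : Q.X ⊗ Q.X ⟶ Q.X)
    (by
      change (ρ_ Q.X).hom ▷ Q.X ≫ μ[Q.X] =
        (α_ Q.X (𝟙_ C) Q.X).hom ≫ Q.X ◁ (λ_ Q.X).hom ≫ μ[Q.X]
      simp)
    (by
      change (α_ Q.X Q.X Q.X).inv ≫ μ[Q.X] ▷ Q.X ≫ μ[Q.X] = Q.X ◁ μ[Q.X] ≫ μ[Q.X]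
      simp)
    (by
      change (α_ Q.X Q.X Q.X).hom ≫ Q.X ◁ μ[Q.X] ≫ μ[Q.X] = μ[Q.X] ▷ Q.X ≫ μ[Q.X]
      simp)

theorem proj_mulCell : proj (extBar Q) (ext Q) ≫ hom (mulCell Q) = μ[Q.X] :=
  proj_descCell _ _ _ _

/-- The unit as a 2-cell `𝒰 ⟶ Q ⊗_𝒬 Q`. -/
noncomputable def oneCell : 𝟙 (triv C) ⟶ ext Q ≫ extBar Q :=
  idTriv C ≫ ofHom η[Q.X] ≫ (multIso Q).inv

theorem hom_oneCell : hom (oneCell Q) = η[Q.X] ≫ hom (multIso Q).inv :=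
  Category.id_comp _

/-- In elements, `t⁻¹(x)` is the class of `1 ⊗ x`, because `1 x = x`. So `t⁻¹` lifts to the ambient
tensor product, as the zigzag lemmas require. -/
theorem multIso_inv_eq :
    hom (multIso Q).inv = ((λ_ Q.X).inv ≫ η[Q.X] ▷ Q.X) ≫ proj (ext Q) (extBar Q) :=
  (Category.id_comp (hom (multIso Q).inv)).symm.trans
    ((congrArg (· ≫ hom (multIso Q).inv)
      (show 𝟙 Q.X = ((λ_ Q.X).inv ≫ η[Q.X] ▷ Q.X) ≫ μ[Q.X] by simp)).trans
      ((Category.assoc _ _ _).trans (congrArg (_ ≫ ·) (mul_multIso_inv Q))))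

/-- The adjunction between `_𝒰Q_𝒬` and `_𝒬Q_𝒰` given by the monoid structure. -/
noncomputable def adjL : Bicategory.Adjunction (ext Q) (extBar Q) where
  unit := oneCell Q
  counit := mulCell Q
  left_triangle := by
    -- The lift of `t⁻¹ ∘ η` is `1 ⊗ 1`, by `multIso_inv_eq`.
    refine leftZigzag_eq _ _ (η[Q.X] ≫ (λ_ Q.X).inv ≫ η[Q.X] ▷ Q.X : 𝟙_ C ⟶ Q.X ⊗ Q.X) μ[Q.X]
      ?_ (proj_mulCell Q) ?_
    · exact (hom_oneCell Q).trans ((congrArg (η[Q.X] ≫ ·) (multIso_inv_eq Q)).trans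
        (Category.assoc _ _ _).symm)
    · change (η[Q.X] ≫ (λ_ Q.X).inv ≫ η[Q.X] ▷ Q.X) ▷ Q.X ≫ (α_ Q.X Q.X Q.X).hom ≫
        Q.X ◁ μ[Q.X] ≫ μ[Q.X] = (λ_ Q.X).hom
      rw [← mul_assoc, ← comp_whiskerRight_assoc]
      simp
  right_triangle := by
    refine rightZigzag_eq _ _ (η[Q.X] ≫ (λ_ Q.X).inv ≫ η[Q.X] ▷ Q.X : 𝟙_ C ⟶ Q.X ⊗ Q.X) μ[Q.X]
      ?_ (proj_mulCell Q) ?_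
    · exact (hom_oneCell Q).trans ((congrArg (η[Q.X] ≫ ·) (multIso_inv_eq Q)).trans
        (Category.assoc _ _ _).symm)
    · change Q.X ◁ (η[Q.X] ≫ (λ_ Q.X).inv ≫ η[Q.X] ▷ Q.X) ≫ (α_ Q.X Q.X Q.X).inv ≫
        μ[Q.X] ▷ Q.X ≫ μ[Q.X] = (ρ_ Q.X).hom
      rw [mul_assoc, Iso.inv_hom_id_assoc, ← MonoidalCategory.whiskerLeft_comp_assoc]
      simp

variable {Q} {δ : Q.X ⟶ Q.X ⊗ Q.X} {ν : Q.X ⟶ 𝟙_ C} (F : IsFrobenius Q δ ν)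

/-- The comultiplication as a 2-cell `𝒬 ⟶ _𝒬Q ⊗ Q_𝒬`. -/
noncomputable def comulCell : 𝟙 (ofMon Q) ⟶ extBar Q ≫ ext Q :=
  projCell (f := extBar Q) (g := ext Q) (h := 𝟙 (ofMon Q)) δ F.left F.right

/-- The adjunction between `_𝒬Q_𝒰` and `_𝒰Q_𝒬` given by the comonoid structure. -/
noncomputable def adjR : Bicategory.Adjunction (extBar Q) (ext Q) where
  unit := comulCell F
  counit := (multIso Q).hom ≫ ofHom ν ≫ trivId C
  left_triangle := by
    -- Here the unit comes with the lift `δ`, and the counit is `μ ≫ ν` on representatives.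
    refine leftZigzag_eq _ _ δ (μ[Q.X] ≫ ν : Q.X ⊗ Q.X ⟶ 𝟙_ C) rfl ?_ ?_
    · exact (Category.assoc _ _ _).symm.trans ((congrArg (· ≫ ν ≫ 𝟙 (𝟙_ C)) (proj_multIso Q)).trans
        (congrArg (μ[Q.X] ≫ ·) (Category.comp_id ν)))
    · change δ ▷ Q.X ≫ (α_ Q.X Q.X Q.X).hom ≫ Q.X ◁ (μ[Q.X] ≫ ν) ≫ (ρ_ Q.X).hom = μ[Q.X]
      -- The Frobenius relation brings `δ` behind `μ`, where the counit law cancels it against `ν`.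
      have h := congrArg (· ≫ Q.X ◁ ν ≫ (ρ_ Q.X).hom) F.right
      simp only [Category.assoc, F.counit_right, Category.comp_id] at h
      rw [MonoidalCategory.whiskerLeft_comp, Category.assoc, h]
  right_triangle := by
    refine rightZigzag_eq _ _ δ (μ[Q.X] ≫ ν : Q.X ⊗ Q.X ⟶ 𝟙_ C) rfl ?_ ?_
    · exact (Category.assoc _ _ _).symm.trans ((congrArg (· ≫ ν ≫ 𝟙 (𝟙_ C)) (proj_multIso Q)).trans
        (congrArg (μ[Q.X] ≫ ·) (Category.comp_id ν)))
    · change Q.X ◁ δ ≫ (α_ Q.X Q.X Q.X).inv ≫ (μ[Q.X] ≫ ν) ▷ Q.X ≫ (λ_ Q.X).hom = μ[Q.X]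
      have h := congrArg (· ≫ ν ▷ Q.X ≫ (λ_ Q.X).hom) F.left
      simp only [Category.assoc, F.counit_left, Category.comp_id] at h
      rw [MonoidalCategory.comp_whiskerRight, Category.assoc, h]

end BIM

end FrobeniusMonoids

/-! ### The D2 endomorphism of the triple composites, read on `Q ⊗ Q` -/

section DepthTwoCells

open CategoryTheory.Limits MonObj

namespace BIM

variable {C : Type u} [Category.{v} C] [MonoidalCategory C] [HasCoequalizers C]
  [∀ X : C, PreservesColimitsOfSize.{0, 0} (tensorLeft X)]
  [∀ X : C, PreservesColimitsOfSize.{0, 0} (tensorRight X)]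

open scoped Bicategory

section Cells

variable {a b : BIM C} {f : a ⟶ b} {g : b ⟶ a} {Y : C} {m : Bimod.X f ⊗ Bimod.X g ⟶ Y}
  {s : Y ⟶ Bimod.X (f ≫ g)} (hm : m ≫ s = proj f g)

include hm

/-- The pair `m`, `s` replaces the object underlying `f ≫ g` by an ambient object `Y`; below, `m` is
the multiplication of `Q` and `s` is `t⁻¹`. The four lemmas of this section treat the evaluation and
coevaluation halves of the D2 endomorphism, for both bracketings. -/
theorem whiskerRight_proj_associator_hom {k : b ⟶ b} (ψ : g ≫ f ⟶ k)
    (e : Bimod.X g ⊗ Bimod.X f ⟶ Bimod.X k) (he : proj g f ≫ hom ψ = e) :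
    m ▷ Bimod.X f ≫ (s ▷ Bimod.X f ≫ proj (f ≫ g) f) ≫
        hom ((Bicategory.associator f g f).hom ≫ f ◁ ψ) =
      (α_ (Bimod.X f) (Bimod.X g) (Bimod.X f)).hom ≫ Bimod.X f ◁ e ≫ proj f k := by
  have h := congrArg (· ≫ hom (f ◁ ψ)) (proj_associator_hom f g f)
  simp only [Category.assoc] at h
  rw [proj_whiskerLeft, ← MonoidalCategory.whiskerLeft_comp_assoc, he] at h
  rw [← h, ← hm, MonoidalCategory.comp_whiskerRight, hom_comp]
  simp only [Category.assoc]

theorem proj_whiskerLeft_associator_inv {k : b ⟶ b} (φ : k ⟶ g ≫ f)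
    (p : Bimod.X k ⟶ Bimod.X g ⊗ Bimod.X f) (hp : hom φ = p ≫ proj g f) :
    proj f k ≫ hom (f ◁ φ ≫ (Bicategory.associator f g f).inv) =
      Bimod.X f ◁ p ≫ (α_ (Bimod.X f) (Bimod.X g) (Bimod.X f)).inv ≫ m ▷ Bimod.X f ≫
        (s ▷ Bimod.X f ≫ proj (f ≫ g) f) := by
  rw [hom_comp, ← Category.assoc, proj_whiskerLeft, hp, MonoidalCategory.whiskerLeft_comp]
  simp only [Category.assoc]
  rw [proj_associator_inv, ← hm, MonoidalCategory.comp_whiskerRight]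
  simp only [Category.assoc]

theorem whiskerLeft_proj_associator_inv {k : b ⟶ b} (ψ : g ≫ f ⟶ k)
    (e : Bimod.X g ⊗ Bimod.X f ⟶ Bimod.X k) (he : proj g f ≫ hom ψ = e) :
    Bimod.X g ◁ m ≫ (Bimod.X g ◁ s ≫ proj g (f ≫ g)) ≫
        hom ((Bicategory.associator g f g).inv ≫ ψ ▷ g) =
      (α_ (Bimod.X g) (Bimod.X f) (Bimod.X g)).inv ≫ e ▷ Bimod.X g ≫ proj k g := by
  have h := congrArg (· ≫ hom (ψ ▷ g)) (proj_associator_inv g f g)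
  simp only [Category.assoc] at h
  rw [proj_whiskerRight, ← MonoidalCategory.comp_whiskerRight_assoc, he] at h
  rw [← h, ← hm, MonoidalCategory.whiskerLeft_comp, hom_comp]
  simp only [Category.assoc]

theorem proj_whiskerRight_associator_hom {k : b ⟶ b} (φ : k ⟶ g ≫ f)
    (p : Bimod.X k ⟶ Bimod.X g ⊗ Bimod.X f) (hp : hom φ = p ≫ proj g f) :
    proj k g ≫ hom (φ ▷ g ≫ (Bicategory.associator g f g).hom) =
      p ▷ Bimod.X g ≫ (α_ (Bimod.X g) (Bimod.X f) (Bimod.X g)).hom ≫ Bimod.X g ◁ m ≫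
        (Bimod.X g ◁ s ≫ proj g (f ≫ g)) := by
  rw [hom_comp, ← Category.assoc, proj_whiskerRight, hp, MonoidalCategory.comp_whiskerRight]
  simp only [Category.assoc]
  rw [proj_associator_hom, ← hm, MonoidalCategory.whiskerLeft_comp]
  simp only [Category.assoc]

end Cells

variable (Q : Mon C)

/-- The identification of `Q ⊗ Q` with the object underlying `(𝒳 × 𝒳̄) × 𝒳`. -/
noncomputable def toLeftTriple : Q.X ⊗ Q.X ⟶ Bimod.X ((ext Q ≫ extBar Q) ≫ ext Q) :=
  hom (multIso Q).inv ▷ Q.X ≫ proj (ext Q ≫ extBar Q) (ext Q)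

/-- The identification of `Q ⊗ Q` with the object underlying `𝒳̄ × (𝒳 × 𝒳̄)`. -/
noncomputable def toRightTriple : Q.X ⊗ Q.X ⟶ Bimod.X (extBar Q ≫ ext Q ≫ extBar Q) :=
  Q.X ◁ hom (multIso Q).inv ≫ proj (extBar Q) (ext Q ≫ extBar Q)

instance isIso_hom_multIso_inv : IsIso (hom (multIso Q).inv) :=
  ⟨hom (multIso Q).hom, hom_isoInv_hom _, hom_isoHom_inv _⟩

/-- Equations on the triple composites can thus be tested on `Q ⊗ Q`; invertibility of the
identification is not needed. -/
instance epi_toLeftTriple : Epi (toLeftTriple Q) :=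
  epi_comp' (inferInstanceAs (Epi ((tensorRight Q.X).map (hom (multIso Q).inv)))) (epi_proj _ _)

instance epi_toRightTriple : Epi (toRightTriple Q) :=
  epi_comp' (inferInstanceAs (Epi ((tensorLeft Q.X).map (hom (multIso Q).inv)))) (epi_proj _ _)

/-- Multiplication is split by `x ↦ 1 ⊗ x`. -/
instance epi_mul_whiskerRight : Epi (μ[Q.X] ▷ Q.X) :=
  epi_of_epi_fac (show ((λ_ Q.X).inv ≫ η[Q.X] ▷ Q.X) ▷ Q.X ≫ μ[Q.X] ▷ Q.X = 𝟙 (Q.X ⊗ Q.X) by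
    rw [← comp_whiskerRight]; simp)

instance epi_whiskerLeft_mul : Epi (Q.X ◁ μ[Q.X]) :=
  epi_of_epi_fac (show Q.X ◁ ((λ_ Q.X).inv ≫ η[Q.X] ▷ Q.X) ≫ Q.X ◁ μ[Q.X] = 𝟙 (Q.X ⊗ Q.X) by
    rw [← MonoidalCategory.whiskerLeft_comp]; simp)

/-- After precomposition with `μ ▷ Q`, the two sides send `(x ⊗ y) ⊗ z` to the classes of `x ⊗ y z`
and of `x y ⊗ z`, which agree in the tensor product over `𝒬`. -/
theorem toLeftTriple_mulCell :
    toLeftTriple Q ≫ hom ((Bicategory.associator (ext Q) (extBar Q) (ext Q)).hom ≫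
      ext Q ◁ mulCell Q) = proj (ext Q) (𝟙 (ofMon Q)) :=
  (cancel_epi (μ[Q.X] ▷ Q.X)).1
    ((whiskerRight_proj_associator_hom (mul_multIso_inv Q) (mulCell Q) _ (proj_mulCell Q)).trans
      (proj_condition (ext Q) (𝟙 (ofMon Q))).symm)

theorem toRightTriple_mulCell :
    toRightTriple Q ≫ hom ((Bicategory.associator (extBar Q) (ext Q) (extBar Q)).inv ≫
      mulCell Q ▷ extBar Q) = proj (𝟙 (ofMon Q)) (extBar Q) :=
  (cancel_epi (Q.X ◁ μ[Q.X])).1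
    ((whiskerLeft_proj_associator_inv (mul_multIso_inv Q) (mulCell Q) _ (proj_mulCell Q)).trans
      ((Iso.inv_comp_eq _).2 (proj_condition (𝟙 (ofMon Q)) (extBar Q))))

variable {Q} {δ : Q.X ⟶ Q.X ⊗ Q.X} {ν : Q.X ⟶ 𝟙_ C} (F : IsFrobenius Q δ ν)

/-- Directly, `x ⊗ q` goes to `δ(q)` with `x` multiplied into its first leg; by the Frobenius
relation this is `δ(x q)`. -/
theorem proj_comulCell_left :
    proj (ext Q) (𝟙 (ofMon Q)) ≫
      hom (ext Q ◁ comulCell F ≫ (Bicategory.associator (ext Q) (extBar Q) (ext Q)).inv) =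
    (μ[Q.X] ≫ δ) ≫ toLeftTriple Q := by
  refine (proj_whiskerLeft_associator_inv (mul_multIso_inv Q) (comulCell F) δ rfl).trans ?_
  rw [← F.left]
  simp only [Category.assoc]
  rfl

/-- The other Frobenius relation: `δ(q)` with `x` multiplied into its second leg is `δ(q x)`. -/
theorem proj_comulCell_right :
    proj (𝟙 (ofMon Q)) (extBar Q) ≫
      hom (comulCell F ▷ extBar Q ≫ (Bicategory.associator (extBar Q) (ext Q) (extBar Q)).hom) =
    (μ[Q.X] ≫ δ) ≫ toRightTriple Q := by
  refine (proj_whiskerRight_associator_hom (mul_multIso_inv Q) (comulCell F) δ rfl).trans ?_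
  rw [← F.right]
  simp only [Category.assoc]
  rfl

/-- The heart of the D2 condition: read on `Q ⊗ Q`, the endomorphism built from `ev_L` and `coev_R`
is `x ⊗ y ↦ δ(x y)`, and the coequalizers have disappeared. -/
theorem toLeftTriple_mul_comul :
    toLeftTriple Q ≫ hom ((Bicategory.associator (ext Q) (extBar Q) (ext Q)).hom ≫
      ext Q ◁ mulCell Q ≫ ext Q ◁ comulCell F ≫
        (Bicategory.associator (ext Q) (extBar Q) (ext Q)).inv) =
      (μ[Q.X] ≫ δ) ≫ toLeftTriple Q := by
  rw [← Category.assoc (Bicategory.associator _ _ _).hom, hom_comp, ← Category.assoc,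
    toLeftTriple_mulCell]
  exact proj_comulCell_left F

theorem toRightTriple_mul_comul :
    toRightTriple Q ≫ hom ((Bicategory.associator (extBar Q) (ext Q) (extBar Q)).inv ≫
      mulCell Q ▷ extBar Q ≫ comulCell F ▷ extBar Q ≫
        (Bicategory.associator (extBar Q) (ext Q) (extBar Q)).hom) =
      (μ[Q.X] ≫ δ) ≫ toRightTriple Q := by
  rw [← Category.assoc (Bicategory.associator _ _ _).inv, hom_comp, ← Category.assoc,
    toRightTriple_mulCell]
  exact proj_comulCell_right F

/-- The 2-endomorphism of `𝒳 × 𝒳̄` that corresponds to an endomorphism of `Q`. -/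
noncomputable def conj (x : Q.X ⟶ Q.X) : ext Q ≫ extBar Q ⟶ ext Q ≫ extBar Q :=
  (multIso Q).hom ≫ ofHom x ≫ (multIso Q).inv

theorem multIso_inv_conj (x : Q.X ⟶ Q.X) :
    hom (multIso Q).inv ≫ hom (conj x) = x ≫ hom (multIso Q).inv := by
  rw [← hom_comp, conj, Iso.inv_hom_id_assoc]
  rfl

theorem toLeftTriple_conj (x : Q.X ⟶ Q.X) :
    toLeftTriple Q ≫ hom (conj x ▷ ext Q) = x ▷ Q.X ≫ toLeftTriple Q := by
  refine (Category.assoc _ _ _).trans ((congrArg (hom (multIso Q).inv ▷ Q.X ≫ ·)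
    (proj_whiskerRight (conj x) (ext Q))).trans ((Category.assoc _ _ _).symm.trans ?_))
  refine Eq.trans (congrArg (· ≫ proj (ext Q ≫ extBar Q) (ext Q))
    ((comp_whiskerRight (hom (multIso Q).inv) (hom (conj x)) Q.X).symm.trans
      ((congrArg (· ▷ Q.X) (multIso_inv_conj x)).trans (comp_whiskerRight _ _ _)))) ?_
  exact Category.assoc _ _ _

theorem toRightTriple_conj (x : Q.X ⟶ Q.X) :
    toRightTriple Q ≫ hom (extBar Q ◁ conj x) = Q.X ◁ x ≫ toRightTriple Q := by
  refine (Category.assoc _ _ _).trans ((congrArg (Q.X ◁ hom (multIso Q).inv ≫ ·)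
    (proj_whiskerLeft (extBar Q) (conj x))).trans ((Category.assoc _ _ _).symm.trans ?_))
  refine Eq.trans (congrArg (· ≫ proj (extBar Q) (ext Q ≫ extBar Q))
    ((MonoidalCategory.whiskerLeft_comp Q.X (hom (multIso Q).inv) (hom (conj x))).symm.trans
      ((congrArg (Q.X ◁ ·) (multIso_inv_conj x)).trans
        (MonoidalCategory.whiskerLeft_comp _ _ _)))) ?_
  exact Category.assoc _ _ _

/-- A right `Q`-linear endomorphism of `Q` as a 2-endomorphism of `𝒳`. -/
def extEnd (x : Q.X ⟶ Q.X) (hx : μ[Q.X] ≫ x = x ▷ Q.X ≫ μ[Q.X]) : ext Q ⟶ ext Q :=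
  Bimod.Hom.mk (M := unitMonBimod Q) (N := unitMonBimod Q) x (leftUnitor_naturality x).symm hx

/-- On representatives both sides send `h ⊗ k` to `x(h) ⊗ k`, since `x(h k) = x(h) k`. So these
elements of `A` come from `E` and may be moved across `⊗_E`. -/
theorem conj_eq_whiskerRight (x : Q.X ⟶ Q.X) (hx : μ[Q.X] ≫ x = x ▷ Q.X ≫ μ[Q.X]) :
    conj x = extEnd x hx ▷ extBar Q := by
  apply hom_inj
  refine (cancel_epi (proj (ext Q) (extBar Q))).1 ?_
  rw [proj_whiskerRight, ← mul_multIso_inv]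
  refine (Category.assoc _ _ _).trans ((congrArg (μ[Q.X] ≫ ·) (multIso_inv_conj x)).trans ?_)
  refine (Category.assoc _ _ _).symm.trans ((congrArg (· ≫ hom (multIso Q).inv) hx).trans ?_)
  exact Category.assoc _ _ _

theorem conj_comp (x y : Q.X ⟶ Q.X) : conj (x ≫ y) = conj x ≫ conj y := by
  have h : ofHom (x ≫ y) = ofHom x ≫ ofHom y := rfl
  simp only [conj, h, Category.assoc, Iso.inv_hom_id_assoc]

end BIM

end DepthTwoCells

/-! ### Finite direct sums of bimodules, and direct summands -/

section Summands

open CategoryTheory.Limits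

/-- An object is a summand of copies of `Y` as soon as its identity factors through `Y` in a
finite sum. -/
theorem isSummandOfCopies_of_sum {D : Type*} [Category D] [Preadditive D] {X Y : D} {n : ℕ}
    (S : Bicone (fun _ : Fin n => Y)) (hS : S.IsBilimit) (f : Fin n → (X ⟶ Y)) (g : Fin n → (Y ⟶ X))
    (h : ∑ j, f j ≫ g j = 𝟙 X) : IsSummandOfCopies X Y := by
  classical
  refine ⟨n, S, ⟨hS⟩, ⟨{ i := ∑ j, f j ≫ S.ι j, r := ∑ j, S.π j ≫ g j, retract := ?_ }⟩⟩
  rw [Preadditive.sum_comp, ← h]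
  refine Finset.sum_congr rfl (fun j _ => ?_)
  rw [Preadditive.comp_sum, Finset.sum_eq_single j]
  · simp
  · intro k _ hk
    rw [Category.assoc, ← Category.assoc (S.ι j), S.ι_π, dif_neg hk.symm, zero_comp, comp_zero]
  · simp

namespace Bimod

variable {C : Type u} [Category.{v} C] [MonoidalCategory C] [Preadditive C] [MonoidalPreadditive C]
  [HasFiniteBiproducts C] {A B : Mon C} (P : Bimod A B) (n : ℕ)

/-- The direct sum of `n` copies of a bimodule. -/
noncomputable def copies : Bimod A B where
  X := ⨁ fun _ : Fin n => P.X
  actLeft := biproduct.lift fun j => A.X ◁ biproduct.π _ j ≫ P.actLeft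
  actRight := biproduct.lift fun j => biproduct.π _ j ▷ B.X ≫ P.actRight
  one_actLeft := by
    refine biproduct.hom_ext _ _ (fun j => ?_)
    rw [Category.assoc, biproduct.lift_π, ← whisker_exchange_assoc, P.one_actLeft,
      leftUnitor_naturality]
  left_assoc := by
    refine biproduct.hom_ext _ _ (fun j => ?_)
    simp only [Category.assoc, biproduct.lift_π]
    rw [← whisker_exchange_assoc, P.left_assoc, ← MonoidalCategory.whiskerLeft_comp_assoc,
      biproduct.lift_π]
    simp
  actRight_one := by
    refine biproduct.hom_ext _ _ (fun j => ?_)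
    rw [Category.assoc, biproduct.lift_π, whisker_exchange_assoc, P.actRight_one,
      rightUnitor_naturality]
  right_assoc := by
    refine biproduct.hom_ext _ _ (fun j => ?_)
    simp only [Category.assoc, biproduct.lift_π]
    rw [whisker_exchange_assoc, P.right_assoc, ← comp_whiskerRight_assoc, biproduct.lift_π]
    simp
  middle_assoc := by
    refine biproduct.hom_ext _ _ (fun j => ?_)
    simp only [Category.assoc, biproduct.lift_π]
    rw [← comp_whiskerRight_assoc, biproduct.lift_π, ← MonoidalCategory.whiskerLeft_comp_assoc,
      biproduct.lift_π]
    simp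

/-- The projections and inclusions of a direct sum of copies. -/
noncomputable def copiesBicone : Bicone (fun _ : Fin n => P) where
  pt := P.copies n
  π j := Hom.mk (M := P.copies n) (N := P) (biproduct.π (fun _ : Fin n => P.X) j)
    (biproduct.lift_π _ _) (biproduct.lift_π _ _)
  ι j := Hom.mk (M := P) (N := P.copies n) (biproduct.ι (fun _ : Fin n => P.X) j)
    (by
      apply biproduct.hom_ext
      intro k
      simp only [copies, Category.assoc, biproduct.lift_π, ← MonoidalCategory.whiskerLeft_comp_assoc]
      by_cases h : j = k
      · subst h; simp
      · simp [biproduct.ι_π_ne _ h])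
    (by
      apply biproduct.hom_ext
      intro k
      simp only [copies, Category.assoc, biproduct.lift_π, ← comp_whiskerRight_assoc]
      by_cases h : j = k
      · subst h; simp
      · simp [biproduct.ι_π_ne _ h])
  ι_π j k := by
    apply hom_ext
    change biproduct.ι (fun _ : Fin n => P.X) j ≫ biproduct.π (fun _ : Fin n => P.X) k = _
    by_cases h : j = k
    · subst h
      rw [biproduct.ι_π_self, dif_pos rfl]
      rfl
    · rw [biproduct.ι_π_ne _ h, dif_neg h]
      rfl

omit [HasFiniteBiproducts C] in
theorem hom_sum {X Y : Bimod A B} {J : Type*} (s : Finset J)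
    (φ : J → (X ⟶ Y)) : (∑ j ∈ s, φ j).hom = ∑ j ∈ s, (φ j).hom :=
  map_sum (AddMonoidHom.mk' (fun φ : X ⟶ Y => φ.hom) (fun _ _ => rfl)) φ s

/-- The direct sum of copies is a biproduct. -/
noncomputable def copiesIsBilimit : (P.copiesBicone n).IsBilimit :=
  isBilimitOfTotal _ (by
    apply hom_ext
    rw [hom_sum]
    exact biproduct.total (f := fun _ : Fin n => P.X))

end Bimod

end Summands

/-! ### From sum identities on `Q ⊗ Q` to D2 conditions and quasi-bases -/

section QuasiBasis

open CategoryTheory.Limits MonObj BalTensor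

open scoped Bicategory

namespace BIM

variable {C : Type u} [Category.{v} C] [MonoidalCategory C] [HasCoequalizers C]
  [∀ X : C, PreservesColimitsOfSize.{0, 0} (tensorLeft X)]
  [∀ X : C, PreservesColimitsOfSize.{0, 0} (tensorRight X)]
  [Preadditive C] [MonoidalPreadditive C]

theorem hom_add {a b : BIM C} {f g : a ⟶ b} (φ ψ : f ⟶ g) : hom (φ + ψ) = hom φ + hom ψ := rfl

/-- Additivity of the ambient tensor product passes to the coequalizer. It makes the quasi-basis
expression biadditive in its two families. -/
theorem add_whiskerRight {a b c : BIM C} {f f' : a ⟶ b} (φ ψ : f ⟶ f') (g : b ⟶ c) :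
    (φ + ψ) ▷ g = φ ▷ g + ψ ▷ g := by
  apply hom_inj
  refine (cancel_epi (proj f g)).1 ?_
  rw [hom_add, Preadditive.comp_add, proj_whiskerRight, proj_whiskerRight, proj_whiskerRight,
    hom_add, MonoidalPreadditive.add_whiskerRight, Preadditive.add_comp]

theorem isSummandOfCopies_of_sum [HasFiniteBiproducts C] {a b : BIM C} {f g : a ⟶ b} {n : ℕ}
    (x : Fin n → (f ⟶ g)) (y : Fin n → (g ⟶ f)) (h : ∑ j, x j ≫ y j = 𝟙 f) :
    IsSummandOfCopies f g :=
  _root_.isSummandOfCopies_of_sum (Bimod.copiesBicone (A := a.mon) (B := b.mon) g n)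
    (Bimod.copiesIsBilimit g n) x y h

/-- The quasi-basis property can be checked on one representation. -/
theorem isD2QuasiBasis_of_rep {a b : BIM C} {f : a ⟶ b} {g : b ⟶ a} (evL : g ≫ f ⟶ 𝟙 b)
    (coevR : 𝟙 b ⟶ g ≫ f) {m : ℕ} (y x : Fin m → (f ≫ g ⟶ f ≫ g))
    (h : ∑ j, (x j ▷ f) ≫ (α_ f g f).hom ≫ (f ◁ evL) ≫ (f ◁ coevR) ≫ (α_ f g f).inv ≫ (y j ▷ f) =
      𝟙 ((f ≫ g) ≫ f)) :
    IsD2QuasiBasis evL coevR (∑ j, tmul _ _ (y j) (x j) : EndTensor f g) := by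
  -- The part of the quasi-basis expression that does not depend on `x` and `y`.
  let c : (f ≫ g) ≫ f ⟶ (f ≫ g) ≫ f :=
    (α_ f g f).hom ≫ (f ◁ evL) ≫ (f ◁ coevR) ≫ (α_ f g f).inv
  -- Naturality of the associator and interchange make `c` commute with the image of `E`. Hence `x ▷
  -- f ≫ c ≫ y ▷ f` is balanced over `E` and depends only on the class in `A ⊗_E A`.
  have hc : ∀ l : f ⟶ f, c ≫ (l ▷ g) ▷ f = (l ▷ g) ▷ f ≫ c := by
    intro l
    simp only [c, Category.assoc]
    rw [Bicategory.associator_naturality_left_assoc, ← Bicategory.whisker_exchange_assoc,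
      ← Bicategory.whisker_exchange_assoc, Bicategory.associator_inv_naturality_left]
  let B : (f ≫ g ⟶ f ≫ g) →+ (f ≫ g ⟶ f ≫ g) →+ ((f ≫ g) ≫ f ⟶ (f ≫ g) ≫ f) :=
    AddMonoidHom.mk' (fun y => AddMonoidHom.mk' (fun x => x ▷ f ≫ c ≫ y ▷ f) (fun x x' => by
        rw [add_whiskerRight, Preadditive.add_comp]))
      (fun y y' => by
        ext x
        simp only [AddMonoidHom.mk'_apply, AddMonoidHom.add_apply]
        rw [add_whiskerRight, Preadditive.comp_add, Preadditive.comp_add])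
  let Φ : EndTensor f g →+ ((f ≫ g) ≫ f ⟶ (f ≫ g) ≫ f) := lift B (fun l y x => by
    change x ▷ f ≫ c ≫ (l ▷ g ≫ y) ▷ f = (x ≫ l ▷ g) ▷ f ≫ c ≫ y ▷ f
    rw [Bicategory.comp_whiskerRight, Bicategory.comp_whiskerRight, ← Category.assoc c ((l ▷ g) ▷ f),
      hc]
    simp only [Category.assoc])
  have hΦ : ∀ {n : ℕ} (y x : Fin n → (f ≫ g ⟶ f ≫ g)),
      Φ (∑ j, tmul _ _ (y j) (x j)) = ∑ j, (x j ▷ f) ≫ (α_ f g f).hom ≫ (f ◁ evL) ≫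
        (f ◁ coevR) ≫ (α_ f g f).inv ≫ (y j ▷ f) := by
    intro n y x
    rw [map_sum]
    refine Finset.sum_congr rfl (fun j _ => ?_)
    change x j ▷ f ≫ c ≫ y j ▷ f = _
    simp only [c, Category.assoc]
  intro n y' x' hq
  rw [← hΦ, ← hq, hΦ, h]

variable {Q : Mon C} {δ : Q.X ⟶ Q.X ⊗ Q.X} {ν : Q.X ⟶ 𝟙_ C} (F : IsFrobenius Q δ ν) {n : ℕ}
  (x y : Fin n → (Q.X ⟶ Q.X))

/-- The hypothesis is the quasi-basis identity read on `Q ⊗ Q`; `toLeftTriple_conj` and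
`toLeftTriple_mul_comul` carry each term across the epimorphism `toLeftTriple`. -/
theorem sum_conj_left (h : ∑ j, x j ▷ Q.X ≫ μ[Q.X] ≫ δ ≫ y j ▷ Q.X = 𝟙 (Q.X ⊗ Q.X)) :
    ∑ j, (conj (x j) ▷ ext Q) ≫ (Bicategory.associator (ext Q) (extBar Q) (ext Q)).hom ≫
      (ext Q ◁ (adjL Q).counit) ≫ (ext Q ◁ (adjR F).unit) ≫
        (Bicategory.associator (ext Q) (extBar Q) (ext Q)).inv ≫ (conj (y j) ▷ ext Q) =
      𝟙 ((ext Q ≫ extBar Q) ≫ ext Q) := by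
  apply hom_inj
  refine (cancel_epi (toLeftTriple Q)).1 ?_
  rw [hom_sum, Preadditive.comp_sum, hom_id, Category.comp_id]
  refine Eq.trans ?_ ((congrArg (· ≫ toLeftTriple Q) h).trans (Category.id_comp _))
  rw [Preadditive.sum_comp]
  refine Finset.sum_congr rfl (fun j _ => ?_)
  have h₃ : toLeftTriple Q ≫ hom (conj (x j) ▷ ext Q ≫
      ((Bicategory.associator (ext Q) (extBar Q) (ext Q)).hom ≫ ext Q ◁ mulCell Q) ≫
      (ext Q ◁ comulCell F ≫ (Bicategory.associator (ext Q) (extBar Q) (ext Q)).inv) ≫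
      conj (y j) ▷ ext Q) = (x j ▷ Q.X ≫ μ[Q.X] ≫ δ ≫ y j ▷ Q.X) ≫ toLeftTriple Q := by
    rw [← Category.assoc (_ ≫ _) (_ ≫ _), hom_comp, hom_comp _ (Bicategory.whiskerRight _ _), ← Category.assoc, toLeftTriple_conj]
    simp only [Category.assoc]
    rw [← Category.assoc (toLeftTriple Q), toLeftTriple_mul_comul F]
    simp only [Category.assoc]
    rw [toLeftTriple_conj]
  rw [← h₃]
  simp only [Category.assoc]
  rfl

/-- The mirror image, on the bracketing `𝒳̄ × (𝒳 × 𝒳̄)`, where endomorphisms of `𝒳 × 𝒳̄` act on the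
right-hand factor. -/
theorem sum_conj_right (h : ∑ j, Q.X ◁ x j ≫ μ[Q.X] ≫ δ ≫ Q.X ◁ y j = 𝟙 (Q.X ⊗ Q.X)) :
    ∑ j, (extBar Q ◁ conj (x j)) ≫ (Bicategory.associator (extBar Q) (ext Q) (extBar Q)).inv ≫
      ((adjL Q).counit ▷ extBar Q) ≫ ((adjR F).unit ▷ extBar Q) ≫
        (Bicategory.associator (extBar Q) (ext Q) (extBar Q)).hom ≫ (extBar Q ◁ conj (y j)) =
      𝟙 (extBar Q ≫ ext Q ≫ extBar Q) := by
  apply hom_inj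
  refine (cancel_epi (toRightTriple Q)).1 ?_
  rw [hom_sum, Preadditive.comp_sum, hom_id, Category.comp_id]
  refine Eq.trans ?_ ((congrArg (· ≫ toRightTriple Q) h).trans (Category.id_comp _))
  rw [Preadditive.sum_comp]
  refine Finset.sum_congr rfl (fun j _ => ?_)
  have h₃ : toRightTriple Q ≫ hom (extBar Q ◁ conj (x j) ≫
      ((Bicategory.associator (extBar Q) (ext Q) (extBar Q)).inv ≫ mulCell Q ▷ extBar Q) ≫
      (comulCell F ▷ extBar Q ≫ (Bicategory.associator (extBar Q) (ext Q) (extBar Q)).hom) ≫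
      extBar Q ◁ conj (y j)) = (Q.X ◁ x j ≫ μ[Q.X] ≫ δ ≫ Q.X ◁ y j) ≫ toRightTriple Q := by
    rw [← Category.assoc (_ ≫ _) (_ ≫ _), hom_comp, hom_comp _ (Bicategory.whiskerLeft _ _), ← Category.assoc, toRightTriple_conj]
    simp only [Category.assoc]
    rw [← Category.assoc (toRightTriple Q), toRightTriple_mul_comul F]
    simp only [Category.assoc]
    rw [toRightTriple_conj]
  rw [← h₃]
  simp only [Category.assoc]
  rfl

include F in
-- Each term of `sum_conj_left` passes through `𝒳 × 𝟙`; inserting the right unitor and its inverse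
-- there factors the identity through copies of `𝒳`.
theorem isLeftD2_of_sum [HasFiniteBiproducts C]
    (h : ∑ j, x j ▷ Q.X ≫ μ[Q.X] ≫ δ ≫ y j ▷ Q.X = 𝟙 (Q.X ⊗ Q.X)) :
    IsLeftD2 (ext Q) (extBar Q) := by
  refine isSummandOfCopies_of_sum
    (fun j => (conj (x j) ▷ ext Q) ≫ (Bicategory.associator (ext Q) (extBar Q) (ext Q)).hom ≫
      (ext Q ◁ (adjL Q).counit) ≫ (Bicategory.rightUnitor (ext Q)).hom)
    (fun j => (Bicategory.rightUnitor (ext Q)).inv ≫ (ext Q ◁ (adjR F).unit) ≫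
        (Bicategory.associator (ext Q) (extBar Q) (ext Q)).inv ≫ (conj (y j) ▷ ext Q)) ?_
  simp only [Category.assoc, Iso.hom_inv_id_assoc]
  exact sum_conj_left F x y h

include F in
theorem isRightD2_of_sum [HasFiniteBiproducts C]
    (h : ∑ j, Q.X ◁ x j ≫ μ[Q.X] ≫ δ ≫ Q.X ◁ y j = 𝟙 (Q.X ⊗ Q.X)) :
    IsRightD2 (ext Q) (extBar Q) := by
  refine isSummandOfCopies_of_sum
    (fun j => (Bicategory.associator (extBar Q) (ext Q) (extBar Q)).hom ≫
      (extBar Q ◁ conj (x j)) ≫ (Bicategory.associator (extBar Q) (ext Q) (extBar Q)).inv ≫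
      ((adjL Q).counit ▷ extBar Q) ≫ (Bicategory.leftUnitor (extBar Q)).hom)
    (fun j => (Bicategory.leftUnitor (extBar Q)).inv ≫ ((adjR F).unit ▷ extBar Q) ≫
        (Bicategory.associator (extBar Q) (ext Q) (extBar Q)).hom ≫ (extBar Q ◁ conj (y j)) ≫
          (Bicategory.associator (extBar Q) (ext Q) (extBar Q)).inv) ?_
  -- `IsRightD2` brackets the triple to the left and `sum_conj_right` to the right, so the identity
  -- is conjugated by the associator.
  have h' := congrArg (fun z => (Bicategory.associator (extBar Q) (ext Q) (extBar Q)).hom ≫ z ≫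
    (Bicategory.associator (extBar Q) (ext Q) (extBar Q)).inv) (sum_conj_right F x y h)
  simp only [Preadditive.comp_sum, Preadditive.sum_comp, Category.assoc, Category.id_comp,
    Iso.hom_inv_id] at h'
  simp only [Category.assoc, Iso.hom_inv_id_assoc]
  exact h'

end BIM

end QuasiBasis

/-! ### Evaluating balanced maps on coproducts -/

section Multiadditive

variable {R : Type*} {R' : Type*} {M : Type*} {N : Type*} {P : Type*} {T : Type*}
  [AddCommGroup M] [AddCommGroup N] [AddCommGroup P] [AddCommGroup T]

/-- A function additive in both variables as a biadditive map. -/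
def biadditive (f : M → N → P) (h₁ : ∀ m m' n, f (m + m') n = f m n + f m' n)
    (h₂ : ∀ m n n', f m (n + n') = f m n + f m n') : M →+ N →+ P :=
  AddMonoidHom.mk' (fun m => AddMonoidHom.mk' (f m) (h₂ m)) (fun m m' => by ext n; exact h₁ m m' n)

/-- A function additive in three variables as a triadditive map. -/
def triadditive (f : M → N → P → T) (h₁ : ∀ m m' n p, f (m + m') n p = f m n p + f m' n p)
    (h₂ : ∀ m n n' p, f m (n + n') p = f m n p + f m n' p)
    (h₃ : ∀ m n p p', f m n (p + p') = f m n p + f m n p') : M →+ N →+ P →+ T :=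
  AddMonoidHom.mk' (fun m => biadditive (f m) (h₂ m) (h₃ m))
    (fun m m' => by ext n p; exact h₁ m m' n p)

/-- With its companion for the other bracketing, this is how Sweedler computations run below: a
coassociativity law is an equation in a threefold tensor product, and a balanced triadditive map
turns its two sides into sums. -/
theorem BalTensor₃.lift_assocL_sum {ρ₁ : R → M →+ M} {l₂ : R → N →+ N} {ρ₂ : R' → N →+ N}
    {l₃ : R' → P →+ P} (f : M →+ N →+ P →+ T) (h₁ : ∀ r m n p, f (ρ₁ r m) n p = f m (l₂ r n) p)
    (h₂ : ∀ r m n p, f m (ρ₂ r n) p = f m n (l₃ r p)) {k : ℕ} {q : BalTensor ρ₁ l₂} {x : Fin k → M}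
    {y : Fin k → N} (hq : q = ∑ j, BalTensor.tmul ρ₁ l₂ (x j) (y j)) (p : P) :
    lift f h₁ h₂ (assocL ρ₁ l₂ ρ₂ l₃ q p) = ∑ j, f (x j) (y j) p := by
  rw [hq, map_sum, AddMonoidHom.finsetSum_apply, map_sum]
  rfl

theorem BalTensor₃.lift_assocR_sum {ρ₁ : R → M →+ M} {l₂ : R → N →+ N} {ρ₂ : R' → N →+ N}
    {l₃ : R' → P →+ P} (f : M →+ N →+ P →+ T) (h₁ : ∀ r m n p, f (ρ₁ r m) n p = f m (l₂ r n) p)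
    (h₂ : ∀ r m n p, f m (ρ₂ r n) p = f m n (l₃ r p)) {k : ℕ} {q : BalTensor ρ₂ l₃} {x : Fin k → N}
    {y : Fin k → P} (hq : q = ∑ j, BalTensor.tmul ρ₂ l₃ (x j) (y j)) (m : M) :
    lift f h₁ h₂ (assocR ρ₁ l₂ ρ₂ l₃ m q) = ∑ j, f m (x j) (y j) := by
  rw [hq, map_sum, map_sum]
  rfl

end Multiadditive

/-! ### The actions of the dual rings of a left bialgebroid -/

namespace LeftBialgebroid

open BalTensor

variable {A L : Type*} [Ring A] [Ring L] (B : LeftBialgebroid A L)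

/-- The codomain `A_L ⊗ _LA` of the coproduct. -/
abbrev Sq : Type _ := BalTensor (fun l => AddMonoidHom.mulLeft (B.t (op l)))
  (fun l => AddMonoidHom.mulLeft (B.s l))

/-- `x ⊗ y ↦ x b ⊗ y c`. -/
def mulRight₂ (b c : A) : B.Sq →+ B.Sq :=
  lift (biadditive (fun x y => tmul _ _ (x * b) (y * c))
      (fun x x' y => by rw [add_mul, add_tmul]) (fun x y y' => by rw [add_mul, tmul_add]))
    (fun l x y => by
      change tmul _ _ (B.t (op l) * x * b) (y * c) = tmul _ _ (x * b) (B.s l * y * c)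
      rw [mul_assoc, mul_assoc]
      exact smul_tmul l (x * b) (y * c))

@[simp] theorem mulRight₂_tmul (b c x y : A) :
    B.mulRight₂ b c (tmul _ _ x y) = tmul _ _ (x * b) (y * c) := rfl

/-- `(b, c) ↦ (x ⊗ y ↦ x b ⊗ y c)` as a biadditive map. -/
def mulRight₂Hom : A →+ A →+ B.Sq →+ B.Sq :=
  biadditive B.mulRight₂
    (fun b b' c => hom_ext (fun x y => by
      rw [AddMonoidHom.add_apply]; simp only [mulRight₂_tmul]; rw [mul_add, add_tmul]))
    (fun b c c' => hom_ext (fun x y => by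
      rw [AddMonoidHom.add_apply]; simp only [mulRight₂_tmul]; rw [mul_add, tmul_add]))

theorem mulRight₂Hom_apply (b c : A) (q : B.Sq) : B.mulRight₂Hom b c q = B.mulRight₂ b c q := rfl

theorem mulRight₂_mulRight₂ (b c b' c' : A) (q : B.Sq) :
    B.mulRight₂ b c (B.mulRight₂ b' c' q) = B.mulRight₂ (b' * b) (c' * c) q :=
  DFunLike.congr_fun (hom_ext (f := (B.mulRight₂ b c).comp (B.mulRight₂ b' c')) (fun x y => by
    rw [AddMonoidHom.comp_apply]; simp only [mulRight₂_tmul, mul_assoc])) q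

/-- Only the right factor is expanded: `γ(ab)` appears as right multiplications applied to the
element `γ(a)`, with no representation of `γ(a)` chosen. -/
theorem γ_mul_eq (a b : A) {m : ℕ} {z w : Fin m → A} (h : B.γ b = ∑ k, tmul _ _ (z k) (w k)) :
    B.γ (a * b) = ∑ k, B.mulRight₂ (z k) (w k) (B.γ a) := by
  obtain ⟨n, x, y, h'⟩ := exists_rep (B.γ a)
  rw [B.γ_mul a b n m x y z w h' h, Finset.sum_comm]
  refine Finset.sum_congr rfl (fun k _ => ?_)
  rw [h', map_sum]
  rfl

theorem mulRight₂_t (l : L) (a : A) :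
    B.mulRight₂ (B.t (op l)) 1 (B.γ a) = B.mulRight₂ 1 (B.s l) (B.γ a) := by
  obtain ⟨n, x, y, h⟩ := exists_rep (B.γ a)
  have h' := B.γ_takeuchi l a n x y h
  rw [h, map_sum, map_sum]
  simpa using h'

theorem γ_t (l : L) : B.γ (B.t (op l)) = tmul _ _ 1 (B.t (op l)) := by
  have h := B.γ_bimod 1 l 1 1 (fun _ => 1) (fun _ => 1) (by simpa using B.γ_one)
  simpa using h

theorem γ_mul_t (a : A) (l : L) : B.γ (a * B.t (op l)) = B.mulRight₂ 1 (B.t (op l)) (B.γ a) := by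
  rw [B.γ_mul_eq a (B.t (op l)) (z := fun _ : Fin 1 => 1) (w := fun _ => B.t (op l))
    (by simpa using B.γ_t l)]
  simp

theorem γ_s_mul (l : L) (a : A) {n : ℕ} {x y : Fin n → A} (h : B.γ a = ∑ j, tmul _ _ (x j) (y j)) :
    B.γ (B.s l * a) = ∑ j, tmul _ _ (B.s l * x j) (y j) := by
  simpa using B.γ_bimod l 1 a n x y h

theorem γ_t_mul (l : L) (a : A) {n : ℕ} {x y : Fin n → A} (h : B.γ a = ∑ j, tmul _ _ (x j) (y j)) :
    B.γ (B.t (op l) * a) = ∑ j, tmul _ _ (x j) (B.t (op l) * y j) := by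
  simpa using B.γ_bimod 1 l a n x y h

/-- `x ⊗ y ↦ t(φ(y)) x`. -/
def actStarL (φ : B.StarL) : B.Sq →+ A :=
  lift (biadditive (fun x y => B.t (op (φ.1 y)) * x) (fun x x' y => mul_add _ _ _)
      (fun x y y' => by rw [map_add, MulOpposite.op_add, map_add, add_mul]))
    (fun l x y => by
      change B.t (op (φ.1 y)) * (B.t (op l) * x) = B.t (op (φ.1 (B.s l * y))) * x
      rw [φ.2, MulOpposite.op_mul, map_mul, mul_assoc])

/-- `x ⊗ y ↦ s(φ(x)) y`. -/
def actLStar (φ : B.LStar) : B.Sq →+ A :=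
  lift (biadditive (fun x y => B.s (φ.1 x) * y)
      (fun x x' y => by rw [map_add, map_add, add_mul]) (fun x y y' => mul_add _ _ _))
    (fun l x y => by
      change B.s (φ.1 (B.t (op l) * x)) * y = B.s (φ.1 x) * (B.s l * y)
      rw [φ.2, map_mul, mul_assoc])

theorem hitStarL_eq (φ : B.StarL) (a : A) : B.hitStarL φ a = B.actStarL φ (B.γ a) := rfl

theorem hitLStar_eq (φ : B.LStar) (a : A) : B.hitLStar φ a = B.actLStar φ (B.γ a) := rfl

theorem hitStarL_sum (φ : B.StarL) {n : ℕ} (x : Fin n → A) :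
    B.hitStarL φ (∑ j, x j) = ∑ j, B.hitStarL φ (x j) := by
  simp only [hitStarL_eq, map_sum]

theorem hitLStar_sum (φ : B.LStar) {n : ℕ} (x : Fin n → A) :
    B.hitLStar φ (∑ j, x j) = ∑ j, B.hitLStar φ (x j) := by
  simp only [hitLStar_eq, map_sum]

theorem actStarL_mulRight₂_left (φ : B.StarL) (b : A) (q : B.Sq) :
    B.actStarL φ (B.mulRight₂ b 1 q) = B.actStarL φ q * b := by
  obtain ⟨n, x, y, rfl⟩ := exists_rep q
  simp only [map_sum, Finset.sum_mul]
  refine Finset.sum_congr rfl (fun j _ => ?_)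
  change B.t (op (φ.1 (y j * 1))) * (x j * b) = B.t (op (φ.1 (y j))) * x j * b
  rw [mul_one, mul_assoc]

theorem actLStar_mulRight₂_right (φ : B.LStar) (c : A) (q : B.Sq) :
    B.actLStar φ (B.mulRight₂ 1 c q) = B.actLStar φ q * c := by
  obtain ⟨n, x, y, rfl⟩ := exists_rep q
  simp only [map_sum, Finset.sum_mul]
  refine Finset.sum_congr rfl (fun j _ => ?_)
  change B.s (φ.1 (x j * 1)) * (y j * c) = B.s (φ.1 (x j)) * y j * c
  rw [mul_one, mul_assoc]

/-- `φ(· c)` for `φ ∈ _*𝒜`. -/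
def shiftStarL (φ : B.StarL) (c : A) : B.StarL :=
  ⟨φ.1.comp (AddMonoidHom.mulRight c), fun l a => by
    change φ.1 (B.s l * a * c) = l * φ.1 (a * c)
    rw [mul_assoc, φ.2]⟩

theorem hitStarL_shiftStarL (φ : B.StarL) (c a : A) :
    B.hitStarL (B.shiftStarL φ c) a = B.actStarL φ (B.mulRight₂ 1 c (B.γ a)) := by
  obtain ⟨n, x, y, h⟩ := exists_rep (B.γ a)
  rw [B.hitStarL_of_rep _ a x y h, h, map_sum, map_sum]
  refine Finset.sum_congr rfl (fun j _ => ?_)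
  change B.t (op (φ.1 (y j * c))) * x j = B.t (op (φ.1 (y j * c))) * (x j * 1)
  rw [mul_one]

/-- The counit as an element of the dual ring `_*𝒜`. -/
def counitStarL : B.StarL := ⟨B.π, fun l a => by simpa using B.π_bimod l 1 a⟩

/-- A counit law of `γ`. For an integral it says that `_Li` sends the counit to `i`. -/
theorem hitStarL_counitStarL (a : A) : B.hitStarL B.counitStarL a = a := by
  obtain ⟨n, x, y, h⟩ := exists_rep (B.γ a)
  rw [B.hitStarL_of_rep _ a x y h]
  exact B.counit_right a n x y h

/-- Left multiplication by `s(l)` changes only the first leg of the coproduct, and the ranges of `s`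
and `t` commute. -/
theorem hitStarL_s_mul (φ : B.StarL) (l : L) (a : A) :
    B.hitStarL φ (B.s l * a) = B.s l * B.hitStarL φ a := by
  obtain ⟨n, x, y, h⟩ := exists_rep (B.γ a)
  rw [B.hitStarL_of_rep φ a x y h, B.hitStarL_of_rep φ _ _ _ (B.γ_s_mul l a h), Finset.mul_sum]
  refine Finset.sum_congr rfl (fun j _ => ?_)
  rw [← mul_assoc, ← B.s_t_comm, mul_assoc]

theorem hitLStar_t_mul (ψ : B.LStar) (l : L) (a : A) :
    B.hitLStar ψ (B.t (op l) * a) = B.t (op l) * B.hitLStar ψ a := by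
  obtain ⟨n, x, y, h⟩ := exists_rep (B.γ a)
  rw [B.hitLStar_of_rep ψ a x y h, B.hitLStar_of_rep ψ _ _ _ (B.γ_t_mul l a h), Finset.mul_sum]
  refine Finset.sum_congr rfl (fun j _ => ?_)
  rw [← mul_assoc, B.s_t_comm, mul_assoc]

/-- `↼` is a right action of `_*𝒜`. -/
theorem hitStarL_mulStarL (φ ψ : B.StarL) (a : A) :
    B.hitStarL (B.mulStarL φ ψ) a = B.hitStarL ψ (B.hitStarL φ a) := by
  obtain ⟨n, x, y, h⟩ := exists_rep (B.γ a)
  have hc := B.coassoc a n x y h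
  -- Both sides of the claim are the value of this map on the threefold coproduct of `a`, bracketed
  -- in the two ways.
  let f : A →+ A →+ A →+ A := triadditive (fun u v w => B.t (op (ψ.1 (B.t (op (φ.1 w)) * v))) * u)
    (fun u u' v w => mul_add _ _ _)
    (fun u v v' w => by rw [mul_add, map_add, MulOpposite.op_add, map_add, add_mul])
    (fun u v w w' => by
      rw [map_add, MulOpposite.op_add, map_add, add_mul, map_add, MulOpposite.op_add, map_add,
        add_mul])
  have hf₁ : ∀ (l : L) (u v w : A), f (B.t (op l) * u) v w = f u (B.s l * v) w := by
    intro l u v w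
    change B.t (op (ψ.1 (B.t (op (φ.1 w)) * v))) * (B.t (op l) * u) =
      B.t (op (ψ.1 (B.t (op (φ.1 w)) * (B.s l * v)))) * u
    rw [← mul_assoc _ (B.s l), ← B.s_t_comm, mul_assoc (B.s l), ψ.2, MulOpposite.op_mul,
      map_mul B.t, mul_assoc]
  have hf₂ : ∀ (l : L) (u v w : A), f u (B.t (op l) * v) w = f u v (B.s l * w) := by
    intro l u v w
    change B.t (op (ψ.1 (B.t (op (φ.1 w)) * (B.t (op l) * v)))) * u =
      B.t (op (ψ.1 (B.t (op (φ.1 (B.s l * w))) * v))) * u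
    rw [φ.2, MulOpposite.op_mul, map_mul B.t, mul_assoc]
  have hc' := congrArg (BalTensor₃.lift f hf₁ hf₂) hc
  rw [map_sum, map_sum] at hc'
  rw [B.hitStarL_of_rep _ a x y h, B.hitStarL_of_rep φ a x y h, hitStarL_sum]
  refine Eq.trans (Finset.sum_congr rfl fun j _ => ?_)
    (hc'.symm.trans (Finset.sum_congr rfl fun j _ => ?_))
  · obtain ⟨m, u, v, h'⟩ := exists_rep (B.γ (y j))
    rw [BalTensor₃.lift_assocR_sum f hf₁ hf₂ h']
    change B.t (op (ψ.1 (B.hitStarL φ (y j)))) * x j =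
      ∑ k, B.t (op (ψ.1 (B.t (op (φ.1 (v k))) * u k))) * x j
    rw [B.hitStarL_of_rep φ _ u v h', map_sum, ← Finset.sum_mul]
    congr 1
    rw [← map_sum B.t]
    congr 1
    exact map_sum (opAddEquiv (α := L)) _ _
  · obtain ⟨m, u, v, h'⟩ := exists_rep (B.γ (x j))
    rw [BalTensor₃.lift_assocL_sum f hf₁ hf₂ h', B.hitStarL_of_rep ψ _ _ _ (B.γ_t_mul _ _ h')]
    rfl

/-- The actions of `_*𝒜` and `𝒜_*` commute. -/
theorem hitStarL_hitLStar (φ : B.StarL) (ψ : B.LStar) (a : A) :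
    B.hitStarL φ (B.hitLStar ψ a) = B.hitLStar ψ (B.hitStarL φ a) := by
  obtain ⟨n, x, y, h⟩ := exists_rep (B.γ a)
  have hc := B.coassoc a n x y h
  -- Both orders give `s(ψ(a₁)) t(φ(a₃)) a₂`: the two functionals read opposite outer legs.
  let f : A →+ A →+ A →+ A := triadditive (fun u v w => B.s (ψ.1 u) * (B.t (op (φ.1 w)) * v))
    (fun u u' v w => by rw [map_add, map_add, add_mul])
    (fun u v v' w => by rw [mul_add, mul_add])
    (fun u v w w' => by rw [map_add, MulOpposite.op_add, map_add, add_mul, mul_add])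
  have hf₁ : ∀ (l : L) (u v w : A), f (B.t (op l) * u) v w = f u (B.s l * v) w := by
    intro l u v w
    change B.s (ψ.1 (B.t (op l) * u)) * (B.t (op (φ.1 w)) * v) =
      B.s (ψ.1 u) * (B.t (op (φ.1 w)) * (B.s l * v))
    rw [ψ.2, map_mul, mul_assoc, ← mul_assoc (B.s l), B.s_t_comm l, mul_assoc]
  have hf₂ : ∀ (l : L) (u v w : A), f u (B.t (op l) * v) w = f u v (B.s l * w) := by
    intro l u v w
    change B.s (ψ.1 u) * (B.t (op (φ.1 w)) * (B.t (op l) * v)) =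
      B.s (ψ.1 u) * (B.t (op (φ.1 (B.s l * w))) * v)
    rw [φ.2, MulOpposite.op_mul, map_mul, mul_assoc (B.t _)]
  have hc' := congrArg (BalTensor₃.lift f hf₁ hf₂) hc
  rw [map_sum, map_sum] at hc'
  rw [B.hitStarL_of_rep φ a x y h, B.hitLStar_of_rep ψ a x y h, hitStarL_sum, hitLStar_sum]
  refine Eq.trans (Finset.sum_congr rfl fun j _ => ?_)
    (hc'.symm.trans (Finset.sum_congr rfl fun j _ => ?_))
  · obtain ⟨m, u, v, h'⟩ := exists_rep (B.γ (y j))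
    rw [BalTensor₃.lift_assocR_sum f hf₁ hf₂ h', hitStarL_s_mul, B.hitStarL_of_rep φ _ u v h',
      Finset.mul_sum]
    rfl
  · obtain ⟨m, u, v, h'⟩ := exists_rep (B.γ (x j))
    rw [BalTensor₃.lift_assocL_sum f hf₁ hf₂ h', hitLStar_t_mul, B.hitLStar_of_rep ψ _ u v h',
      Finset.mul_sum]
    refine Finset.sum_congr rfl fun k _ => ?_
    change B.s (ψ.1 (u k)) * (B.t (op (φ.1 (y j))) * v k) = _
    rw [← mul_assoc, ← mul_assoc, B.s_t_comm]

end LeftBialgebroid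

/-! ### Left multiplications on the coproduct of a right bialgebroid -/

namespace RightBialgebroid

open BalTensor

variable {A R : Type u} [Ring A] [Ring R] (B : RightBialgebroid A R)

/-- The codomain `A^R ⊗ ^RA` of the coproduct. -/
abbrev Sq : Type _ := BalTensor (rightAct B.s A) (leftAct B.t A)

/-- `x ⊗ y ↦ b x ⊗ c y`. -/
def mulLeft₂ (b c : A) : B.Sq →+ B.Sq :=
  lift (biadditive (fun x y => tmul _ _ (b * x) (c * y))
      (fun x x' y => by rw [mul_add, add_tmul]) (fun x y y' => by rw [mul_add, tmul_add]))
    (fun r x y => by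
      change tmul _ _ (b * (x * B.s r)) (c * y) = tmul _ _ (b * x) (c * (y * B.t (op r)))
      rw [← mul_assoc, ← mul_assoc]
      exact smul_tmul r (b * x) (c * y))

@[simp] theorem mulLeft₂_tmul (b c x y : A) :
    B.mulLeft₂ b c (tmul _ _ x y) = tmul _ _ (b * x) (c * y) := rfl

/-- `(b, c) ↦ (x ⊗ y ↦ b x ⊗ c y)` as a biadditive map. -/
def mulLeft₂Hom : A →+ A →+ B.Sq →+ B.Sq :=
  biadditive B.mulLeft₂
    (fun b b' c => hom_ext (fun x y => by
      rw [AddMonoidHom.add_apply]; simp only [mulLeft₂_tmul]; rw [add_mul, add_tmul]))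
    (fun b c c' => hom_ext (fun x y => by
      rw [AddMonoidHom.add_apply]; simp only [mulLeft₂_tmul]; rw [add_mul, tmul_add]))

theorem mulLeft₂Hom_apply (b c : A) (q : B.Sq) : B.mulLeft₂Hom b c q = B.mulLeft₂ b c q := rfl

theorem mulLeft₂_mulLeft₂ (b c b' c' : A) (q : B.Sq) :
    B.mulLeft₂ b c (B.mulLeft₂ b' c' q) = B.mulLeft₂ (b * b') (c * c') q :=
  DFunLike.congr_fun (hom_ext (f := (B.mulLeft₂ b c).comp (B.mulLeft₂ b' c')) (fun x y => by
    rw [AddMonoidHom.comp_apply]; simp only [mulLeft₂_tmul, mul_assoc])) q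

theorem γ_mul_eq (a b : A) {n : ℕ} {x y : Fin n → A} (h : B.γ a = ∑ j, tmul _ _ (x j) (y j)) :
    B.γ (a * b) = ∑ j, B.mulLeft₂ (x j) (y j) (B.γ b) := by
  obtain ⟨m, z, w, h'⟩ := exists_rep (B.γ b)
  rw [B.γ_mul a b n m x y z w h h']
  refine Finset.sum_congr rfl (fun k _ => ?_)
  rw [h', map_sum]
  rfl

theorem mulLeft₂_s (r : R) (a : A) :
    B.mulLeft₂ (B.s r) 1 (B.γ a) = B.mulLeft₂ 1 (B.t (op r)) (B.γ a) := by
  obtain ⟨n, x, y, h⟩ := exists_rep (B.γ a)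
  have h' := B.γ_takeuchi r a n x y h
  rw [h, map_sum, map_sum]
  simpa using h'

theorem γ_s_mul (r : R) (a : A) : B.γ (B.s r * a) = B.mulLeft₂ 1 (B.s r) (B.γ a) := by
  rw [B.γ_mul_eq (B.s r) a (x := fun _ : Fin 1 => 1) (y := fun _ => B.s r)
    (by simpa using B.γ_s r)]
  simp

theorem γ_t_mul (r : R) (a : A) : B.γ (B.t (op r) * a) = B.mulLeft₂ (B.t (op r)) 1 (B.γ a) := by
  rw [B.γ_mul_eq (B.t (op r)) a (x := fun _ : Fin 1 => B.t (op r)) (y := fun _ => 1)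
    (by simpa using B.γ_t r)]
  simp

end RightBialgebroid

/-! ### Integrals, the antipode and the convolution product -/

namespace HopfAlgebroid

open BalTensor

variable {H R : Type u} {L : Type v} [Ring H] [Ring R] [Ring L] (𝓗 : HopfAlgebroid H L R)

theorem S_mul_tR (a : H) (r : R) : 𝓗.S (a * 𝓗.right.t (op r)) = 𝓗.right.s r * 𝓗.S a := by
  simpa using 𝓗.S_right r 1 a

theorem S_tL_mul (l : L) (a : H) : 𝓗.S (𝓗.left.t (op l) * a) = 𝓗.S a * 𝓗.left.s l := by
  simpa using 𝓗.S_left l 1 a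

theorem S_mul_tL (a : H) (l : L) : 𝓗.S (a * 𝓗.left.t (op l)) = 𝓗.left.s l * 𝓗.S a := by
  simpa using 𝓗.S_left 1 l a

/-- The source and target ranges of the two bialgebroids coincide crosswise, so the axioms of both
sides apply to the same elements of `H`. -/
theorem exists_tL_eq (r : R) : ∃ l : L, 𝓗.left.t (op l) = 𝓗.right.s r := by
  obtain ⟨l, hl⟩ := 𝓗.range_tL.symm ▸ Set.mem_range_self r
  exact ⟨l.unop, hl⟩

theorem exists_sR_eq (l : L) : ∃ r : R, 𝓗.right.s r = 𝓗.left.t (op l) :=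
  𝓗.range_tL.subset (Set.mem_range_self (op l))

theorem exists_tR_eq (l : L) : ∃ r : R, 𝓗.right.t (op r) = 𝓗.left.s l := by
  obtain ⟨r, hr⟩ := 𝓗.range_sL ▸ Set.mem_range_self l
  exact ⟨r.unop, hr⟩

/-- `s_R(r)` is some `t_L(l)`, and `γ_L(t_L(l)) = 1 ⊗ t_L(l)`. -/
theorem γL_mul_sR (a : H) (r : R) :
    𝓗.left.γ (a * 𝓗.right.s r) = 𝓗.left.mulRight₂ 1 (𝓗.right.s r) (𝓗.left.γ a) := by
  obtain ⟨l, hl⟩ := 𝓗.exists_tL_eq r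
  rw [← hl, 𝓗.left.γ_mul_t]

theorem γR_tL_mul (l : L) (a : H) :
    𝓗.right.γ (𝓗.left.t (op l) * a) = 𝓗.right.mulLeft₂ 1 (𝓗.left.t (op l)) (𝓗.right.γ a) := by
  obtain ⟨r, hr⟩ := 𝓗.exists_sR_eq l
  rw [← hr, 𝓗.right.γ_s_mul]

theorem γR_sL_mul (l : L) (a : H) :
    𝓗.right.γ (𝓗.left.s l * a) = 𝓗.right.mulLeft₂ (𝓗.left.s l) 1 (𝓗.right.γ a) := by
  obtain ⟨r, hr⟩ := 𝓗.exists_tR_eq l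
  rw [← hr, 𝓗.right.γ_t_mul]

/-- `g₁ a⁽¹⁾₁ ⊗ g₂ a⁽¹⁾₂ S(a⁽²⁾) = g₁ a ⊗ g₂`. -/
theorem sum_mulRight₂_S (g a : H) {n : ℕ} {x y : Fin n → H}
    (h : 𝓗.right.γ a = ∑ j, tmul _ _ (x j) (y j)) :
    ∑ j, 𝓗.left.mulRight₂ 1 (𝓗.S (y j)) (𝓗.left.γ (g * x j)) =
      𝓗.left.mulRight₂ a 1 (𝓗.left.γ g) := by
  obtain ⟨m, z, w, h'⟩ := exists_rep (𝓗.left.γ a)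
  have hc := 𝓗.coassoc_LR a n m x y z w h h'
  -- This map is balanced in the first two variables by the Takeuchi axiom, and in the last two
  -- because `S(w t_R(r)) = s_R(r) S(w)`.
  obtain ⟨f, hf⟩ : ∃ f : H →+ H →+ H →+ 𝓗.left.Sq, ∀ u v w,
      f u v w = 𝓗.left.mulRight₂Hom u (v * 𝓗.S w) (𝓗.left.γ g) :=
    ⟨triadditive (fun u v w => 𝓗.left.mulRight₂Hom u (v * 𝓗.S w) (𝓗.left.γ g))
      (fun u u' v w => by rw [map_add]; rfl)
      (fun u v v' w => by rw [add_mul, map_add]; rfl)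
      (fun u v w w' => by rw [map_add, mul_add, map_add]; rfl), fun _ _ _ => rfl⟩
  have hf₁ : ∀ (l : L) (u v w : H), f (AddMonoidHom.mulLeft (𝓗.left.t (op l)) u) v w =
      f u (AddMonoidHom.mulLeft (𝓗.left.s l) v) w := by
    intro l u v w
    rw [hf, hf]
    change 𝓗.left.mulRight₂ (𝓗.left.t (op l) * u) (v * 𝓗.S w) (𝓗.left.γ g) =
      𝓗.left.mulRight₂ u (𝓗.left.s l * v * 𝓗.S w) (𝓗.left.γ g)
    have h₁ := congrArg (𝓗.left.mulRight₂ u (v * 𝓗.S w)) (𝓗.left.mulRight₂_t l g)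
    rw [𝓗.left.mulRight₂_mulRight₂, 𝓗.left.mulRight₂_mulRight₂, one_mul, one_mul] at h₁
    rw [h₁, mul_assoc]
  have hf₂ : ∀ (r : R) (u v w : H), f u (rightAct 𝓗.right.s H r v) w =
      f u v (leftAct 𝓗.right.t H r w) := by
    intro r u v w
    rw [hf, hf]
    change 𝓗.left.mulRight₂ u (v * 𝓗.right.s r * 𝓗.S w) (𝓗.left.γ g) =
      𝓗.left.mulRight₂ u (v * 𝓗.S (w * 𝓗.right.t (op r))) (𝓗.left.γ g)
    rw [S_mul_tR, mul_assoc]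
  have hc' := congrArg (BalTensor₃.lift f hf₁ hf₂) hc
  rw [map_sum, map_sum] at hc'
  refine Eq.trans (Finset.sum_congr rfl fun j _ => ?_) (hc'.trans ?_)
  · obtain ⟨k, p, q, h₁⟩ := exists_rep (𝓗.left.γ (x j))
    rw [BalTensor₃.lift_assocL_sum f hf₁ hf₂ h₁, 𝓗.left.γ_mul_eq g (x j) h₁, map_sum]
    refine Finset.sum_congr rfl fun c _ => ?_
    rw [𝓗.left.mulRight₂_mulRight₂, mul_one, hf]
    rfl
  -- In the other bracketing the antipode axiom contracts the last two legs to `s_L(π_L(a₂))`; the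
  -- Takeuchi axiom moves this to the first leg as `t_L(π_L(a₂))`, and the counit law restores `a`.
  · have h₂ : ∀ k, BalTensor₃.lift f hf₁ hf₂ (BalTensor₃.assocR _ _ _ _ (z k) (𝓗.right.γ (w k))) =
        𝓗.left.mulRight₂Hom (𝓗.left.t (op (𝓗.left.π (w k))) * z k) 1 (𝓗.left.γ g) := by
      intro k
      obtain ⟨c, p, q, h₁⟩ := exists_rep (𝓗.right.γ (w k))
      rw [BalTensor₃.lift_assocR_sum f hf₁ hf₂ h₁]
      simp only [hf]
      rw [← AddMonoidHom.finsetSum_apply, ← map_sum, 𝓗.antipode_right _ _ _ _ h₁]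
      have h₃ := congrArg (𝓗.left.mulRight₂ (z k) 1) (𝓗.left.mulRight₂_t (𝓗.left.π (w k)) g)
      rw [𝓗.left.mulRight₂_mulRight₂, 𝓗.left.mulRight₂_mulRight₂] at h₃
      simp only [one_mul, mul_one] at h₃
      exact h₃.symm
    simp only [h₂]
    rw [← AddMonoidHom.finsetSum_apply, ← AddMonoidHom.finsetSum_apply, ← map_sum,
      𝓗.left.counit_right a m z w h']
    rfl

variable {𝓗} {i : H} (hi : 𝓗.IsRightIntegral i)

include hi

/-- `i₁ a ⊗ i₂ = i₁ ⊗ i₂ S(a)`. -/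
theorem IsRightIntegral.mulRight₂_S (a : H) :
    𝓗.left.mulRight₂ a 1 (𝓗.left.γ i) = 𝓗.left.mulRight₂ 1 (𝓗.S a) (𝓗.left.γ i) := by
  obtain ⟨n, x, y, h⟩ := exists_rep (𝓗.right.γ a)
  rw [← 𝓗.sum_mulRight₂_S i a h]
  -- The integral turns `i a⁽¹⁾` into `i s_R(π_R(a⁽¹⁾))`, which affects only the second leg of
  -- `γ_L`. There `S` absorbs it as `t_R(π_R(a⁽¹⁾))`, and a counit law collects `a`.
  have h₁ : ∀ j, 𝓗.left.mulRight₂ 1 (𝓗.S (y j)) (𝓗.left.γ (i * x j)) =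
      𝓗.left.mulRight₂Hom 1 (𝓗.S (y j * 𝓗.right.t (op (𝓗.right.π (x j))))) (𝓗.left.γ i) := by
    intro j
    rw [hi (x j), γL_mul_sR, 𝓗.left.mulRight₂_mulRight₂, one_mul, S_mul_tR]
    rfl
  simp only [h₁]
  rw [← AddMonoidHom.finsetSum_apply, ← map_sum, ← map_sum, 𝓗.right.counit_left a n x y h]
  rfl

/-- The integral property at `t_R(r)`, since `π_R(t_R(r)) = r`. -/
theorem IsRightIntegral.mul_t (r : R) : i * 𝓗.right.t (op r) = i * 𝓗.right.s r := by
  rw [hi (𝓗.right.t (op r))]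
  have h := 𝓗.right.π_mul_t 1 r
  rw [one_mul, 𝓗.right.π_one, mul_one] at h
  rw [h]

variable (hnd : 𝓗.IsNondegenerate i)

include hnd

/-- The antipode is anti-multiplicative. -/
theorem IsRightIntegral.S_mul (a b : H) : 𝓗.S (a * b) = 𝓗.S b * 𝓗.S a := by
  -- This `ψ` satisfies `s_L(ψ(i₁)) i₂ = 1`; applied to `i₁ ⊗ i₂ S(ab) = i₁ ⊗ i₂ S(b) S(a)` it
  -- strips off `i`.
  obtain ⟨ψ, hψ⟩ := hnd.bijective_lStar.2 1
  have h₁ := hi.mulRight₂_S (a * b)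
  have h₂ := congrArg (𝓗.left.mulRight₂ b 1) (hi.mulRight₂_S a)
  have h₃ := congrArg (𝓗.left.mulRight₂ 1 (𝓗.S a)) (hi.mulRight₂_S b)
  rw [𝓗.left.mulRight₂_mulRight₂, 𝓗.left.mulRight₂_mulRight₂] at h₂ h₃
  simp only [mul_one, one_mul] at h₂ h₃
  have h₄ := congrArg (𝓗.left.actLStar ψ) (h₁.symm.trans (h₂.trans h₃))
  rw [𝓗.left.actLStar_mulRight₂_right, 𝓗.left.actLStar_mulRight₂_right] at h₄
  change 𝓗.left.actLStar ψ (𝓗.left.γ i) = 1 at hψ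
  rwa [hψ, one_mul, one_mul] at h₄

/-- `S⁻¹(a₂) a₁ = t_R(π_R(a))`. -/
theorem IsRightIntegral.sum_S_symm_mul (a : H) {n : ℕ} {x y : Fin n → H}
    (h : 𝓗.left.γ a = ∑ j, tmul _ _ (x j) (y j)) :
    ∑ j, 𝓗.S.symm (y j) * x j = 𝓗.right.t (op (𝓗.right.π a)) := by
  apply 𝓗.S.injective
  -- Anti-multiplicativity at the product `S⁻¹(1) · 1`, whose image under `S` is `1`.
  have h₁ : 𝓗.S 1 = 1 := by
    have h₂ := hi.S_mul hnd (𝓗.S.symm 1) 1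
    rwa [mul_one, 𝓗.S.apply_symm_apply, mul_one, eq_comm] at h₂
  have h₂ := 𝓗.S_mul_tR 1 (𝓗.right.π a)
  rw [one_mul, h₁, mul_one] at h₂
  rw [h₂, map_sum, ← 𝓗.antipode_left a n x y h]
  refine Finset.sum_congr rfl fun j _ => ?_
  rw [hi.S_mul hnd, 𝓗.S.apply_symm_apply]

omit hi

variable (i) in
omit hnd in
/-- The element `_Li⁻¹(k)` of `_*𝓗`. -/
noncomputable def dualStarL (hnd : 𝓗.IsNondegenerate i) (k : H) : 𝓗.left.StarL :=
  (Equiv.ofBijective _ hnd.bijective_starL).symm k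

theorem hitStarL_dualStarL (k : H) : 𝓗.left.hitStarL (dualStarL i hnd k) i = k :=
  (Equiv.ofBijective _ hnd.bijective_starL).apply_symm_apply k

theorem dualStarL_eq {k : H} {φ : 𝓗.left.StarL} (h : 𝓗.left.hitStarL φ i = k) :
    dualStarL i hnd k = φ :=
  (Equiv.ofBijective _ hnd.bijective_starL).symm_apply_eq.2 h.symm

/-- Since `i ↼ (φψ) = (i ↼ φ) ↼ ψ`, only the second factor has to be pulled back to `_*𝓗`. -/
theorem conv_eq_hitStarL (h k : H) : conv hnd h k = 𝓗.left.hitStarL (dualStarL i hnd k) h := by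
  change 𝓗.left.hitStarL (𝓗.left.mulStarL (dualStarL i hnd h) (dualStarL i hnd k)) i = _
  rw [𝓗.left.hitStarL_mulStarL, hitStarL_dualStarL]

/-- `_Li⁻¹` is multiplicative by the definition of `∗`, so associativity is the action property of
`↼`. -/
theorem conv_assoc (h k l : H) : conv hnd (conv hnd h k) l = conv hnd h (conv hnd k l) := by
  have h₁ : dualStarL i hnd (conv hnd k l) =
      𝓗.left.mulStarL (dualStarL i hnd k) (dualStarL i hnd l) := dualStarL_eq hnd rfl
  rw [conv_eq_hitStarL hnd h (conv hnd k l), h₁, 𝓗.left.hitStarL_mulStarL, ← conv_eq_hitStarL,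
    ← conv_eq_hitStarL]

theorem conv_integral_left (k : H) : conv hnd i k = k := by
  rw [conv_eq_hitStarL, hitStarL_dualStarL]

/-- `_Li⁻¹(i)` is the counit, which acts trivially. -/
theorem conv_integral_right (h : H) : conv hnd h i = h := by
  rw [conv_eq_hitStarL, dualStarL_eq hnd (𝓗.left.hitStarL_counitStarL i),
    𝓗.left.hitStarL_counitStarL]

/-- It makes left multiplication by `s_L(l)` right `𝒬`-linear, hence a 2-endomorphism of `𝒳`. -/
theorem conv_sL_mul (l : L) (h k : H) : conv hnd (𝓗.left.s l * h) k = 𝓗.left.s l * conv hnd h k := by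
  rw [conv_eq_hitStarL, conv_eq_hitStarL, 𝓗.left.hitStarL_s_mul]

/-- `h ∗ k = s_L(ψ(k₁)) k₂` for `ψ = i_L⁻¹(h)`. -/
theorem exists_conv_eq_hitLStar (h : H) :
    ∃ ψ : 𝓗.left.LStar, ∀ k, conv hnd h k = 𝓗.left.hitLStar ψ k := by
  obtain ⟨ψ, hψ⟩ := hnd.bijective_lStar.2 h
  refine ⟨ψ, fun k => ?_⟩
  change 𝓗.left.hitLStar ψ i = h at hψ
  rw [conv_eq_hitStarL]
  -- With `h = i ↼ ψ`, commuting the two actions leaves `i ↼ _Li⁻¹(k) = k` inside.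
  conv_lhs => rw [← hψ]
  rw [𝓗.left.hitStarL_hitLStar, hitStarL_dualStarL]

include hi

/-- `h ∗ k = t_L(φ(h₂ S(k))) h₁` for `φ = _Li⁻¹(1)`. -/
theorem conv_eq_actStarL (h k : H) : conv hnd h k =
    𝓗.left.actStarL (dualStarL i hnd 1) (𝓗.left.mulRight₂ 1 (𝓗.S k) (𝓗.left.γ h)) := by
  -- By `i₁ k ⊗ i₂ = i₁ ⊗ i₂ S(k)`, the functional `φ(· S(k))` sends `i` to `(i ↼ φ) k = k`.
  have h₁ : dualStarL i hnd k = 𝓗.left.shiftStarL (dualStarL i hnd 1) (𝓗.S k) := by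
    apply dualStarL_eq
    rw [𝓗.left.hitStarL_shiftStarL, ← hi.mulRight₂_S, 𝓗.left.actStarL_mulRight₂_left,
      ← 𝓗.left.hitStarL_eq, hitStarL_dualStarL, one_mul]
  rw [conv_eq_hitStarL, h₁, 𝓗.left.hitStarL_shiftStarL]

theorem conv_add_left (h h' k : H) : conv hnd (h + h') k = conv hnd h k + conv hnd h' k := by
  simp only [conv_eq_actStarL hi, map_add]

theorem conv_add_right (h k k' : H) : conv hnd h (k + k') = conv hnd h k + conv hnd h k' := by
  simp only [conv_eq_actStarL hi, ← LeftBialgebroid.mulRight₂Hom_apply, map_add,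
    AddMonoidHom.add_apply]

/-- In the closed form `s_R(r)` lands between `h₂` and `S(k)`, and `s_R(r) S(k) = S(k t_R(r))`. -/
theorem conv_mul_s (h k : H) (r : R) :
    conv hnd (h * 𝓗.right.s r) k = conv hnd h (k * 𝓗.right.t (op r)) := by
  rw [conv_eq_actStarL hi, conv_eq_actStarL hi, γL_mul_sR, 𝓗.left.mulRight₂_mulRight₂, S_mul_tR,
    one_mul]

/-- `(h ∗ k) a = (h a⁽¹⁾) ∗ (k a⁽²⁾)`. -/
theorem conv_mul (h k a : H) {n : ℕ} {x y : Fin n → H}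
    (ha : 𝓗.right.γ a = ∑ j, tmul _ _ (x j) (y j)) :
    ∑ j, conv hnd (h * x j) (k * y j) = conv hnd h k * a := by
  have h₁ : ∀ j, conv hnd (h * x j) (k * y j) = 𝓗.left.actStarL (dualStarL i hnd 1)
      (𝓗.left.mulRight₂ 1 (𝓗.S k) (𝓗.left.mulRight₂ 1 (𝓗.S (y j)) (𝓗.left.γ (h * x j)))) := by
    intro j
    rw [conv_eq_actStarL hi, 𝓗.left.mulRight₂_mulRight₂, hi.S_mul hnd, one_mul]
  simp only [h₁]
  -- Both parts of `γ_R(a)` collapse to one `a` on the first leg, which `φ` does not read.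
  rw [← map_sum, ← map_sum, 𝓗.sum_mulRight₂_S h a ha, 𝓗.left.mulRight₂_mulRight₂,
    conv_eq_actStarL hi, ← 𝓗.left.actStarL_mulRight₂_left, 𝓗.left.mulRight₂_mulRight₂]
  simp only [mul_one, one_mul]

end HopfAlgebroid

/-! ### The coproduct `γ_R` of convolutions and of integrals -/

namespace HopfAlgebroid

open BalTensor

variable {H R : Type u} {L : Type v} [Ring H] [Ring R] [Ring L] (𝓗 : HopfAlgebroid H L R)

/-- `γ_R(h ↼ φ) = h⁽¹⁾ ⊗ (h⁽²⁾ ↼ φ)` for `φ ∈ _*𝓗`. -/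
theorem γR_hitStarL (φ : 𝓗.left.StarL) (a : H) {n : ℕ} {x y : Fin n → H}
    (h : 𝓗.right.γ a = ∑ j, tmul _ _ (x j) (y j)) :
    𝓗.right.γ (𝓗.left.hitStarL φ a) = ∑ j, tmul _ _ (x j) (𝓗.left.hitStarL φ (y j)) := by
  obtain ⟨m, z, w, h'⟩ := exists_rep (𝓗.left.γ a)
  have hc := 𝓗.coassoc_RL a m n z w x y h' h
  -- `φ` reads the last leg of the mixed threefold coproduct. The factor `t_L(φ(·))` enters `γ_R` on
  -- the second leg, since `t_L(l)` is some `s_R(r)`.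
  obtain ⟨f, hf⟩ : ∃ f : H →+ H →+ H →+ 𝓗.right.Sq, ∀ u v w,
      f u v w = tmulHom _ _ u (𝓗.left.t (op (φ.1 w)) * v) :=
    ⟨triadditive (fun u v w => tmulHom _ _ u (𝓗.left.t (op (φ.1 w)) * v))
      (fun u u' v w => by rw [map_add]; rfl)
      (fun u v v' w => by rw [mul_add, map_add])
      (fun u v w w' => by rw [map_add, MulOpposite.op_add, map_add, add_mul, map_add]),
      fun _ _ _ => rfl⟩
  have hf₁ : ∀ (r : R) (u v w : H), f (rightAct 𝓗.right.s H r u) v w =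
      f u (leftAct 𝓗.right.t H r v) w := by
    intro r u v w
    rw [hf, hf]
    refine (smul_tmul r u _).trans ?_
    change tmul _ _ u (𝓗.left.t (op (φ.1 w)) * v * 𝓗.right.t (op r)) =
      tmul _ _ u (𝓗.left.t (op (φ.1 w)) * (v * 𝓗.right.t (op r)))
    rw [mul_assoc]
  have hf₂ : ∀ (l : L) (u v w : H), f u (AddMonoidHom.mulLeft (𝓗.left.t (op l)) v) w =
      f u v (AddMonoidHom.mulLeft (𝓗.left.s l) w) := by
    intro l u v w
    rw [hf, hf]
    change tmul _ _ u (𝓗.left.t (op (φ.1 w)) * (𝓗.left.t (op l) * v)) =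
      tmul _ _ u (𝓗.left.t (op (φ.1 (𝓗.left.s l * w))) * v)
    rw [φ.2, MulOpposite.op_mul, map_mul, mul_assoc]
  have hc' := congrArg (BalTensor₃.lift f hf₁ hf₂) hc
  rw [map_sum, map_sum] at hc'
  rw [𝓗.left.hitStarL_of_rep φ a z w h', map_sum]
  refine Eq.trans (Finset.sum_congr rfl fun j _ => ?_)
    (hc'.trans (Finset.sum_congr rfl fun j _ => ?_))
  · obtain ⟨k, p, q, h₁⟩ := exists_rep (𝓗.right.γ (z j))
    rw [BalTensor₃.lift_assocL_sum f hf₁ hf₂ h₁, γR_tL_mul, h₁, map_sum]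
    refine Finset.sum_congr rfl fun c _ => ?_
    rw [hf, 𝓗.right.mulLeft₂_tmul, one_mul]
    rfl
  · obtain ⟨k, p, q, h₁⟩ := exists_rep (𝓗.left.γ (y j))
    rw [BalTensor₃.lift_assocR_sum f hf₁ hf₂ h₁, 𝓗.left.hitStarL_of_rep φ _ p q h₁, tmul_sum]
    refine Finset.sum_congr rfl fun c _ => ?_
    rw [hf]
    rfl

/-- `γ_R(h ↼ ψ) = (h⁽¹⁾ ↼ ψ) ⊗ h⁽²⁾` for `ψ ∈ 𝓗_*`. -/
theorem γR_hitLStar (ψ : 𝓗.left.LStar) (a : H) {n : ℕ} {x y : Fin n → H}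
    (h : 𝓗.right.γ a = ∑ j, tmul _ _ (x j) (y j)) :
    𝓗.right.γ (𝓗.left.hitLStar ψ a) = ∑ j, tmul _ _ (𝓗.left.hitLStar ψ (x j)) (y j) := by
  obtain ⟨m, z, w, h'⟩ := exists_rep (𝓗.left.γ a)
  have hc := 𝓗.coassoc_LR a n m x y z w h h'
  -- Now `ψ` reads the first leg, and `s_L(ψ(·))` enters `γ_R` on the first leg, since `s_L(l)` is
  -- some `t_R(r)`.
  obtain ⟨f, hf⟩ : ∃ f : H →+ H →+ H →+ 𝓗.right.Sq, ∀ u v w,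
      f u v w = tmulHom _ _ (𝓗.left.s (ψ.1 u) * v) w :=
    ⟨triadditive (fun u v w => tmulHom _ _ (𝓗.left.s (ψ.1 u) * v) w)
      (fun u u' v w => by rw [map_add, map_add, add_mul, map_add]; rfl)
      (fun u v v' w => by rw [mul_add, map_add]; rfl)
      (fun u v w w' => by rw [map_add]),
      fun _ _ _ => rfl⟩
  have hf₁ : ∀ (l : L) (u v w : H), f (AddMonoidHom.mulLeft (𝓗.left.t (op l)) u) v w =
      f u (AddMonoidHom.mulLeft (𝓗.left.s l) v) w := by
    intro l u v w
    rw [hf, hf]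
    change tmul _ _ (𝓗.left.s (ψ.1 (𝓗.left.t (op l) * u)) * v) w =
      tmul _ _ (𝓗.left.s (ψ.1 u) * (𝓗.left.s l * v)) w
    rw [ψ.2, map_mul, mul_assoc]
  have hf₂ : ∀ (r : R) (u v w : H), f u (rightAct 𝓗.right.s H r v) w =
      f u v (leftAct 𝓗.right.t H r w) := by
    intro r u v w
    rw [hf, hf]
    refine Eq.trans ?_ (smul_tmul r (𝓗.left.s (ψ.1 u) * v) w)
    change tmul _ _ (𝓗.left.s (ψ.1 u) * (v * 𝓗.right.s r)) w =
      tmul _ _ (𝓗.left.s (ψ.1 u) * v * 𝓗.right.s r) w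
    rw [mul_assoc]
  have hc' := congrArg (BalTensor₃.lift f hf₁ hf₂) hc
  rw [map_sum, map_sum] at hc'
  rw [𝓗.left.hitLStar_of_rep ψ a z w h', map_sum]
  refine Eq.trans (Finset.sum_congr rfl fun j _ => ?_)
    (hc'.symm.trans (Finset.sum_congr rfl fun j _ => ?_))
  · obtain ⟨k, p, q, h₁⟩ := exists_rep (𝓗.right.γ (w j))
    rw [BalTensor₃.lift_assocR_sum f hf₁ hf₂ h₁, γR_sL_mul, h₁, map_sum]
    refine Finset.sum_congr rfl fun c _ => ?_
    rw [hf, 𝓗.right.mulLeft₂_tmul, one_mul]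
    rfl
  · obtain ⟨k, p, q, h₁⟩ := exists_rep (𝓗.left.γ (x j))
    rw [BalTensor₃.lift_assocL_sum f hf₁ hf₂ h₁, 𝓗.left.hitLStar_of_rep ψ _ p q h₁, sum_tmul]
    refine Finset.sum_congr rfl fun c _ => ?_
    rw [hf]
    rfl

variable {𝓗} {i : H} (hi : 𝓗.IsRightIntegral i) (hnd : 𝓗.IsNondegenerate i)

/-- `γ_R(h ∗ k) = h⁽¹⁾ ⊗ (h⁽²⁾ ∗ k)`. -/
theorem γR_conv_right (h k : H) {n : ℕ} {x y : Fin n → H}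
    (hh : 𝓗.right.γ h = ∑ j, tmul _ _ (x j) (y j)) :
    𝓗.right.γ (conv hnd h k) = ∑ j, tmul _ _ (x j) (conv hnd (y j) k) := by
  simp only [conv_eq_hitStarL]
  exact 𝓗.γR_hitStarL _ h hh

/-- `γ_R(h ∗ k) = (h ∗ k⁽¹⁾) ⊗ k⁽²⁾`. -/
theorem γR_conv_left (h k : H) {n : ℕ} {x y : Fin n → H}
    (hk : 𝓗.right.γ k = ∑ j, tmul _ _ (x j) (y j)) :
    𝓗.right.γ (conv hnd h k) = ∑ j, tmul _ _ (conv hnd h (x j)) (y j) := by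
  -- Acting on `k` requires the other description of `∗`, through `𝓗_*`.
  obtain ⟨ψ, hψ⟩ := exists_conv_eq_hitLStar hnd h
  simp only [hψ]
  exact 𝓗.γR_hitLStar ψ k hk

include hi

/-- `S(i₁) (i₂ h)⁽¹⁾ ⊗ (i₂ h)⁽²⁾ = h ⊗ i`. -/
theorem IsRightIntegral.sum_mulLeft₂_S {n : ℕ} {x y : Fin n → H}
    (hx : 𝓗.left.γ i = ∑ j, tmul _ _ (x j) (y j)) (h : H) :
    ∑ j, 𝓗.right.mulLeft₂ (𝓗.S (x j)) 1 (𝓗.right.γ (y j * h)) = tmul _ _ h i := by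
  obtain ⟨m, z, w, hz⟩ := exists_rep (𝓗.right.γ i)
  have hc := 𝓗.coassoc_LR i m n z w x y hz hx
  obtain ⟨f, hf⟩ : ∃ f : H →+ H →+ H →+ 𝓗.right.Sq, ∀ u v w,
      f u v w = 𝓗.right.mulLeft₂Hom (𝓗.S u * v) w (𝓗.right.γ h) :=
    ⟨triadditive (fun u v w => 𝓗.right.mulLeft₂Hom (𝓗.S u * v) w (𝓗.right.γ h))
      (fun u u' v w => by rw [map_add, add_mul, map_add]; rfl)
      (fun u v v' w => by rw [mul_add, map_add]; rfl)
      (fun u v w w' => by rw [map_add]; rfl),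
      fun _ _ _ => rfl⟩
  have hf₁ : ∀ (l : L) (u v w : H), f (AddMonoidHom.mulLeft (𝓗.left.t (op l)) u) v w =
      f u (AddMonoidHom.mulLeft (𝓗.left.s l) v) w := by
    intro l u v w
    rw [hf, hf]
    simp only [AddMonoidHom.coe_mulLeft]
    rw [S_tL_mul, mul_assoc]
  have hT : ∀ (b c : H) (r : R), 𝓗.right.mulLeft₂ (b * 𝓗.right.s r) c (𝓗.right.γ h) =
      𝓗.right.mulLeft₂ b (c * 𝓗.right.t (op r)) (𝓗.right.γ h) := by
    intro b c r
    have h₁ := congrArg (𝓗.right.mulLeft₂ b c) (𝓗.right.mulLeft₂_s r h)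
    rw [𝓗.right.mulLeft₂_mulLeft₂, 𝓗.right.mulLeft₂_mulLeft₂] at h₁
    simpa only [mul_one] using h₁
  have hf₂ : ∀ (r : R) (u v w : H), f u (rightAct 𝓗.right.s H r v) w =
      f u v (leftAct 𝓗.right.t H r w) := by
    intro r u v w
    rw [hf, hf]
    change 𝓗.right.mulLeft₂ (𝓗.S u * (v * 𝓗.right.s r)) w (𝓗.right.γ h) =
      𝓗.right.mulLeft₂ (𝓗.S u * v) (w * 𝓗.right.t (op r)) (𝓗.right.γ h)
    rw [← hT, mul_assoc]
  have hc' := congrArg (BalTensor₃.lift f hf₁ hf₂) hc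
  rw [map_sum, map_sum] at hc'
  refine Eq.trans (Finset.sum_congr rfl fun j _ => ?_) (hc'.symm.trans ?_)
  · obtain ⟨k, p, q, h₁⟩ := exists_rep (𝓗.right.γ (y j))
    rw [BalTensor₃.lift_assocR_sum f hf₁ hf₂ h₁, 𝓗.right.γ_mul_eq (y j) h h₁, map_sum]
    refine Finset.sum_congr rfl fun c _ => ?_
    rw [hf, 𝓗.right.mulLeft₂_mulLeft₂, one_mul]
    rfl
  -- In the other bracketing `S(i⁽¹⁾₁) i⁽¹⁾₂ = s_R(π_R(i⁽¹⁾))` crosses to the second leg by the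
  -- Takeuchi axiom; a counit law restores `i` there, leaving `h⁽¹⁾ ⊗ i h⁽²⁾`.
  · have h₂ : ∀ k, BalTensor₃.lift f hf₁ hf₂ (BalTensor₃.assocL _ _ _ _ (𝓗.left.γ (z k)) (w k)) =
        𝓗.right.mulLeft₂Hom 1 (w k * 𝓗.right.t (op (𝓗.right.π (z k)))) (𝓗.right.γ h) := by
      intro k
      obtain ⟨c, p, q, h₁⟩ := exists_rep (𝓗.left.γ (z k))
      rw [BalTensor₃.lift_assocL_sum f hf₁ hf₂ h₁]
      simp only [hf]
      rw [← AddMonoidHom.finsetSum_apply, ← AddMonoidHom.finsetSum_apply, ← map_sum,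
        𝓗.antipode_left _ _ _ _ h₁]
      have h₃ := hT 1 (w k) (𝓗.right.π (z k))
      rw [one_mul] at h₃
      exact h₃
    simp only [h₂]
    rw [← AddMonoidHom.finsetSum_apply, ← map_sum, 𝓗.right.counit_left i m z w hz,
      𝓗.right.mulLeft₂Hom_apply]
    obtain ⟨k, p, q, h₁⟩ := exists_rep (𝓗.right.γ h)
    rw [h₁, map_sum, ← 𝓗.right.counit_right h k p q h₁, sum_tmul]
    refine Finset.sum_congr rfl fun c _ => ?_
    -- `i h⁽²⁾ = i t_R(π_R(h⁽²⁾))`, and this base ring element crosses `⊗_R` to complete `h` on the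
    -- first leg.
    rw [𝓗.right.mulLeft₂_tmul, one_mul, hi (q c), ← hi.mul_t]
    exact (smul_tmul _ _ _).symm

include hnd

/-- `(i₁ k)⁽¹⁾ ⊗ S⁻¹(i₂) (i₁ k)⁽²⁾ = i ⊗ k`. -/
theorem IsRightIntegral.sum_mulLeft₂_S_symm {n : ℕ} {x y : Fin n → H}
    (hx : 𝓗.left.γ i = ∑ j, tmul _ _ (x j) (y j)) (h : H) :
    ∑ j, 𝓗.right.mulLeft₂ 1 (𝓗.S.symm (y j)) (𝓗.right.γ (x j * h)) = tmul _ _ i h := by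
  obtain ⟨m, z, w, hz⟩ := exists_rep (𝓗.right.γ i)
  have hc := 𝓗.coassoc_RL i n m x y z w hx hz
  obtain ⟨f, hf⟩ : ∃ f : H →+ H →+ H →+ 𝓗.right.Sq, ∀ u v w,
      f u v w = 𝓗.right.mulLeft₂Hom u (𝓗.S.symm w * v) (𝓗.right.γ h) :=
    ⟨triadditive (fun u v w => 𝓗.right.mulLeft₂Hom u (𝓗.S.symm w * v) (𝓗.right.γ h))
      (fun u u' v w => by rw [map_add]; rfl)
      (fun u v v' w => by rw [mul_add, map_add]; rfl)
      (fun u v w w' => by rw [map_add, add_mul, map_add]; rfl),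
      fun _ _ _ => rfl⟩
  have hT : ∀ (b c : H) (r : R), 𝓗.right.mulLeft₂ (b * 𝓗.right.s r) c (𝓗.right.γ h) =
      𝓗.right.mulLeft₂ b (c * 𝓗.right.t (op r)) (𝓗.right.γ h) := by
    intro b c r
    have h₁ := congrArg (𝓗.right.mulLeft₂ b c) (𝓗.right.mulLeft₂_s r h)
    rw [𝓗.right.mulLeft₂_mulLeft₂, 𝓗.right.mulLeft₂_mulLeft₂] at h₁
    simpa only [mul_one] using h₁
  have hf₁ : ∀ (r : R) (u v w : H), f (rightAct 𝓗.right.s H r u) v w =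
      f u (leftAct 𝓗.right.t H r v) w := by
    intro r u v w
    rw [hf, hf]
    change 𝓗.right.mulLeft₂ (u * 𝓗.right.s r) (𝓗.S.symm w * v) (𝓗.right.γ h) =
      𝓗.right.mulLeft₂ u (𝓗.S.symm w * (v * 𝓗.right.t (op r))) (𝓗.right.γ h)
    rw [hT, mul_assoc]
  have hf₂ : ∀ (l : L) (u v w : H), f u (AddMonoidHom.mulLeft (𝓗.left.t (op l)) v) w =
      f u v (AddMonoidHom.mulLeft (𝓗.left.s l) w) := by
    intro l u v w
    have h₁ : 𝓗.S.symm (𝓗.left.s l * w) = 𝓗.S.symm w * 𝓗.left.t (op l) := by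
      rw [AddEquiv.symm_apply_eq, S_mul_tL, AddEquiv.apply_symm_apply]
    rw [hf, hf]
    simp only [AddMonoidHom.coe_mulLeft]
    rw [h₁, mul_assoc]
  have hc' := congrArg (BalTensor₃.lift f hf₁ hf₂) hc
  rw [map_sum, map_sum] at hc'
  refine Eq.trans (Finset.sum_congr rfl fun j _ => ?_) (hc'.trans ?_)
  · obtain ⟨k, p, q, h₁⟩ := exists_rep (𝓗.right.γ (x j))
    rw [BalTensor₃.lift_assocL_sum f hf₁ hf₂ h₁, 𝓗.right.γ_mul_eq (x j) h h₁, map_sum]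
    refine Finset.sum_congr rfl fun c _ => ?_
    rw [hf, 𝓗.right.mulLeft₂_mulLeft₂, one_mul]
    rfl
  -- Here `S⁻¹(i⁽²⁾₂) i⁽²⁾₁ = t_R(π_R(i⁽²⁾))` crosses to the first leg, leaving `i h⁽¹⁾ ⊗ h⁽²⁾`; the
  -- integral property then gives `i ⊗ h`.
  · have h₂ : ∀ k, BalTensor₃.lift f hf₁ hf₂ (BalTensor₃.assocR _ _ _ _ (z k) (𝓗.left.γ (w k))) =
        𝓗.right.mulLeft₂Hom (z k * 𝓗.right.s (𝓗.right.π (w k))) 1 (𝓗.right.γ h) := by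
      intro k
      obtain ⟨c, p, q, h₁⟩ := exists_rep (𝓗.left.γ (w k))
      rw [BalTensor₃.lift_assocR_sum f hf₁ hf₂ h₁]
      simp only [hf]
      rw [← AddMonoidHom.finsetSum_apply, ← map_sum, hi.sum_S_symm_mul hnd _ h₁]
      have h₃ := hT (z k) 1 (𝓗.right.π (w k))
      rw [one_mul] at h₃
      exact h₃.symm
    simp only [h₂]
    rw [← AddMonoidHom.finsetSum_apply, ← AddMonoidHom.finsetSum_apply, ← map_sum,
      𝓗.right.counit_right i m z w hz, 𝓗.right.mulLeft₂Hom_apply]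
    obtain ⟨k, p, q, h₁⟩ := exists_rep (𝓗.right.γ h)
    rw [h₁, map_sum, ← 𝓗.right.counit_left h k p q h₁, tmul_sum]
    refine Finset.sum_congr rfl fun c _ => ?_
    rw [𝓗.right.mulLeft₂_tmul, one_mul, hi (p c)]
    exact smul_tmul _ _ _

end HopfAlgebroid

/-! ### Left multiplications as endomorphisms of the regular module -/

namespace RightBialgebroid

open BalTensor

variable {A R : Type u} [Ring A] [Ring R] {B : RightBialgebroid A R}

instance : Limits.HasFiniteBiproducts B.Mod :=
  inferInstanceAs (Limits.HasFiniteBiproducts (ModuleCat.{u} Aᵐᵒᵖ))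

theorem lin_whiskerRight_leftMul (a : A) (q : B.Sq) :
    Mod.lin (B.leftMul a ▷ B.reg) q = B.mulLeft₂ a 1 q := by
  refine DFunLike.congr_fun (hom_ext (f := (Mod.lin (B.leftMul a ▷ B.reg)).toAddMonoidHom)
    (g := B.mulLeft₂ a 1) (fun (x y : A) => ?_)) q
  exact congrArg (tmul (rightAct B.s A) (leftAct B.t A) (a * x)) (one_mul y).symm

theorem lin_whiskerLeft_leftMul (a : A) (q : B.Sq) :
    Mod.lin (B.reg ◁ B.leftMul a) q = B.mulLeft₂ 1 a q := by
  refine DFunLike.congr_fun (hom_ext (f := (Mod.lin (B.reg ◁ B.leftMul a)).toAddMonoidHom)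
    (g := B.mulLeft₂ 1 a) (fun (x y : A) => ?_)) q
  exact congrArg (fun z => tmul (rightAct B.s A) (leftAct B.t A) z (a * y)) (one_mul x).symm

theorem Mod.lin_sum_apply {M N : B.Mod} {J : Type*} (s : Finset J) (f : J → (M ⟶ N)) (m : M) :
    Mod.lin (∑ j ∈ s, f j) m = ∑ j ∈ s, Mod.lin (f j) m :=
  map_sum (AddMonoidHom.mk' (fun f : M ⟶ N => Mod.lin f m) (fun _ _ => rfl)) f s

theorem leftMul_mul (a b : A) : B.leftMul (a * b) = B.leftMul b ≫ B.leftMul a :=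
  Mod.hom_ext' (LinearMap.ext (fun k : A => mul_assoc a b k))

theorem leftMul_add (a b : A) : B.leftMul (a + b) = B.leftMul a + B.leftMul b :=
  Mod.hom_ext' (LinearMap.ext (fun k : A => add_mul a b k))

end RightBialgebroid

/-! ### The convolution Frobenius monoid, its D2 identities and its quasi-basis -/

namespace HopfAlgebroid

open BalTensor MonObj RightBialgebroid

variable {H R : Type u} {L : Type v} [Ring H] [Ring R] [Ring L] {𝓗 : HopfAlgebroid H L R}
  {i : H} (hi : 𝓗.IsRightIntegral i) (hnd : 𝓗.IsNondegenerate i)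

/-- The unit `η(r) = i s_R(r)` of the convolution monoid. -/
def unitHom (hi : 𝓗.IsRightIntegral i) : 𝟙_ 𝓗.right.Mod ⟶ 𝓗.right.reg :=
  Mod.ofLin (M := Mod.of 𝓗.right 𝓗.right.UnitMod) (N := 𝓗.right.reg)
    { toFun := fun r : R => (i * 𝓗.right.s r : H)
      map_add' := fun (r r' : R) => by
        change i * 𝓗.right.s (r + r') = i * 𝓗.right.s r + i * 𝓗.right.s r'
        rw [map_add, mul_add]
      map_smul' := fun a (r : R) => by
        change i * 𝓗.right.s (𝓗.right.π (𝓗.right.s r * a.unop)) = i * 𝓗.right.s r * a.unop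
        -- `H`-linearity of `η` is the integral property.
        rw [← hi, _root_.mul_assoc] }

/-- The convolution product as a morphism `H_H ⊗ H_H ⟶ H_H`. -/
noncomputable def convHom (hi : 𝓗.IsRightIntegral i) (hnd : 𝓗.IsNondegenerate i) :
    𝓗.right.reg ⊗ 𝓗.right.reg ⟶ 𝓗.right.reg :=
  Mod.ofLin (M := Mod.tensor 𝓗.right.reg 𝓗.right.reg) (N := 𝓗.right.reg)
    (𝓗.right.linOfTmul (M := H) (N := H) (P := H)
      (lift (biadditive (conv hnd) (conv_add_left hi hnd) (conv_add_right hi hnd))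
        (fun r h k => conv_mul_s hi hnd h k r))
      (fun a h k => by
        obtain ⟨n, x, y, ha⟩ := exists_rep (𝓗.right.γ a)
        rw [𝓗.right.smul_tmul_of_rep a h k x y ha, map_sum]
        exact conv_mul hi hnd h k a ha))

/-- The additive map `x ⊗ y ↦ x ⊗ (y ∗ k)`. -/
noncomputable def convRight (k : H) : 𝓗.right.Sq →+ 𝓗.right.Sq :=
  (Mod.lin ((α_ 𝓗.right.reg 𝓗.right.reg 𝓗.right.reg).hom ≫
      𝓗.right.reg ◁ convHom hi hnd)).toAddMonoidHom.comp
    ((tmulHom (rightAct 𝓗.right.s (𝓗.right.reg ⊗ 𝓗.right.reg : 𝓗.right.Mod))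
      (leftAct 𝓗.right.t 𝓗.right.reg)).flip k)

theorem convRight_tmul (x y k : H) :
    convRight hi hnd k (tmul _ _ x y) = tmul _ _ x (conv hnd y k) := rfl

/-- The additive map `x ⊗ y ↦ (h ∗ x) ⊗ y`. -/
noncomputable def convLeft (h : H) : 𝓗.right.Sq →+ 𝓗.right.Sq :=
  (Mod.lin ((α_ 𝓗.right.reg 𝓗.right.reg 𝓗.right.reg).inv ≫
      convHom hi hnd ▷ 𝓗.right.reg)).toAddMonoidHom.comp
    (tmulHom (rightAct 𝓗.right.s 𝓗.right.reg)
      (leftAct 𝓗.right.t (𝓗.right.reg ⊗ 𝓗.right.reg : 𝓗.right.Mod)) h)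

theorem convLeft_tmul (h x y : H) :
    convLeft hi hnd h (tmul _ _ x y) = tmul _ _ (conv hnd h x) y := rfl

theorem convRight_γR (h k : H) :
    convRight hi hnd k (𝓗.right.γ h) = 𝓗.right.γ (conv hnd h k) := by
  obtain ⟨n, x, y, hh⟩ := exists_rep (𝓗.right.γ h)
  rw [γR_conv_right hnd h k hh, hh, map_sum]
  rfl

theorem convLeft_γR (h k : H) :
    convLeft hi hnd h (𝓗.right.γ k) = 𝓗.right.γ (conv hnd h k) := by
  obtain ⟨n, x, y, hk⟩ := exists_rep (𝓗.right.γ k)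
  rw [γR_conv_left hnd h k hk, hk, map_sum]
  rfl

/-- The two operators act on different legs. -/
theorem mulLeft₂_convRight (a k : H) (q : 𝓗.right.Sq) :
    𝓗.right.mulLeft₂ a 1 (convRight hi hnd k q) = convRight hi hnd k (𝓗.right.mulLeft₂ a 1 q) :=
  DFunLike.congr_fun (hom_ext (f := (𝓗.right.mulLeft₂ a 1).comp (convRight hi hnd k))
    (g := (convRight hi hnd k).comp (𝓗.right.mulLeft₂ a 1)) (fun x y => by
      simp only [AddMonoidHom.comp_apply, convRight_tmul, mulLeft₂_tmul, _root_.one_mul])) q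

theorem mulLeft₂_convLeft (a h : H) (q : 𝓗.right.Sq) :
    𝓗.right.mulLeft₂ 1 a (convLeft hi hnd h q) = convLeft hi hnd h (𝓗.right.mulLeft₂ 1 a q) :=
  DFunLike.congr_fun (hom_ext (f := (𝓗.right.mulLeft₂ 1 a).comp (convLeft hi hnd h))
    (g := (convLeft hi hnd h).comp (𝓗.right.mulLeft₂ 1 a)) (fun x y => by
      simp only [AddMonoidHom.comp_apply, convLeft_tmul, mulLeft₂_tmul, _root_.one_mul])) q

/-- The convolution monoid `(H_H, ∗, η)`. -/
noncomputable abbrev convMonObj : MonObj 𝓗.right.reg where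
  one := unitHom hi
  mul := convHom hi hnd
  one_mul := Mod.tensor_ext (fun (r : R) (m : H) => by
    change conv hnd (i * 𝓗.right.s r) m = m * 𝓗.right.t (op r)
    rw [conv_mul_s hi, conv_integral_left])
  mul_one := Mod.tensor_ext (fun (m : H) (r : R) => by
    change conv hnd m (i * 𝓗.right.s r) = m * 𝓗.right.s r
    -- Since `γ_R(s_R(r)) = 1 ⊗ s_R(r)`, linearity of `∗` gives `m ∗ (i s_R(r)) = (m ∗ i) s_R(r)`.
    have h := conv_mul hi hnd m i (𝓗.right.s r) (x := fun _ : Fin 1 => 1)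
      (y := fun _ => 𝓗.right.s r) (by simpa using 𝓗.right.γ_s r)
    rw [conv_integral_right] at h
    simpa using h)
  mul_assoc := Mod.tensor_ext₃ (fun (h k l : H) => conv_assoc hnd h k l)

theorem isConvolution :
    letI := convMonObj hi hnd
    𝓗.IsConvolution hnd :=
  letI := convMonObj hi hnd
  { mul := fun _ _ => rfl
    one := fun _ => rfl }

/-- The convolution monoid with the coproduct and the counit of the right bialgebroid is a
Frobenius monoid. -/
theorem isFrobenius :
    letI := convMonObj hi hnd
    BIM.IsFrobenius 𝓗.monReg 𝓗.right.comulHom 𝓗.right.counitHom :=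
  letI := convMonObj hi hnd
  { left := Mod.tensor_ext (fun (h k : H) => convLeft_γR hi hnd h k)
    right := Mod.tensor_ext (fun (h k : H) => convRight_γR hi hnd h k)
    counit_left := Mod.hom_ext' (LinearMap.ext (fun h : H => by
      obtain ⟨n, x, y, hh⟩ := exists_rep (𝓗.right.γ h)
      change Mod.lin (𝓗.right.counitHom ▷ 𝓗.right.reg ≫ (λ_ 𝓗.right.reg).hom) (𝓗.right.γ h) = h
      refine Eq.trans ?_ (𝓗.right.counit_left h n x y hh)
      rw [hh]
      exact map_sum _ _ _))
    counit_right := Mod.hom_ext' (LinearMap.ext (fun h : H => by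
      obtain ⟨n, x, y, hh⟩ := exists_rep (𝓗.right.γ h)
      change Mod.lin (𝓗.right.reg ◁ 𝓗.right.counitHom ≫ (ρ_ 𝓗.right.reg).hom) (𝓗.right.γ h) = h
      refine Eq.trans ?_ (𝓗.right.counit_right h n x y hh)
      rw [hh]
      exact map_sum _ _ _)) }

/-- By a Frobenius relation a term sends `h ⊗ k` to `S(i₁)(i₂h)⁽¹⁾ ⊗ ((i₂h)⁽²⁾ ∗ k)`. The sum is `h
⊗ (i ∗ k)`, and `i` is the unit. -/
theorem sum_leftMul_left {n : ℕ} {x y : Fin n → H}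
    (hx : 𝓗.left.γ i = ∑ j, tmul _ _ (x j) (y j)) :
    ∑ j, 𝓗.right.leftMul (y j) ▷ 𝓗.right.reg ≫ convHom hi hnd ≫ 𝓗.right.comulHom ≫
      𝓗.right.leftMul (𝓗.S (x j)) ▷ 𝓗.right.reg = 𝟙 (𝓗.right.reg ⊗ 𝓗.right.reg) := by
  refine Mod.tensor_ext (fun (h k : H) => ?_)
  refine (Mod.lin_sum_apply _ _ _).trans ?_
  have hj : ∀ j, Mod.lin (𝓗.right.leftMul (y j) ▷ 𝓗.right.reg ≫ convHom hi hnd ≫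
      𝓗.right.comulHom ≫ 𝓗.right.leftMul (𝓗.S (x j)) ▷ 𝓗.right.reg) (tmul _ _ h k) =
      convRight hi hnd k (𝓗.right.mulLeft₂ (𝓗.S (x j)) 1 (𝓗.right.γ (y j * h))) := by
    intro j
    refine (lin_whiskerRight_leftMul (𝓗.S (x j)) (𝓗.right.γ (conv hnd (y j * h) k))).trans ?_
    rw [← mulLeft₂_convRight, convRight_γR]
  refine (Finset.sum_congr rfl (fun j _ => hj j)).trans ?_
  refine (map_sum (convRight hi hnd k) _ _).symm.trans ?_
  rw [hi.sum_mulLeft₂_S hx h, convRight_tmul, conv_integral_left]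
  rfl

/-- By the other Frobenius relation the sum sends `h ⊗ k` to `(h ∗ (i₁k)⁽¹⁾) ⊗ S⁻¹(i₂)(i₁k)⁽²⁾ = (h
∗ i) ⊗ k`. -/
theorem sum_leftMul_right {n : ℕ} {x y : Fin n → H}
    (hx : 𝓗.left.γ i = ∑ j, tmul _ _ (x j) (y j)) :
    ∑ j, 𝓗.right.reg ◁ 𝓗.right.leftMul (x j) ≫ convHom hi hnd ≫ 𝓗.right.comulHom ≫
      𝓗.right.reg ◁ 𝓗.right.leftMul (𝓗.S.symm (y j)) = 𝟙 (𝓗.right.reg ⊗ 𝓗.right.reg) := by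
  refine Mod.tensor_ext (fun (h k : H) => ?_)
  refine (Mod.lin_sum_apply _ _ _).trans ?_
  have hj : ∀ j, Mod.lin (𝓗.right.reg ◁ 𝓗.right.leftMul (x j) ≫ convHom hi hnd ≫
      𝓗.right.comulHom ≫ 𝓗.right.reg ◁ 𝓗.right.leftMul (𝓗.S.symm (y j))) (tmul _ _ h k) =
      convLeft hi hnd h (𝓗.right.mulLeft₂ 1 (𝓗.S.symm (y j)) (𝓗.right.γ (x j * k))) := by
    intro j
    refine (lin_whiskerLeft_leftMul (𝓗.S.symm (y j)) (𝓗.right.γ (conv hnd h (x j * k)))).trans ?_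
    rw [← mulLeft₂_convLeft, convLeft_γR]
  refine (Finset.sum_congr rfl (fun j _ => hj j)).trans ?_
  refine (map_sum (convLeft hi hnd h) _ _).symm.trans ?_
  rw [hi.sum_mulLeft₂_S_symm hnd hx k, convLeft_tmul, conv_integral_right]
  rfl

section LeftMultiplication

variable [MonObj 𝓗.right.reg]

theorem Lam_mul (a b : H) : 𝓗.Lam (a * b) = 𝓗.Lam b ≫ 𝓗.Lam a := by
  refine Eq.trans ?_ (BIM.conj_comp (Q := 𝓗.monReg) (𝓗.right.leftMul b) (𝓗.right.leftMul a))
  exact congrArg (BIM.conj (Q := 𝓗.monReg)) (leftMul_mul a b)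

theorem Lam_add (a b : H) : 𝓗.Lam (a + b) = 𝓗.Lam a + 𝓗.Lam b := by
  have h : BIM.ofHom (𝓗.right.leftMul (a + b)) =
      BIM.ofHom (𝓗.right.leftMul a) + BIM.ofHom (𝓗.right.leftMul b) :=
    BIM.hom_inj (leftMul_add a b)
  simp only [Lam, h, Preadditive.add_comp, Preadditive.comp_add]

/-- Left multiplication by `s_L(l)` is right `𝒬`-linear by `conv_sL_mul`, so it comes from `E`. -/
theorem exists_Lam_sL_eq (hc : 𝓗.IsConvolution hnd) (l : L) :
    ∃ e : 𝓗.calX ⟶ 𝓗.calX, 𝓗.Lam (𝓗.left.s l) = Bicategory.whiskerRight e 𝓗.calXbar :=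
  ⟨_, BIM.conj_eq_whiskerRight (Q := 𝓗.monReg) (𝓗.right.leftMul (𝓗.left.s l))
    (Mod.tensor_ext (fun (h k : H) =>
      (congrArg (fun z : H => 𝓗.left.s l * z) (hc.mul h k)).trans
        ((conv_sL_mul hnd l h k).symm.trans (hc.mul (𝓗.left.s l * h) k).symm)))⟩

/-- The additive map `x ⊗ y ↦ Λ(S(x)) ⊗ Λ(y)`. -/
noncomputable def LamTensor (hc : 𝓗.IsConvolution hnd) :
    𝓗.left.Sq →+ EndTensor 𝓗.calX 𝓗.calXbar :=
  lift (biadditive (fun x y => tmul _ _ (𝓗.Lam (𝓗.S x)) (𝓗.Lam y))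
      (fun x x' y => by rw [map_add, Lam_add, add_tmul])
      (fun x y y' => by rw [Lam_add, tmul_add]))
    (fun l x y => by
      change tmul _ _ (𝓗.Lam (𝓗.S (𝓗.left.t (op l) * x))) (𝓗.Lam y) =
        tmul _ _ (𝓗.Lam (𝓗.S x)) (𝓗.Lam (𝓗.left.s l * y))
      -- As `S(t_L(l) x) = S(x) s_L(l)`, both sides carry `Λ(s_L(l)) = e × 𝒳̄`, which moves across
      -- `⊗_E`.
      obtain ⟨e, he⟩ := exists_Lam_sL_eq hnd hc l
      rw [S_tL_mul, Lam_mul, Lam_mul, he]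
      exact smul_tmul e _ _)

end LeftMultiplication

end HopfAlgebroid

/-- Let `𝓗` be a Hopf algebroid with a non-degenerate right integral `i`. The convolution product
makes the right regular module a monoid `𝒬` of `ℳ_H`; the 1-cell `𝒳 = (H_H, l_H, ∗)` of
`BIM(ℳ_H)` is Frobenius with two-sided dual `𝒳̄ = (H_H, ∗, r_H)`, it satisfies the (left and right)
D2 condition, and `Λ(S(i₁)) ⊗ Λ(i₂)` is a D2 quasi-basis. -/
theorem mainTheorem7 {H R : Type u} {L : Type v} [Ring H] [Ring R] [Ring L]
    (𝓗 : HopfAlgebroid H L R) (i : H) (hi : 𝓗.IsRightIntegral i) (hnd : 𝓗.IsNondegenerate i) :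
    ∃ _ : MonObj 𝓗.right.reg, 𝓗.IsConvolution hnd ∧
      ∃ (adjL : Bicategory.Adjunction 𝓗.calX 𝓗.calXbar)
        (adjR : Bicategory.Adjunction 𝓗.calXbar 𝓗.calX),
        𝓗.IsCanonicalDuality adjL adjR ∧
        IsLeftD2 𝓗.calX 𝓗.calXbar ∧ IsRightD2 𝓗.calX 𝓗.calXbar ∧
        ∃ q : EndTensor 𝓗.calX 𝓗.calXbar,
          (∀ (n : ℕ) (x y : Fin n → H), 𝓗.left.γ i = ∑ j, BalTensor.tmul _ _ (x j) (y j) →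
            q = ∑ j, BalTensor.tmul _ _ (𝓗.Lam (𝓗.S (x j))) (𝓗.Lam (y j))) ∧
          IsD2QuasiBasis adjL.counit adjR.unit q := by
  let := HopfAlgebroid.convMonObj hi hnd
  have hc : 𝓗.IsConvolution hnd := HopfAlgebroid.isConvolution hi hnd
  have F : BIM.IsFrobenius 𝓗.monReg 𝓗.right.comulHom 𝓗.right.counitHom :=
    HopfAlgebroid.isFrobenius hi hnd
  -- One decomposition of `γ_L(i)` serves both D2 conditions and the quasi-basis identity.
  obtain ⟨m, x, y, hx⟩ := BalTensor.exists_rep (𝓗.left.γ i)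
  have hl := HopfAlgebroid.sum_leftMul_left hi hnd hx
  have hr := HopfAlgebroid.sum_leftMul_right hi hnd hx
  have hq : ∀ (n : ℕ) (x y : Fin n → H), 𝓗.left.γ i = ∑ j, BalTensor.tmul _ _ (x j) (y j) →
      HopfAlgebroid.LamTensor hnd hc (𝓗.left.γ i) =
        ∑ j, BalTensor.tmul _ _ (𝓗.Lam (𝓗.S (x j))) (𝓗.Lam (y j)) := by
    intro n x y h
    rw [h, map_sum]
    rfl
  refine ⟨inferInstance, hc, BIM.adjL 𝓗.monReg, BIM.adjR F, ⟨?_, ?_, ?_, rfl⟩,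
    BIM.isLeftD2_of_sum F (fun j => 𝓗.right.leftMul (y j))
      (fun j => 𝓗.right.leftMul (𝓗.S (x j))) hl,
    BIM.isRightD2_of_sum F (fun j => 𝓗.right.leftMul (x j))
      (fun j => 𝓗.right.leftMul (𝓗.S.symm (y j))) hr,
    HopfAlgebroid.LamTensor hnd hc (𝓗.left.γ i), hq, ?_⟩
  · exact BIM.proj_mulCell 𝓗.monReg
  · refine (congrArg (· ≫ BIM.hom (BIM.multIso 𝓗.monReg).hom)
      (BIM.hom_oneCell 𝓗.monReg)).trans ((Category.assoc _ _ _).trans ?_)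
    exact (congrArg (MonObj.one (X := 𝓗.right.reg) ≫ ·)
      (BIM.hom_isoInv_hom (BIM.multIso 𝓗.monReg))).trans (Category.comp_id _)
  · exact congrArg (BIM.hom (BIM.multIso 𝓗.monReg).hom ≫ ·)
      (Category.comp_id 𝓗.right.counitHom)
  · rw [hq m x y hx]
    exact BIM.isD2QuasiBasis_of_rep _ _ _ _ (BIM.sum_conj_left F
      (fun j => 𝓗.right.leftMul (y j)) (fun j => 𝓗.right.leftMul (𝓗.S (x j))) hl)
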